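/- Let $J\subseteq\mathbb R$ be an open interval. All functions of $u$ below are smooth real functions on $J$. A local functional $\int h\,dx$ is the class of a differential polynomial $h(u;u_x,u_{xx},\dots)$ (polynomial in $u_x,u_{xx},\dots$ with smooth functions of $u$ as coefficients) modulo the image of the total derivative $\partial_x$; the variational derivative is $\frac{\delta H}{\delta u(x)}=\frac{\partial h}{\partial u}-\partial_x\frac{\partial h}{\partial u_x}+\partial_x^2\frac{\partial h}{\partial u_{xx}}-\cdots$, and the Poisson bracket is $\{H,F\}=\int\frac{\delta H}{\delta u(x)}\,\partial_x\frac{\delta F}{\delta u(x)}\,dx$. A Hamiltonian is a formal series $H=\sum_{n\ge 0}\varepsilon^nH_n$ of the form $\int h(u,\varepsilon u_x,\varepsilon^2u_{xx},\dots)\,dx$, that is, each $H_n$ has a density that is homogeneous of degree $n$, where $\deg u^{(k)}=k$ and functions of $u$ have degree $0$. The canonical transformation $u\mapsto u+\varepsilon\{u,K\}+\frac{\varepsilon^2}{2!}\{\{u,K\},K\}+\cdots$ generated by a Hamiltonian $K$ takes $H$ to $H+\varepsilon\{H,K\}+\frac{\varepsilon^2}{2!}\{\{H,K\},K\}+\cdots$.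 A Hamiltonian $H=\int\frac{u^3}{6}\,dx+O(\varepsilon)$ is called $N$-integrable if there are Hamiltonians $H_f=\int f(u)\,dx+O(\varepsilon)$, one for each smooth function $f$, such that $H_f=H$ for $f=u^3/6$ and $\{H_f,H_g\}=O(\varepsilon^{N+1})$ for all $f,g$. **1)** For every Hamiltonian $H=\int\frac{u^3}{6}\,dx+O(\varepsilon)$ there are a canonical transformation and smooth functions $c,p,\alpha,\beta$ of $u$ such that the transformation takes $H$, modulo $O(\varepsilon^7)$, to $$\int\Big[\frac{u^3}{6}-\frac{\varepsilon^2}{2}c(u)u_x^2+\varepsilon^4p(u)u_{xx}^2-\varepsilon^6\big(\alpha(u)u_{xxx}^2+\beta(u)u_{xx}^3\big)\Big]dx.\qquad(*)$$ The Hamiltonian $(*)$ is $7$-integrable for arbitrary smooth functions $c,p,\alpha,\beta$. **2)** Let $c,p,\alpha,\beta$ be smooth functions such that $c$ and $p$ have no common zero. Then $(*)$ can be extended, by adding terms of order higher than $6$ in $\varepsilon$, to a $9$-integrable Hamiltonian if and only if $c(u)\neq 0$ for all $u\in J$ and $$\alpha=\frac{1}{28}\Big[80\frac{p^2}{c}-67\,p\,c'+33\,c\,p'+12\,c\,(c')^2-9\,c^2c''\Big].$$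 -/

import Mathlib

open scoped ContDiff Nat

/-! ### Differential polynomials over a differential algebra of coefficients

`R` is the algebra of coefficient functions of `u` and `D` is the derivation `d/du` on it.
The variable `X k` of `MvPolynomial ℕ R` stands for the jet coordinate `u^{(k+1)}`, that is
`X 0 = u_x`, `X 1 = u_xx`, `X 2 = u_xxx`, ... -/

/-- Differential polynomials in `u_x, u_xx, ...` with coefficients in `R`. -/
abbrev DiffPoly (R : Type*) [CommRing R] : Type _ := MvPolynomial ℕ R

noncomputable section DifferentialPolynomials

variable {R : Type*} [CommRing R] [Algebra ℝ R] (D : Derivation ℝ R R)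

theorem coeff_sum_monomial (h : DiffPoly R) (n : ℕ →₀ ℕ) :
    (∑ m ∈ h.support, MvPolynomial.monomial m (D (h.coeff m))).coeff n = D (h.coeff n) := by
  classical
  simp only [MvPolynomial.coeff_sum, MvPolynomial.coeff_monomial]
  rw [Finset.sum_ite_eq' h.support n]
  split_ifs with hn
  · rfl
  · rw [MvPolynomial.notMem_support_iff.mp hn, map_zero]

/-- The partial derivative `∂/∂u`: it acts on the coefficients by `D` and fixes every monomial in
the jet coordinates. -/
def partialU : DiffPoly R →ₗ[ℝ] DiffPoly R where
  toFun h := ∑ m ∈ h.support, MvPolynomial.monomial m (D (h.coeff m))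
  map_add' h k := by
    ext n
    rw [MvPolynomial.coeff_add, coeff_sum_monomial, coeff_sum_monomial, coeff_sum_monomial,
      MvPolynomial.coeff_add, map_add]
  map_smul' r h := by
    ext n
    rw [MvPolynomial.coeff_smul, coeff_sum_monomial, coeff_sum_monomial,
      MvPolynomial.coeff_smul, RingHom.id_apply, Derivation.map_smul]

theorem coeff_partialU (h : DiffPoly R) (n : ℕ →₀ ℕ) :
    (partialU D h).coeff n = D (h.coeff n) :=
  coeff_sum_monomial D h n

theorem partialU_monomial (n : ℕ →₀ ℕ) (a : R) :
    partialU D (MvPolynomial.monomial n a) = MvPolynomial.monomial n (D a) := by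
  classical
  ext m
  rw [coeff_partialU, MvPolynomial.coeff_monomial, MvPolynomial.coeff_monomial]
  split_ifs <;> simp

theorem partialU_mul (h k : DiffPoly R) :
    partialU D (h * k) = h * partialU D k + k * partialU D h := by
  induction h using MvPolynomial.induction_on' with
  | monomial n a =>
    induction k using MvPolynomial.induction_on' with
    | monomial m b =>
      simp only [MvPolynomial.monomial_mul, partialU_monomial, Derivation.leibniz, smul_eq_mul,
        map_add, add_comm m n]
    | add p q hp hq => simp only [mul_add, add_mul, map_add, hp, hq]; ring
  | add p q hp hq => simp only [mul_add, add_mul, map_add, hp, hq]; ring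

/-- The part `∑ₖ u^{(k+2)} ∂/∂u^{(k+1)}` of the total derivative. -/
def jetShift : Derivation R (DiffPoly R) (DiffPoly R) :=
  MvPolynomial.mkDerivation R fun k => MvPolynomial.X (k + 1)

/-- The total derivative
`∂ₓ h = u_x ∂h/∂u + u_xx ∂h/∂u_x + u_xxx ∂h/∂u_xx + ...`. -/
def totalDeriv : DiffPoly R →ₗ[ℝ] DiffPoly R :=
  LinearMap.mulLeft ℝ (MvPolynomial.X 0) ∘ₗ partialU D +
    ((jetShift : Derivation R (DiffPoly R) (DiffPoly R)) :
      DiffPoly R →ₗ[R] DiffPoly R).restrictScalars ℝ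

theorem totalDeriv_apply (h : DiffPoly R) :
    totalDeriv D h = MvPolynomial.X 0 * partialU D h + jetShift h := rfl

/-- The partial derivative `∂/∂u^{(j)}` for every `j ≥ 0`. -/
def jetPartial : ℕ → DiffPoly R →ₗ[ℝ] DiffPoly R
  | 0 => partialU D
  | k + 1 => ((MvPolynomial.pderiv k : Derivation R (DiffPoly R) (DiffPoly R)) :
      DiffPoly R →ₗ[R] DiffPoly R).restrictScalars ℝ

/-- `h` does not depend on `u^{(j)}` for `j ≥ jetBound h`. -/
def jetBound (h : DiffPoly R) : ℕ := h.vars.sup (fun k => k + 1) + 1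

theorem jetPartial_eq_zero (h : DiffPoly R) (j : ℕ) (hj : jetBound h ≤ j) :
    jetPartial D j h = 0 := by
  cases j with
  | zero => simp [jetBound] at hj
  | succ k =>
    refine MvPolynomial.pderiv_eq_zero_of_notMem_vars fun hk => ?_
    have := Finset.le_sup (f := fun k => k + 1) hk
    simp only [jetBound] at hj
    omega

theorem sum_jetPartial_eq (h : DiffPoly R) (N : ℕ) (hN : jetBound h ≤ N) :
    ∑ j ∈ Finset.range N, ((-totalDeriv D) ^ j) (jetPartial D j h) =
      ∑ j ∈ Finset.range (jetBound h), ((-totalDeriv D) ^ j) (jetPartial D j h) := by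
  symm
  refine Finset.sum_subset (Finset.range_mono hN) fun j _ hj => ?_
  rw [jetPartial_eq_zero D h j (by simpa using hj), map_zero]

/-- The Euler--Lagrange derivative of a density,
`∂h/∂u - ∂ₓ(∂h/∂u_x) + ∂ₓ²(∂h/∂u_xx) - ...` (all the terms beyond `jetBound h` are zero). -/
def eulerLagrange : DiffPoly R →ₗ[ℝ] DiffPoly R where
  toFun h := ∑ j ∈ Finset.range (jetBound h), ((-totalDeriv D) ^ j) (jetPartial D j h)
  map_add' h k := by
    have e1 := sum_jetPartial_eq D h (max (jetBound (h + k)) (max (jetBound h) (jetBound k)))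
      (by simp)
    have e2 := sum_jetPartial_eq D k (max (jetBound (h + k)) (max (jetBound h) (jetBound k)))
      (by simp)
    have e3 := sum_jetPartial_eq D (h + k)
      (max (jetBound (h + k)) (max (jetBound h) (jetBound k))) (by simp)
    rw [← e1, ← e2, ← e3, ← Finset.sum_add_distrib]
    simp only [map_add]
  map_smul' r h := by
    have e1 := sum_jetPartial_eq D h (max (jetBound (r • h)) (jetBound h)) (by simp)
    have e2 := sum_jetPartial_eq D (r • h) (max (jetBound (r • h)) (jetBound h)) (by simp)
    rw [RingHom.id_apply, ← e1, ← e2, Finset.smul_sum]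
    simp only [map_smul]

theorem eulerLagrange_eq_sum (h : DiffPoly R) (N : ℕ) (hN : jetBound h ≤ N) :
    eulerLagrange D h =
      ∑ j ∈ Finset.range N, ((-totalDeriv D) ^ j) (jetPartial D j h) :=
  (sum_jetPartial_eq D h N hN).symm

theorem totalDeriv_mul (h k : DiffPoly R) :
    totalDeriv D (h * k) = h * totalDeriv D k + k * totalDeriv D h := by
  simp only [totalDeriv_apply, partialU_mul, Derivation.leibniz, smul_eq_mul]
  ring

theorem totalDeriv_C (a : R) :
    totalDeriv D (MvPolynomial.C a) = MvPolynomial.X 0 * MvPolynomial.C (D a) := by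
  rw [totalDeriv_apply, MvPolynomial.C_apply, partialU_monomial, ← MvPolynomial.C_apply,
    ← MvPolynomial.C_apply, jetShift, MvPolynomial.derivation_C, add_zero]

theorem partialU_X (k : ℕ) : partialU D (MvPolynomial.X k) = 0 := by
  rw [MvPolynomial.X, partialU_monomial, Derivation.map_one_eq_zero, map_zero]

theorem totalDeriv_X (k : ℕ) :
    totalDeriv D (MvPolynomial.X k) = MvPolynomial.X (k + 1) := by
  rw [totalDeriv_apply, partialU_X, jetShift, MvPolynomial.mkDerivation_X, mul_zero, zero_add]

theorem jetPartial_mul (j : ℕ) (h k : DiffPoly R) :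
    jetPartial D j (h * k) = h * jetPartial D j k + k * jetPartial D j h := by
  cases j with
  | zero => exact partialU_mul D h k
  | succ j => exact Derivation.leibniz (MvPolynomial.pderiv j) h k

theorem jetPartial_zero_totalDeriv (h : DiffPoly R) :
    jetPartial D 0 (totalDeriv D h) = totalDeriv D (jetPartial D 0 h) := by
  change partialU D (totalDeriv D h) = totalDeriv D (partialU D h)
  induction h using MvPolynomial.induction_on with
  | C a =>
    rw [totalDeriv_C, partialU_mul, partialU_X, mul_zero, add_zero, MvPolynomial.C_apply,
      MvPolynomial.C_apply, partialU_monomial, partialU_monomial, ← MvPolynomial.C_apply,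
      ← MvPolynomial.C_apply, totalDeriv_C]
  | add p q hp hq => simp only [map_add, hp, hq]
  | mul_X p k hp =>
    simp only [totalDeriv_mul, partialU_mul, map_add, totalDeriv_X, partialU_X, hp, mul_zero,
      zero_add, add_zero]
    ring

theorem jetPartial_succ_totalDeriv (j : ℕ) (h : DiffPoly R) :
    jetPartial D (j + 1) (totalDeriv D h) =
      totalDeriv D (jetPartial D (j + 1) h) + jetPartial D j h := by
  classical
  induction h using MvPolynomial.induction_on with
  | C a =>
    have h1 : ∀ (i : ℕ) (b : R), jetPartial D (i + 1) (MvPolynomial.C b) = 0 := fun i b =>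
      MvPolynomial.pderiv_C
    rw [totalDeriv_C, jetPartial_mul, h1, h1, map_zero, mul_zero, zero_add, zero_add]
    cases j with
    | zero =>
      change MvPolynomial.C (D a) * MvPolynomial.pderiv 0 (MvPolynomial.X 0) =
        partialU D (MvPolynomial.C a)
      rw [MvPolynomial.pderiv_X_self, mul_one, MvPolynomial.C_apply, MvPolynomial.C_apply,
        partialU_monomial]
    | succ j =>
      rw [h1]
      change MvPolynomial.C (D a) * MvPolynomial.pderiv (j + 1) (MvPolynomial.X 0) = 0
      rw [MvPolynomial.pderiv_X_of_ne (by omega), mul_zero]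
  | add p q hp hq => simp only [map_add, hp, hq]; ring
  | mul_X p k hp =>
    have hX : jetPartial D (j + 1) (MvPolynomial.X (k + 1)) =
        totalDeriv D (jetPartial D (j + 1) (MvPolynomial.X k)) +
          jetPartial D j (MvPolynomial.X k) := by
      have h1 : totalDeriv D (jetPartial D (j + 1) (MvPolynomial.X k)) = 0 := by
        change totalDeriv D (MvPolynomial.pderiv j (MvPolynomial.X k)) = 0
        rw [MvPolynomial.pderiv_X]
        by_cases hjk : j = k
        · subst hjk
          rw [Pi.single_eq_same, ← MvPolynomial.C_1, totalDeriv_C, Derivation.map_one_eq_zero,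
            map_zero, mul_zero]
        · rw [Pi.single_eq_of_ne (by omega), map_zero]
      rw [h1, zero_add]
      cases j with
      | zero =>
        change MvPolynomial.pderiv 0 (MvPolynomial.X (k + 1)) = partialU D (MvPolynomial.X k)
        rw [partialU_X, MvPolynomial.pderiv_X_of_ne (by omega)]
      | succ j =>
        change MvPolynomial.pderiv (j + 1) (MvPolynomial.X (k + 1)) =
          MvPolynomial.pderiv j (MvPolynomial.X k)
        rw [MvPolynomial.pderiv_X, MvPolynomial.pderiv_X]
        by_cases hjk : j = k
        · subst hjk
          rw [Pi.single_eq_same, Pi.single_eq_same]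
        · rw [Pi.single_eq_of_ne (by omega), Pi.single_eq_of_ne (by omega)]
    simp only [totalDeriv_mul, jetPartial_mul, map_add, totalDeriv_X, hp, hX]
    ring

/-- The Euler--Lagrange derivative of a total derivative is zero. -/
theorem eulerLagrange_totalDeriv (h : DiffPoly R) :
    eulerLagrange D (totalDeriv D h) = 0 := by
  set N := max (jetBound (totalDeriv D h)) (jetBound h) with hN
  have tele : ∀ M : ℕ, ∑ j ∈ Finset.range (M + 1),
      ((-totalDeriv D) ^ j) (jetPartial D j (totalDeriv D h)) =
        -(((-totalDeriv D) ^ (M + 1)) (jetPartial D M h)) := by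
    intro M
    induction M with
    | zero =>
      simp [jetPartial_zero_totalDeriv]
    | succ M ih =>
      rw [Finset.sum_range_succ, ih, jetPartial_succ_totalDeriv, map_add,
        pow_succ (-totalDeriv D) (M + 1), Module.End.mul_apply, LinearMap.neg_apply, map_neg]
      abel
  rw [eulerLagrange_eq_sum D _ (N + 1) (by omega), tele,
    jetPartial_eq_zero D h N (by omega), map_zero, neg_zero]

/-- Local functionals `∫ h dx` of the formal calculus of variations: densities modulo the image of
the total derivative. -/
abbrev LocalFunctional : Type _ := DiffPoly R ⧸ LinearMap.range (totalDeriv D)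

/-- The local functional `∫ h dx` of a density `h`. -/
def functional : DiffPoly R →ₗ[ℝ] LocalFunctional D := (LinearMap.range (totalDeriv D)).mkQ

/-- The variational derivative `δH/δu(x)` of a local functional `H`. -/
def varDeriv : LocalFunctional D →ₗ[ℝ] DiffPoly R :=
  (LinearMap.range (totalDeriv D)).liftQ (eulerLagrange D) (by
    rintro _ ⟨h, rfl⟩
    exact eulerLagrange_totalDeriv D h)

/-- The Poisson bracket `{H, F} = ∫ (δH/δu) ∂ₓ (δF/δu) dx`. -/
def poissonBracket (H F : LocalFunctional D) : LocalFunctional D :=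
  functional D (varDeriv D H * totalDeriv D (varDeriv D F))

/-- Formal series `H = H₀ + ε H₁ + ε² H₂ + ...` of local functionals. -/
abbrev HamSeries : Type _ := ℕ → LocalFunctional D

/-- `H` is of the form `∫ h(u, ε u_x, ε² u_xx, ...) dx`: the coefficient of `ε^n` has a density
that is homogeneous of degree `n`, where `u^{(k)}` has degree `k` and functions of `u` have
degree `0`. -/
def IsGraded (H : HamSeries D) : Prop :=
  ∀ n, ∃ h : DiffPoly R,
    MvPolynomial.IsWeightedHomogeneous (fun k : ℕ => k + 1) h n ∧ functional D h = H n

/-- The Poisson bracket of two series in `ε`. -/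
def seriesBracket (H F : HamSeries D) : HamSeries D := fun n =>
  ∑ ij ∈ Finset.HasAntidiagonal.antidiagonal n, poissonBracket D (H ij.1) (F ij.2)

/-- The Hamiltonian obtained from `H` by the canonical transformation
`u ↦ u + ε {u, K} + ε²/2! {{u, K}, K} + ...`, that is
`H + ε {H, K} + ε²/2! {{H, K}, K} + ...`. -/
def canonicalTransform (K H : HamSeries D) : HamSeries D := fun n =>
  ∑ m ∈ Finset.range (n + 1),
    ((m ! : ℝ)⁻¹) • ((fun G : HamSeries D => seriesBracket D G K)^[m] H) (n - m)

/-- `H = O(ε^n)`. -/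
def IsBigOEps (H : HamSeries D) (n : ℕ) : Prop := ∀ k < n, H k = 0

/-- The functional `∫ f(u) dx` of a function `f` of `u`. -/
def functionalOf (f : R) : LocalFunctional D := functional D (MvPolynomial.C f)

/-- `H` is an `N`-integrable perturbation of `∫ f₀(u) dx`: there is a family of Hamiltonians
`H_f = ∫ f(u) dx + O(ε)`, one for every function `f`, with `H_{f₀} = H` and
`{H_f, H_g} = O(ε^{N+1})` for all `f` and `g`. -/
def IsIntegrableOf (f₀ : R) (N : ℕ) (H : HamSeries D) : Prop :=
  ∃ F : R → HamSeries D,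
    (∀ f, IsGraded D (F f)) ∧ (∀ f, F f 0 = functionalOf D f) ∧ F f₀ = H ∧
      ∀ f g, IsBigOEps D (seriesBracket D (F f) (F g)) (N + 1)

end DifferentialPolynomials

/-! ### Smooth coefficient functions and the perturbed Hopf Hamiltonian -/

noncomputable section Hopf

/-- Smooth real-valued functions `f = f(u)` of `u` in an open set `J ⊆ ℝ`. -/
def SmoothFn (J : TopologicalSpace.Opens ℝ) : Subalgebra ℝ (J → ℝ) where
  carrier := {f | ContDiffOn ℝ ∞ (Function.extend Subtype.val f 0) J}
  mul_mem' {f g} hf hg := by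
    refine (ContDiffOn.mul hf hg).congr fun x hx => ?_
    lift x to J using hx
    simp
  add_mem' {f g} hf hg := by
    refine (ContDiffOn.add hf hg).congr fun x hx => ?_
    lift x to J using hx
    simp
  algebraMap_mem' r := by
    refine (contDiffOn_const (c := r)).congr fun x hx => ?_
    lift x to J using hx
    simp

variable (J : TopologicalSpace.Opens ℝ)

theorem extend_differentiableAt (f : SmoothFn J) (u : J) :
    DifferentiableAt ℝ (Function.extend Subtype.val (f : J → ℝ) 0) (u : ℝ) :=
  (ContDiffOn.differentiableOn f.2 (by simp)).differentiableAt (J.isOpen.mem_nhds u.2)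

/-- The derivative `d/du` on smooth functions. -/
def smoothDeriv : Derivation ℝ (SmoothFn J) (SmoothFn J) :=
  Derivation.mk'
    { toFun := fun f =>
        ⟨fun u => deriv (Function.extend Subtype.val (f : J → ℝ) 0) (u : ℝ), by
          refine (ContDiffOn.deriv_of_isOpen (m := ∞) f.2 J.isOpen (by simp)).congr
            fun x hx => ?_
          lift x to J using hx
          simp⟩
      map_add' := fun f g => by
        ext u
        have h : Function.extend Subtype.val ((f + g : SmoothFn J) : J → ℝ) 0
            =ᶠ[nhds (u : ℝ)] Function.extend Subtype.val (f : J → ℝ) 0 +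
              Function.extend Subtype.val (g : J → ℝ) 0 := by
          filter_upwards [J.isOpen.mem_nhds u.2] with x hx
          lift x to J using hx
          simp
        change deriv (Function.extend Subtype.val ((f + g : SmoothFn J) : J → ℝ) 0) (u : ℝ) =
          deriv (Function.extend Subtype.val (f : J → ℝ) 0) (u : ℝ) +
          deriv (Function.extend Subtype.val (g : J → ℝ) 0) (u : ℝ)
        rw [h.deriv_eq]
        exact deriv_add (extend_differentiableAt J f u) (extend_differentiableAt J g u)
      map_smul' := fun r f => by
        ext u
        have h : Function.extend Subtype.val ((r • f : SmoothFn J) : J → ℝ) 0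
            =ᶠ[nhds (u : ℝ)] fun x => r * Function.extend Subtype.val (f : J → ℝ) 0 x := by
          filter_upwards [J.isOpen.mem_nhds u.2] with x hx
          lift x to J using hx
          simp
        change deriv (Function.extend Subtype.val ((r • f : SmoothFn J) : J → ℝ) 0) (u : ℝ) =
          r * deriv (Function.extend Subtype.val (f : J → ℝ) 0) (u : ℝ)
        rw [h.deriv_eq]
        exact deriv_const_mul r (extend_differentiableAt J f u) }
    (fun f g => by
      ext u
      have h : Function.extend Subtype.val ((f * g : SmoothFn J) : J → ℝ) 0
          =ᶠ[nhds (u : ℝ)] Function.extend Subtype.val (f : J → ℝ) 0 *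
            Function.extend Subtype.val (g : J → ℝ) 0 := by
        filter_upwards [J.isOpen.mem_nhds u.2] with x hx
        lift x to J using hx
        simp
      change deriv (Function.extend Subtype.val ((f * g : SmoothFn J) : J → ℝ) 0) (u : ℝ) =
        (f : J → ℝ) u * deriv (Function.extend Subtype.val (g : J → ℝ) 0) (u : ℝ) +
        (g : J → ℝ) u * deriv (Function.extend Subtype.val (f : J → ℝ) 0) (u : ℝ)
      rw [h.deriv_eq, deriv_mul (extend_differentiableAt J f u) (extend_differentiableAt J g u),
        Subtype.val_injective.extend_apply, Subtype.val_injective.extend_apply]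
      ring)

/-- The function `u³/6`. -/
def cubicHopf : SmoothFn J :=
  ⟨fun u => (u : ℝ) ^ 3 / 6, by
    have h : ContDiffOn ℝ ∞ (fun x : ℝ => x ^ 3 / 6) J := by fun_prop
    refine h.congr fun x hx => ?_
    lift x to J using hx
    simp⟩

variable {J}

/-- The normal form
`H = ∫ [u³/6 - ε²/2 c(u) u_x² + ε⁴ p(u) u_xx² - ε⁶ (α(u) u_xxx² + β(u) u_xx³)] dx`. -/
def normalForm (c p α β : SmoothFn J) : HamSeries (smoothDeriv J)
  | 0 => functionalOf (smoothDeriv J) (cubicHopf J)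
  | 2 => functional (smoothDeriv J)
      (-((1 / 2 : ℝ) • (MvPolynomial.C c * MvPolynomial.X 0 ^ 2)))
  | 4 => functional (smoothDeriv J) (MvPolynomial.C p * MvPolynomial.X 1 ^ 2)
  | 6 => functional (smoothDeriv J)
      (-(MvPolynomial.C α * MvPolynomial.X 2 ^ 2 + MvPolynomial.C β * MvPolynomial.X 1 ^ 3))
  | _ => 0

/-- `N`-integrable perturbations of the Hopf Hamiltonian `∫ u³/6 dx`. -/
def IsNIntegrable (N : ℕ) (H : HamSeries (smoothDeriv J)) : Prop :=
  IsIntegrableOf (smoothDeriv J) (cubicHopf J) N H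

/-- `H` can be extended, by terms of order higher than `6` in `ε`, to an `N`-integrable
perturbation of the Hopf Hamiltonian. -/
def ExtendsToNIntegrable (N : ℕ) (H : HamSeries (smoothDeriv J)) : Prop :=
  ∃ H' : HamSeries (smoothDeriv J),
    IsGraded (smoothDeriv J) H' ∧ (∀ n ≤ 6, H' n = H n) ∧ IsNIntegrable N H'

end Hopf

/-! Put f₀ = u³/6 and H₀ = ∫ f₀ dx. Everything rests on the linear map G ↦ {G, H₀}, which raises the
differential degree by one. Call a monomial in the jet variables reduced if its highest jet variable
does not occur linearly. Integration by parts brings every functional to reduced monomials, and in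
positive degree this form is unique, because a total derivative is at most linear in its highest jet
variable (`exists_reduced_density`, `eq_zero_of_functional_eq_zero`). Since f₀''' = 1, the map sends
a monomial m to (Λ(m) - 1) u_x m plus terms of smaller key, and Λ(m) ≥ 2 when m is reduced and
nonconstant (`hopfOp_monomial`, `one_lt_hopfWeight`). Hence it is injective in positive degree
(`eq_zero_of_poissonBracket_hopf`), and its image together with the residual monomials, namely u_x²
and the reduced monomials free of u_x, spans everything (`exists_residual_density`).

The residual monomials are u_x² in degree 2, u_xx² in degree 4, u_xxx² and u_xx³ in degree 6, and
none in degrees 1, 3, 5, 7. The term K_n of a generator first acts at order n + 1, by adding {H₀,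
K_n}; removing the image order by order gives the normal form. A deformation of ∫ f dx that commutes
with (*) requires at order n an equation in degree n + 1. For even n ≤ 6 there is no obstruction,
and odd orders vanish by parity. Deformations that commute with H commute with each other, by the
Jacobi identity and injectivity (`seriesBracket_isBigOEps`). This gives 7-integrability.

At order 8 the equation lives in degree 9, whose only residual monomial is u_xxx³. Modulo densities
with at least four jet factors, the bracket of a functional of degree 8 with H₀ is q (9 u_x u_xxxx²
- 10 u_xxx³), so g₁ u_x u_xxxx² + g₂ u_xxx³ is in the image exactly when 10 g₁ + 9 g₂ = 0. The lower
orders determine F₂ and F₄, and F₆ up to four factors; the result is 2 (10 g₁ + 9 g₂) = f'''' ·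
`obstruction` (`exists_obstruction`). A term H₈ only contributes another multiple of (9, -10), so it
cannot help. Taking f'''' = 1 shows that `obstruction` must vanish; conversely its vanishing solves
order 8, and order 9 is odd. Where c = 0 the condition reads p = 0, which is why c cannot vanish. -/

namespace JetCalculus

open MvPolynomial

noncomputable section

variable {R : Type*} [CommRing R] [Algebra ℝ R] (D : Derivation ℝ R R)

/-! ### Homogeneity -/

/-- The weight of a jet variable: `X k` stands for `u^{(k+1)}`. -/
abbrev jetWeight (k : ℕ) : ℕ := k + 1

/-- Differential polynomials that are homogeneous of differential degree `d`. -/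
abbrev IsHom (h : DiffPoly R) (d : ℕ) : Prop := IsWeightedHomogeneous jetWeight h d

theorem IsHom.of_monomial (T : DiffPoly R →ₗ[ℝ] DiffPoly R) (d e : ℕ)
    (hT : ∀ m a, Finsupp.weight jetWeight m = d → IsHom (T (monomial m a)) e)
    {h : DiffPoly R} (hh : IsHom h d) : IsHom (T h) e := by
  rw [h.as_sum, map_sum]
  exact IsWeightedHomogeneous.sum _ _ _ fun m hm => hT m _ (hh (mem_support_iff.mp hm))

theorem isHom_partialU {h : DiffPoly R} {d : ℕ} (hh : IsHom h d) : IsHom (partialU D h) d :=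
  IsHom.of_monomial _ d d (fun m a hm => by
    rw [partialU_monomial]; exact isWeightedHomogeneous_monomial _ _ _ hm) hh

theorem isHom_mkDerivation (t : ℕ → DiffPoly R) (e : ℕ) (ht : ∀ k, IsHom (t k) (k + 1 + e))
    {h : DiffPoly R} {d : ℕ} (hh : IsHom h d) : IsHom (mkDerivation R t h) (d + e) := by
  refine IsHom.of_monomial ((mkDerivation R t : DiffPoly R →ₗ[R] DiffPoly R).restrictScalars ℝ)
    d (d + e) (fun m a hm => ?_) hh
  change IsHom (mkDerivation R t (monomial m a)) (d + e)
  rw [mkDerivation_monomial, smul_eq_C_mul]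
  refine IsWeightedHomogeneous.C_mul (IsWeightedHomogeneous.sum _ _ _ fun i hi => ?_) _
  have h1 : Finsupp.weight jetWeight (m - Finsupp.single i 1) + (i + 1) = d := by
    have h2 : m - Finsupp.single i 1 + Finsupp.single i 1 = m :=
      tsub_add_cancel_of_le (Finsupp.single_le_iff.mpr
        (Nat.one_le_iff_ne_zero.mpr (Finsupp.mem_support_iff.mp hi)))
    rw [← hm]
    conv_rhs => rw [← h2]
    rw [map_add, Finsupp.weight_single]
    simp
  have h3 := (isWeightedHomogeneous_monomial jetWeight (m - Finsupp.single i 1) ((m i : ℕ) : R)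
    rfl).mul (ht i)
  rw [show d + e = Finsupp.weight jetWeight (m - Finsupp.single i 1) + (i + 1 + e) by omega]
  exact h3

theorem isHom_totalDeriv {h : DiffPoly R} {d : ℕ} (hh : IsHom h d) :
    IsHom (totalDeriv D h) (d + 1) := by
  rw [totalDeriv_apply]
  refine IsWeightedHomogeneous.add ?_ ?_
  · rw [add_comm]
    exact (isWeightedHomogeneous_X R jetWeight 0).mul (isHom_partialU D hh)
  · exact isHom_mkDerivation _ 1 (fun k => isWeightedHomogeneous_X R jetWeight (k + 1)) hh

theorem isHom_totalDeriv_iterate {h : DiffPoly R} {d : ℕ} (hh : IsHom h d) (j : ℕ) :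
    IsHom ((totalDeriv D ^ j) h) (d + j) := by
  induction j with
  | zero => simpa using hh
  | succ j ih =>
    rw [pow_succ', Module.End.mul_apply]
    exact isHom_totalDeriv D ih

theorem neg_totalDeriv_pow (j : ℕ) (h : DiffPoly R) :
    ((-totalDeriv D) ^ j) h = (-1 : ℝ) ^ j • (totalDeriv D ^ j) h := by
  rw [← neg_one_smul ℝ (totalDeriv D), smul_pow]; rfl

theorem IsHom.smul_real {h : DiffPoly R} {d : ℕ} (hh : IsHom h d) (r : ℝ) : IsHom (r • h) d :=
  fun m hm => hh fun h0 => hm (by rw [coeff_smul, h0, smul_zero])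

theorem isHom_eulerLagrange {h : DiffPoly R} {d : ℕ} (hh : IsHom h d) :
    IsHom (eulerLagrange D h) d := by
  refine IsWeightedHomogeneous.sum _ _ _ fun j _ => ?_
  rw [neg_totalDeriv_pow]
  refine IsHom.smul_real ?_ _
  cases j with
  | zero => exact isHom_partialU D hh
  | succ j =>
    by_cases hj : j + 1 ≤ d
    · have h1 : IsHom (pderiv j h) (d - (j + 1)) :=
        IsWeightedHomogeneous.pderiv hh (by simp only [jetWeight]; omega)
      have h2 := isHom_totalDeriv_iterate D h1 (j + 1)
      rwa [Nat.sub_add_cancel hj] at h2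
    -- The truncated subtraction d - (j + 1) is wrong here, but a density of degree d contains no
    -- variable of weight above d, so the whole term vanishes.
    · have h0 : jetPartial D (j + 1) h = 0 := by
        change pderiv j h = 0
        ext m
        rw [coeff_pderiv, coeff_zero, hh.coeff_eq_zero, zero_mul]
        rw [map_add, Finsupp.weight_single]
        simp only [jetWeight, smul_eq_mul]
        omega
      rw [h0, map_zero]
      exact isWeightedHomogeneous_zero _ _ _

/-- Local functionals with a density that is homogeneous of degree `d`. -/
def IsHomF (G : LocalFunctional D) (d : ℕ) : Prop := ∃ h, IsHom h d ∧ functional D h = G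

variable {D}

theorem functional_surjective (G : LocalFunctional D) : ∃ h, functional D h = G :=
  Submodule.mkQ_surjective _ G

theorem varDeriv_functional (h : DiffPoly R) :
    varDeriv D (functional D h) = eulerLagrange D h := rfl

theorem functional_eq_zero_iff {h : DiffPoly R} :
    functional D h = 0 ↔ ∃ W, totalDeriv D W = h := by
  rw [functional, Submodule.mkQ_apply, Submodule.Quotient.mk_eq_zero]; rfl

theorem functional_totalDeriv (h : DiffPoly R) : functional D (totalDeriv D h) = 0 :=
  functional_eq_zero_iff.mpr ⟨h, rfl⟩

theorem isHomF_functional {h : DiffPoly R} {d : ℕ} (hh : IsHom h d) :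
    IsHomF D (functional D h) d := ⟨h, hh, rfl⟩

theorem isHomF_zero (d : ℕ) : IsHomF D 0 d :=
  ⟨0, isWeightedHomogeneous_zero _ _ _, map_zero _⟩

theorem IsHomF.add {G G' : LocalFunctional D} {d : ℕ} (h : IsHomF D G d) (h' : IsHomF D G' d) :
    IsHomF D (G + G') d := by
  obtain ⟨k, hk, rfl⟩ := h
  obtain ⟨k', hk', rfl⟩ := h'
  exact ⟨k + k', IsWeightedHomogeneous.add hk hk', map_add _ _ _⟩

theorem IsHomF.smul {G : LocalFunctional D} {d : ℕ} (h : IsHomF D G d) (r : ℝ) :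
    IsHomF D (r • G) d := by
  obtain ⟨k, hk, rfl⟩ := h
  exact ⟨r • k, hk.smul_real r, map_smul _ _ _⟩

theorem IsHomF.neg {G : LocalFunctional D} {d : ℕ} (h : IsHomF D G d) : IsHomF D (-G) d := by
  rw [← neg_one_smul ℝ G]; exact h.smul _

theorem IsHomF.sub {G G' : LocalFunctional D} {d : ℕ} (h : IsHomF D G d) (h' : IsHomF D G' d) :
    IsHomF D (G - G') d := by
  rw [sub_eq_add_neg]; exact h.add h'.neg

theorem IsHomF.sum {ι : Type*} (s : Finset ι) (G : ι → LocalFunctional D) {d : ℕ}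
    (h : ∀ i ∈ s, IsHomF D (G i) d) : IsHomF D (∑ i ∈ s, G i) d := by
  classical
  induction s using Finset.induction_on with
  | empty => simpa using isHomF_zero d
  | insert a s ha ih =>
    rw [Finset.sum_insert ha]
    exact (h a (Finset.mem_insert_self a s)).add
      (ih fun i hi => h i (Finset.mem_insert_of_mem hi))

theorem IsHomF.poissonBracket {H F : LocalFunctional D} {i j : ℕ} (hH : IsHomF D H i)
    (hF : IsHomF D F j) : IsHomF D (poissonBracket D H F) (i + j + 1) := by
  obtain ⟨h, hh, rfl⟩ := hH
  obtain ⟨f, hf, rfl⟩ := hF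
  exact isHomF_functional
    ((isHom_eulerLagrange D hh).mul (isHom_totalDeriv D (isHom_eulerLagrange D hf)))

variable (D)

/-- The homogeneous component of degree `d` of a total derivative. -/
theorem component_totalDeriv (h : DiffPoly R) (d : ℕ) :
    weightedHomogeneousComponent jetWeight (d + 1) (totalDeriv D h) =
      totalDeriv D (weightedHomogeneousComponent jetWeight d h) := by
  classical
  induction h using MvPolynomial.induction_on' with
  | monomial m a =>
    have h1 : IsHom (monomial m a) (Finsupp.weight jetWeight m) :=
      isWeightedHomogeneous_monomial _ _ _ rfl
    have h2 := isHom_totalDeriv D h1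
    by_cases hd : Finsupp.weight jetWeight m = d
    · rw [← hd, h1.weightedHomogeneousComponent_same, h2.weightedHomogeneousComponent_same]
    · rw [h1.weightedHomogeneousComponent_ne _ (Ne.symm hd),
        h2.weightedHomogeneousComponent_ne _ (by omega), map_zero]
  | add p q hp hq => simp only [map_add, hp, hq]

end

noncomputable section

variable {R : Type*} [CommRing R] [Algebra ℝ R] (D : Derivation ℝ R R)

/-! ### Evolutionary vector fields -/

/-- The evolutionary derivation `∑ⱼ (∂ₓʲ Q) ∂/∂u^{(j)}` with characteristic `Q`. -/
def evol (Q : DiffPoly R) : DiffPoly R →ₗ[ℝ] DiffPoly R :=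
  LinearMap.mulLeft ℝ Q ∘ₗ partialU D +
    (mkDerivation R (fun k => (totalDeriv D ^ (k + 1)) Q) :
      DiffPoly R →ₗ[R] DiffPoly R).restrictScalars ℝ

theorem evol_apply (Q h : DiffPoly R) :
    evol D Q h = Q * partialU D h + mkDerivation R (fun k => (totalDeriv D ^ (k + 1)) Q) h := rfl

theorem evol_mul (Q h k : DiffPoly R) :
    evol D Q (h * k) = h * evol D Q k + k * evol D Q h := by
  simp only [evol_apply, partialU_mul, Derivation.leibniz, smul_eq_mul]
  ring

theorem partialU_C (a : R) : partialU D (C a) = C (D a) := by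
  rw [C_apply, C_apply, partialU_monomial]

theorem evol_C (Q : DiffPoly R) (a : R) : evol D Q (C a) = Q * C (D a) := by
  rw [evol_apply, derivation_C, add_zero, partialU_C]

theorem evol_X (Q : DiffPoly R) (k : ℕ) : evol D Q (X k) = (totalDeriv D ^ (k + 1)) Q := by
  rw [evol_apply, partialU_X, mul_zero, zero_add, mkDerivation_X]

theorem totalDeriv_pow_succ (j : ℕ) (h : DiffPoly R) :
    (totalDeriv D ^ (j + 1)) h = totalDeriv D ((totalDeriv D ^ j) h) := by
  rw [pow_succ', Module.End.mul_apply]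

/-- Both composites obey compatible product rules, so agreement on coefficients and jet variables
suffices. On X k the field is defined as ∂ₓ^{k+1} Q precisely to make this hold. -/
theorem totalDeriv_evol (Q h : DiffPoly R) :
    totalDeriv D (evol D Q h) = evol D Q (totalDeriv D h) := by
  induction h using MvPolynomial.induction_on with
  | C a =>
    rw [evol_C, totalDeriv_C, evol_mul, evol_C, evol_X, totalDeriv_mul, totalDeriv_C, zero_add,
      pow_one]
    ring
  | add p q hp hq => simp only [map_add, hp, hq]
  | mul_X p k hp =>
    simp only [evol_mul, totalDeriv_mul, map_add, hp, evol_X, totalDeriv_X, totalDeriv_pow_succ]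
    ring

theorem totalDeriv_pow_evol (Q h : DiffPoly R) (j : ℕ) :
    (totalDeriv D ^ j) (evol D Q h) = evol D Q ((totalDeriv D ^ j) h) := by
  induction j with
  | zero => rfl
  | succ j ih => rw [totalDeriv_pow_succ, totalDeriv_pow_succ, ih, totalDeriv_evol]

/-- A commutator of derivations is a derivation, and on jet variables commutation with ∂ₓ reduces
the claim to the characteristics. This is the source of the Jacobi identity. -/
theorem evol_commutator (Q P h : DiffPoly R) :
    evol D Q (evol D P h) - evol D P (evol D Q h) = evol D (evol D Q P - evol D P Q) h := by
  induction h using MvPolynomial.induction_on with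
  | C a => simp only [evol_C, evol_mul]; ring
  | add p q hp hq => simp only [map_add, ← hp, ← hq]; ring
  | mul_X p k hp =>
    simp only [evol_mul, map_add, evol_X, ← totalDeriv_pow_evol, map_sub, ← hp]
    ring

theorem jetPartial_succ_X (j k : ℕ) :
    jetPartial D (j + 1) (X k : DiffPoly R) = if j = k then 1 else 0 := by
  change pderiv j (X k) = _
  rw [pderiv_X]
  by_cases h : j = k
  · subst h; simp
  · rw [Pi.single_eq_of_ne (by omega), if_neg h]

theorem jetPartial_succ_C (j : ℕ) (a : R) : jetPartial D (j + 1) (C a : DiffPoly R) = 0 :=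
  pderiv_C

/-- Stating the finite sum for all large N lets the bounds of different densities be merged by
filter arguments. -/
theorem evol_eq_sum_eventually (Q h : DiffPoly R) :
    ∀ᶠ N in Filter.atTop,
      evol D Q h = ∑ j ∈ Finset.range N, jetPartial D j h * (totalDeriv D ^ j) Q := by
  induction h using MvPolynomial.induction_on with
  | C a =>
    filter_upwards [Filter.eventually_ge_atTop 1] with N hN
    obtain ⟨M, rfl⟩ := Nat.exists_eq_add_of_le' hN
    rw [Finset.sum_range_succ', Finset.sum_eq_zero fun j _ => by
      rw [jetPartial_succ_C, zero_mul], evol_C]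
    change _ = 0 + partialU D (C a) * Q
    rw [partialU_C]
    ring
  | add p q hp hq =>
    filter_upwards [hp, hq] with N h1 h2
    simp only [map_add, h1, h2, add_mul, Finset.sum_add_distrib]
  | mul_X p k hp =>
    filter_upwards [hp, Filter.eventually_ge_atTop (k + 2)] with N h1 hN
    have hX : ∑ j ∈ Finset.range N, jetPartial D j (X k) * (totalDeriv D ^ j) Q =
        (totalDeriv D ^ (k + 1)) Q := by
      rw [Finset.sum_eq_single (k + 1)]
      · rw [jetPartial_succ_X, if_pos rfl, one_mul]
      · intro j _ hj
        cases j with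
        | zero =>
          change partialU D (X k) * _ = 0
          rw [partialU_X, zero_mul]
        | succ j => rw [jetPartial_succ_X, if_neg (by omega), zero_mul]
      · intro h; simp at h; omega
    rw [evol_mul, h1, evol_X, ← hX, Finset.mul_sum, Finset.mul_sum, ← Finset.sum_add_distrib]
    refine Finset.sum_congr rfl fun j _ => ?_
    rw [jetPartial_mul]
    ring

/-- The formal adjoint of the Fréchet derivative of `Q`, `P ↦ ∑ⱼ (-∂ₓ)ʲ (∂Q/∂u^{(j)} P)`. -/
def frechetAdj (Q P : DiffPoly R) : DiffPoly R :=
  ∑ j ∈ Finset.range (jetBound Q), ((-totalDeriv D) ^ j) (jetPartial D j Q * P)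

theorem frechetAdj_eq_sum (Q P : DiffPoly R) (N : ℕ) (hN : jetBound Q ≤ N) :
    frechetAdj D Q P = ∑ j ∈ Finset.range N, ((-totalDeriv D) ^ j) (jetPartial D j Q * P) := by
  refine Finset.sum_subset (Finset.range_mono hN) fun j _ hj => ?_
  rw [jetPartial_eq_zero D Q j (by simpa using hj), zero_mul, map_zero]

theorem eulerLagrange_mul (P Q : DiffPoly R) :
    eulerLagrange D (P * Q) = frechetAdj D P Q + frechetAdj D Q P := by
  set N := max (jetBound (P * Q)) (max (jetBound P) (jetBound Q))
  rw [eulerLagrange_eq_sum D (P * Q) N (by simp [N]), frechetAdj_eq_sum D P Q N (by simp [N]),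
    frechetAdj_eq_sum D Q P N (by simp [N]), ← Finset.sum_add_distrib]
  refine Finset.sum_congr rfl fun j _ => ?_
  rw [jetPartial_mul, map_add, mul_comm Q, mul_comm P, add_comm]

/-- The Fréchet derivative of ∂ₓQ is ∂ₓ composed with that of Q, and the adjoint of ∂ₓ is -∂ₓ. The
commutator of ∂ₓ with ∂/∂u^{(j)} makes the sum telescope. -/
theorem frechetAdj_totalDeriv (Q P : DiffPoly R) :
    frechetAdj D (totalDeriv D Q) P = -frechetAdj D Q (totalDeriv D P) := by
  have tele : ∀ M : ℕ, ∑ j ∈ Finset.range (M + 1),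
      ((-totalDeriv D) ^ j) (jetPartial D j (totalDeriv D Q) * P) =
        -∑ j ∈ Finset.range (M + 1), ((-totalDeriv D) ^ j) (jetPartial D j Q * totalDeriv D P)
          - ((-totalDeriv D) ^ (M + 1)) (jetPartial D M Q * P) := by
    intro M
    induction M with
    | zero =>
      simp only [zero_add, Finset.sum_range_one, pow_zero, Module.End.one_apply, pow_one,
        LinearMap.neg_apply, totalDeriv_mul, jetPartial_zero_totalDeriv]
      ring
    | succ M ih =>
      rw [Finset.sum_range_succ, ih, Finset.sum_range_succ _ (M + 1), jetPartial_succ_totalDeriv,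
        add_mul, map_add, pow_succ (-totalDeriv D) (M + 1), Module.End.mul_apply,
        LinearMap.neg_apply, totalDeriv_mul, map_neg, map_add, mul_comm P]
      abel
  set N := max (jetBound (totalDeriv D Q)) (jetBound Q) with hN
  rw [frechetAdj_eq_sum D _ P (N + 1) (by omega), frechetAdj_eq_sum D Q _ (N + 1) (by omega), tele,
    jetPartial_eq_zero D Q N (by omega), zero_mul, map_zero, sub_zero]

theorem frechetAdj_totalDeriv_pow (Q P : DiffPoly R) (i : ℕ) :
    frechetAdj D ((totalDeriv D ^ i) Q) P = frechetAdj D Q (((-totalDeriv D) ^ i) P) := by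
  induction i generalizing P with
  | zero => rfl
  | succ i ih =>
    rw [totalDeriv_pow_succ, frechetAdj_totalDeriv, ih, pow_succ (-totalDeriv D),
      Module.End.mul_apply, LinearMap.neg_apply, map_neg]
    simp only [frechetAdj, mul_neg, map_neg, Finset.sum_neg_distrib]

theorem frechetAdj_sum (Q : DiffPoly R) {ι : Type*} (s : Finset ι) (P : ι → DiffPoly R) :
    frechetAdj D Q (∑ i ∈ s, P i) = ∑ i ∈ s, frechetAdj D Q (P i) := by
  simp only [frechetAdj, Finset.mul_sum, map_sum]
  exact Finset.sum_comm

theorem jetPartial_evol (Q h : DiffPoly R) (j : ℕ) :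
    ∀ᶠ N in Filter.atTop, jetPartial D j (evol D Q h) = evol D Q (jetPartial D j h) +
      ∑ i ∈ Finset.range N, jetPartial D j ((totalDeriv D ^ i) Q) * jetPartial D i h := by
  have hcomm : ∀ i, jetPartial D j (jetPartial D i h) = jetPartial D i (jetPartial D j h) := by
    intro i
    have hp : ∀ k, partialU D (pderiv k h) = pderiv k (partialU D h) := by
      intro k
      ext m
      rw [coeff_partialU, coeff_pderiv, coeff_pderiv, coeff_partialU, Derivation.leibniz]
      simp [mul_comm]
    cases i with
    | zero =>
      cases j with
      | zero => rfl
      | succ j => exact (hp j).symm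
    | succ i =>
      cases j with
      | zero => exact hp i
      | succ j =>
        change pderiv j (pderiv i h) = pderiv i (pderiv j h)
        ext m
        simp only [coeff_pderiv, Finsupp.add_apply]
        by_cases hij : i = j
        · subst hij; rfl
        · rw [Finsupp.single_eq_of_ne (by omega), Finsupp.single_eq_of_ne (by omega),
            add_right_comm]
          simp only [add_zero]
          ring
  filter_upwards [evol_eq_sum_eventually D Q h, evol_eq_sum_eventually D Q (jetPartial D j h)]
    with N h1 h2
  rw [h1, h2, map_sum, ← Finset.sum_add_distrib]
  refine Finset.sum_congr rfl fun i _ => ?_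
  rw [jetPartial_mul, hcomm]
  ring

/-- Commuting ∂/∂u^{(j)} past the field leaves the terms ∂(∂ₓⁱQ)/∂u^{(j)} · ∂h/∂u^{(i)}. Summed over
j these are adjoints of ∂ₓⁱQ; moving ∂ₓⁱ to the other argument rebuilds the Euler--Lagrange
derivative of h. -/
theorem eulerLagrange_evol (Q h : DiffPoly R) :
    eulerLagrange D (evol D Q h) =
      evol D Q (eulerLagrange D h) + frechetAdj D Q (eulerLagrange D h) := by
  set B := max (jetBound (evol D Q h)) (jetBound h)
  obtain ⟨N, hN, hNB⟩ : ∃ N, (∀ j < B, jetPartial D j (evol D Q h) =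
      evol D Q (jetPartial D j h) +
        ∑ i ∈ Finset.range N, jetPartial D j ((totalDeriv D ^ i) Q) * jetPartial D i h) ∧
      B ≤ N := by
    have h1 : ∀ᶠ N in Filter.atTop, ∀ j ∈ Finset.range B, jetPartial D j (evol D Q h) =
      evol D Q (jetPartial D j h) +
        ∑ i ∈ Finset.range N, jetPartial D j ((totalDeriv D ^ i) Q) * jetPartial D i h :=
      (Filter.eventually_all_finset _).mpr fun j _ => jetPartial_evol D Q h j
    obtain ⟨N, h2, h3⟩ := (h1.and (Filter.eventually_ge_atTop B)).exists
    exact ⟨N, fun j hj => h2 j (Finset.mem_range.mpr hj), h3⟩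
  -- One M bounds the jet orders of all ∂ₓⁱQ with i < N, so the double sum runs over a rectangle and
  -- can be exchanged.
  obtain ⟨M, hMB, hM⟩ : ∃ M, B ≤ M ∧ ∀ i < N, jetBound ((totalDeriv D ^ i) Q) ≤ M := by
    refine ⟨max B ((Finset.range N).sup fun i => jetBound ((totalDeriv D ^ i) Q)), by simp,
      fun i hi => le_max_of_le_right (Finset.le_sup (f := fun i =>
        jetBound ((totalDeriv D ^ i) Q)) (Finset.mem_range.mpr hi))⟩
  have key : ∀ j, jetPartial D j (evol D Q h) = evol D Q (jetPartial D j h) +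
        ∑ i ∈ Finset.range N, jetPartial D j ((totalDeriv D ^ i) Q) * jetPartial D i h := by
    intro j
    by_cases hj : j < B
    · exact hN j hj
    · obtain ⟨N', h1, h2⟩ := ((jetPartial_evol D Q h j).and
        (Filter.eventually_ge_atTop N)).exists
      rw [h1]
      congr 1
      symm
      refine Finset.sum_subset (Finset.range_mono h2) fun i _ hi => ?_
      rw [jetPartial_eq_zero D h i, mul_zero]
      have : jetBound h ≤ B := le_max_right _ _
      simp at hi
      omega
  rw [eulerLagrange_eq_sum D (evol D Q h) M ((le_max_left _ _).trans hMB),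
    Finset.sum_congr rfl fun j _ => by rw [key j], eulerLagrange_eq_sum D h N
      ((le_max_right _ _).trans hNB), frechetAdj_sum]
  simp only [map_add, map_sum, Finset.sum_add_distrib]
  congr 1
  · rw [Finset.sum_subset (Finset.range_mono (le_max_left M N)), ← Finset.sum_subset
      (Finset.range_mono (le_max_right M N))]
    · refine Finset.sum_congr rfl fun j _ => ?_
      rw [neg_totalDeriv_pow, neg_totalDeriv_pow, map_smul, totalDeriv_pow_evol]
    · intro j _ hj
      have : jetBound h ≤ B := le_max_right _ _
      rw [jetPartial_eq_zero D h j (by simp at hj; omega)]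
      simp only [map_zero]
    · intro j _ hj
      have : jetBound h ≤ B := le_max_right _ _
      rw [jetPartial_eq_zero D h j (by simp at hj; omega)]
      simp only [map_zero]
  · rw [Finset.sum_comm]
    refine Finset.sum_congr rfl fun i hi => ?_
    rw [← frechetAdj_totalDeriv_pow, frechetAdj_eq_sum D _ _ M (hM i (Finset.mem_range.mp hi))]

/-! ### The Poisson bracket -/

variable {D}

theorem functional_mul_totalDeriv (a b : DiffPoly R) :
    functional D (a * totalDeriv D b) = -functional D (totalDeriv D a * b) := by
  have h := functional_totalDeriv (D := D) (a * b)
  rw [totalDeriv_mul, map_add, mul_comm b] at h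
  exact eq_neg_of_add_eq_zero_left h

theorem functional_mul_totalDeriv_pow (a b : DiffPoly R) (j : ℕ) :
    functional D (a * (totalDeriv D ^ j) b) = functional D (((-totalDeriv D) ^ j) a * b) := by
  induction j generalizing a with
  | zero => rfl
  | succ j ih =>
    rw [totalDeriv_pow_succ, functional_mul_totalDeriv, ih, pow_succ (-totalDeriv D),
      Module.End.mul_apply, LinearMap.neg_apply, map_neg, neg_mul, map_neg]

theorem functional_evol (Q h : DiffPoly R) :
    functional D (evol D Q h) = functional D (eulerLagrange D h * Q) := by
  obtain ⟨N, h1, h2⟩ := ((evol_eq_sum_eventually D Q h).and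
    (Filter.eventually_ge_atTop (jetBound h))).exists
  rw [h1, eulerLagrange_eq_sum D h N h2, Finset.sum_mul, map_sum, map_sum]
  exact Finset.sum_congr rfl fun j _ => functional_mul_totalDeriv_pow _ _ _

theorem poissonBracket_functional (h : DiffPoly R) (F : LocalFunctional D) :
    poissonBracket D (functional D h) F =
      functional D (evol D (totalDeriv D (varDeriv D F)) h) := by
  rw [functional_evol]; rfl

theorem poissonBracket_antisymm (H F : LocalFunctional D) :
    poissonBracket D H F = -poissonBracket D F H := by
  rw [poissonBracket, functional_mul_totalDeriv, mul_comm]; rfl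

theorem poissonBracket_add_left (H H' F : LocalFunctional D) :
    poissonBracket D (H + H') F = poissonBracket D H F + poissonBracket D H' F := by
  simp only [poissonBracket, map_add, add_mul]

theorem poissonBracket_add_right (H F F' : LocalFunctional D) :
    poissonBracket D H (F + F') = poissonBracket D H F + poissonBracket D H F' := by
  simp only [poissonBracket, map_add, mul_add]

theorem poissonBracket_smul_left (r : ℝ) (H F : LocalFunctional D) :
    poissonBracket D (r • H) F = r • poissonBracket D H F := by
  simp only [poissonBracket, map_smul, smul_mul_assoc]

theorem poissonBracket_smul_right (r : ℝ) (H F : LocalFunctional D) :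
    poissonBracket D H (r • F) = r • poissonBracket D H F := by
  simp only [poissonBracket, map_smul, mul_smul_comm]

variable (D) in
/-- The Poisson bracket as a bilinear map. -/
def bracketₗ : LocalFunctional D →ₗ[ℝ] LocalFunctional D →ₗ[ℝ] LocalFunctional D :=
  LinearMap.mk₂ ℝ (poissonBracket D) poissonBracket_add_left poissonBracket_smul_left
    poissonBracket_add_right poissonBracket_smul_right

theorem bracketₗ_apply (H F : LocalFunctional D) : bracketₗ D H F = poissonBracket D H F := rfl

theorem poissonBracket_zero_left (F : LocalFunctional D) : poissonBracket D 0 F = 0 := by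
  rw [← bracketₗ_apply, map_zero, LinearMap.zero_apply]

theorem poissonBracket_zero_right (F : LocalFunctional D) : poissonBracket D F 0 = 0 := by
  rw [← bracketₗ_apply, map_zero]

theorem poissonBracket_neg_right (H F : LocalFunctional D) :
    poissonBracket D H (-F) = -poissonBracket D H F := by
  rw [← bracketₗ_apply, map_neg, bracketₗ_apply]

theorem poissonBracket_sub_right (H F F' : LocalFunctional D) :
    poissonBracket D H (F - F') = poissonBracket D H F - poissonBracket D H F' := by
  rw [← bracketₗ_apply, map_sub, bracketₗ_apply, bracketₗ_apply]

theorem eq_zero_of_eq_neg {M : Type*} [AddCommGroup M] [Module ℝ M] {x : M} (h : x = -x) :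
    x = 0 := by
  have h2 : (2 : ℝ) • x = 0 := by
    rw [two_smul]
    nth_rewrite 2 [h]
    exact add_neg_cancel x
  simpa using h2

/-- The Fréchet derivative of a variational derivative is self-adjoint. -/
theorem frechetAdj_eulerLagrange (g P : DiffPoly R) :
    frechetAdj D (eulerLagrange D g) P = evol D P (eulerLagrange D g) := by
  -- The two densities differ by a total derivative. Expanding both sides leaves the common term
  -- `frechetAdj D P (eulerLagrange D g)`, which cancels.
  have h1 : eulerLagrange D (evol D P g) = eulerLagrange D (eulerLagrange D g * P) := by
    rw [← varDeriv_functional, ← varDeriv_functional, functional_evol]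
  rw [eulerLagrange_evol, eulerLagrange_mul] at h1
  exact (add_right_cancel h1).symm

/-- After ∂ₓ is applied, the right side is the characteristic of the commutator of the two
Hamiltonian fields. Self-adjointness of the Fréchet derivative of δG/δu turns the adjoint term into
the second field. -/
theorem varDeriv_poissonBracket (F G : LocalFunctional D) :
    varDeriv D (poissonBracket D F G) =
      evol D (totalDeriv D (varDeriv D G)) (varDeriv D F) -
        evol D (totalDeriv D (varDeriv D F)) (varDeriv D G) := by
  obtain ⟨f, rfl⟩ := functional_surjective F
  obtain ⟨g, rfl⟩ := functional_surjective G
  rw [poissonBracket_functional, varDeriv_functional, varDeriv_functional, varDeriv_functional,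
    eulerLagrange_evol, frechetAdj_totalDeriv, frechetAdj_eulerLagrange, sub_eq_add_neg]

/-- The Jacobi identity. -/
theorem poissonBracket_jacobi (H F G : LocalFunctional D) :
    poissonBracket D H (poissonBracket D F G) =
      poissonBracket D (poissonBracket D H F) G - poissonBracket D (poissonBracket D H G) F := by
  obtain ⟨h, rfl⟩ := functional_surjective H
  rw [poissonBracket_functional, varDeriv_poissonBracket, map_sub, totalDeriv_evol,
    totalDeriv_evol, ← evol_commutator, map_sub, poissonBracket_functional h F,
    poissonBracket_functional, poissonBracket_functional h G, poissonBracket_functional]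

/-! ### Series -/

theorem seriesBracket_apply (H F : HamSeries D) (n : ℕ) :
    seriesBracket D H F n =
      ∑ ij ∈ Finset.HasAntidiagonal.antidiagonal n, poissonBracket D (H ij.1) (F ij.2) := rfl

theorem seriesBracket_antisymm (H F : HamSeries D) :
    seriesBracket D H F = -seriesBracket D F H := by
  funext n
  rw [Pi.neg_apply, seriesBracket_apply, seriesBracket_apply, ← Finset.sum_neg_distrib,
    ← Finset.Nat.sum_antidiagonal_swap (n := n)]
  exact Finset.sum_congr rfl fun ij _ => poissonBracket_antisymm _ _

theorem seriesBracket_self (H : HamSeries D) : seriesBracket D H H = 0 :=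
  eq_zero_of_eq_neg (seriesBracket_antisymm H H)

theorem seriesBracket_jacobi (H F G : HamSeries D) :
    seriesBracket D H (seriesBracket D F G) =
      seriesBracket D (seriesBracket D H F) G - seriesBracket D (seriesBracket D H G) F := by
  funext n
  have e1 : seriesBracket D H (seriesBracket D F G) n =
      ∑ ij ∈ Finset.HasAntidiagonal.antidiagonal n, ∑ kl ∈ Finset.HasAntidiagonal.antidiagonal ij.2,
        poissonBracket D (H ij.1) (poissonBracket D (F kl.1) (G kl.2)) := by
    refine Finset.sum_congr rfl fun ij _ => ?_
    rw [seriesBracket_apply, ← bracketₗ_apply, map_sum]; rfl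
  have e2 : ∀ A B : HamSeries D, seriesBracket D (seriesBracket D H A) B n =
      ∑ ij ∈ Finset.HasAntidiagonal.antidiagonal n, ∑ kl ∈ Finset.HasAntidiagonal.antidiagonal ij.2,
        poissonBracket D (poissonBracket D (H ij.1) (A kl.1)) (B kl.2) := by
    intro A B
    simp only [seriesBracket_apply, ← bracketₗ_apply, map_sum, LinearMap.sum_apply,
      Finset.sum_sigma']
    -- Both sides sum over triples of indices with total n; only the bracketing of the triple
    -- changes.
    apply Finset.sum_nbij' (fun ⟨⟨_, j⟩, ⟨k, l⟩⟩ ↦ ⟨(k, l + j), (l, j)⟩)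
      (fun ⟨⟨i, _⟩, ⟨k, l⟩⟩ ↦ ⟨(i + k, l), (i, k)⟩) <;>
      rintro ⟨⟨_, _⟩, ⟨_, _⟩⟩ <;>
      simp only [Finset.mem_sigma, Finset.HasAntidiagonal.mem_antidiagonal] <;> grind
  rw [Pi.sub_apply, e1, e2, e2, ← Finset.sum_sub_distrib]
  refine Finset.sum_congr rfl fun ij _ => ?_
  rw [← Finset.Nat.sum_antidiagonal_swap (n := ij.2) (f := fun kl => poissonBracket D
    (poissonBracket D (H ij.1) (G kl.1)) (F kl.2)), ← Finset.sum_sub_distrib]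
  exact Finset.sum_congr rfl fun kl _ => poissonBracket_jacobi _ _ _

end

noncomputable section

variable {R : Type*} [CommRing R] [Algebra ℝ R] {D : Derivation ℝ R R}

/-! ### Reduced densities -/

/-- The weight with respect to which integration by parts is triangular. -/
abbrev jetKey (m : ℕ →₀ ℕ) : ℕ := Finsupp.weight (fun j => 3 ^ j) m

/-- Differential polynomials of differential degree `d` whose monomials have at least `r` jet
factors. -/
def jetFiltration (R : Type*) [CommRing R] [Algebra ℝ R] (d r : ℕ) :
    Submodule ℝ (DiffPoly R) where
  carrier := {h | ∀ m, coeff m h ≠ 0 → Finsupp.weight jetWeight m = d ∧ r ≤ Finsupp.degree m}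
  zero_mem' := fun m hm => (hm (coeff_zero m)).elim
  add_mem' := fun {a b} ha hb m hm => by
    by_cases h : coeff m a = 0
    · exact hb m fun h' => hm (by rw [coeff_add, h, h', add_zero])
    · exact ha m h
  smul_mem' := fun r h hh m hm => hh m fun h' => hm (by rw [coeff_smul, h', smul_zero])

theorem monomial_mem_jetFiltration {d r : ℕ} {m : ℕ →₀ ℕ} (hd : Finsupp.weight jetWeight m = d)
    (hr : r ≤ Finsupp.degree m) (a : R) : monomial m a ∈ jetFiltration R d r := fun n hn => by
  classical
  rw [coeff_monomial] at hn
  obtain rfl : m = n := by by_contra h; exact hn (if_neg h)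
  exact ⟨hd, hr⟩

theorem isHom_iff_mem_jetFiltration {d : ℕ} {h : DiffPoly R} :
    IsHom h d ↔ h ∈ jetFiltration R d 0 :=
  ⟨fun hh _ hm => ⟨hh hm, Nat.zero_le _⟩, fun hh m hm => (hh m hm).1⟩

theorem isHom_of_mem_jetFiltration {d r : ℕ} {h : DiffPoly R} (hh : h ∈ jetFiltration R d r) :
    IsHom h d := fun _ hm => (hh _ hm).1

/-- A monomial is reduced when its highest jet variable does not occur linearly. -/
def IsReduced (m : ℕ →₀ ℕ) : Prop := ∀ k, (∀ j, k < j → m j = 0) → m k ≠ 1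

theorem totalDeriv_monomial (m : ℕ →₀ ℕ) (a : R) :
    totalDeriv D (monomial m a) = monomial (m + Finsupp.single 0 1) (D a) +
      ∑ j ∈ m.support,
        monomial (m - Finsupp.single j 1 + Finsupp.single (j + 1) 1) (a * (m j : R)) := by
  rw [totalDeriv_apply, partialU_monomial, jetShift, mkDerivation_monomial, Finsupp.smul_sum,
    Finsupp.sum, X, monomial_mul, one_mul, add_comm m]
  congr 1
  refine Finset.sum_congr rfl fun j _ => ?_
  rw [X, smul_eq_mul, monomial_mul, mul_one, smul_monomial, smul_eq_mul]

theorem exists_of_coeff_totalDeriv_monomial_ne_zero {m n : ℕ →₀ ℕ} {a : R}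
    (hn : coeff n (totalDeriv D (monomial m a)) ≠ 0) :
    n = m + Finsupp.single 0 1 ∨
      ∃ j, m j ≠ 0 ∧ n + Finsupp.single j 1 = m + Finsupp.single (j + 1) 1 := by
  classical
  by_contra hc
  push Not at hc
  refine hn ?_
  rw [totalDeriv_monomial, coeff_add, coeff_monomial, if_neg (Ne.symm hc.1), zero_add, coeff_sum]
  refine Finset.sum_eq_zero fun j hj => ?_
  rw [coeff_monomial, if_neg]
  rintro rfl
  have hj' := Finsupp.mem_support_iff.mp hj
  refine hc.2 j hj' ?_
  rw [add_right_comm, tsub_add_cancel_of_le (Finsupp.single_le_iff.mpr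
    (Nat.one_le_iff_ne_zero.mpr hj'))]

theorem totalDeriv_pow (h : DiffPoly R) (n : ℕ) :
    totalDeriv D (h ^ (n + 1)) = ((n + 1 : ℕ) : DiffPoly R) * h ^ n * totalDeriv D h := by
  induction n with
  | zero => simp
  | succ n ih => rw [pow_succ, totalDeriv_mul, ih]; push_cast; ring

/-- Integration by parts lowers the key of a monomial whose highest jet variable is linear. -/
theorem exists_integration_by_parts (hD : Function.Surjective D) {m : ℕ →₀ ℕ}
    (hm : ¬ IsReduced m) (a : R) :
    ∃ h : DiffPoly R, functional D (monomial m a) = functional D h ∧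
      ∀ n, coeff n h ≠ 0 → Finsupp.weight jetWeight n = Finsupp.weight jetWeight m ∧
        Finsupp.degree m ≤ Finsupp.degree n ∧ jetKey n < jetKey m := by
  classical
  simp only [IsReduced, not_forall, not_not] at hm
  obtain ⟨k, hk, hk1⟩ := hm
  cases k with
  | zero =>
    -- The monomial is a(u) u_x, the total derivative of an antiderivative of a.
    obtain ⟨b, rfl⟩ := hD a
    have hm0 : m = Finsupp.single 0 1 := by
      ext j
      cases j with
      | zero => simpa using hk1
      | succ j => rw [hk _ (Nat.succ_pos j), Finsupp.single_eq_of_ne (by omega)]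
    refine ⟨0, ?_, fun n hn => (hn (coeff_zero n)).elim⟩
    rw [map_zero]
    refine functional_eq_zero_iff.mpr ⟨C b, ?_⟩
    rw [totalDeriv_C, hm0, X, C_apply, monomial_mul]
    simp
  | succ k =>
    set s := m k
    set m₁ : ℕ →₀ ℕ := (m.erase (k + 1)).erase k with hm₁
    have hmm : m = m₁ + Finsupp.single k s + Finsupp.single (k + 1) 1 := by
      ext j
      rcases eq_or_ne j (k + 1) with rfl | h1
      · simp [hm₁, hk1]
      · rcases eq_or_ne j k with rfl | h2
        · simp [hm₁, s]
        · simp [hm₁, h1, h2]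
    have hm₁z : ∀ j, k ≤ j → m₁ j = 0 := by
      intro j hj
      rcases Nat.lt_or_ge (k + 1) j with h | h
      · rw [hm₁, Finsupp.erase_ne (by omega), Finsupp.erase_ne (by omega), hk j h]
      · obtain rfl | rfl : j = k ∨ j = k + 1 := by omega
        · rw [hm₁, Finsupp.erase_same]
        · rw [hm₁, Finsupp.erase_ne (by omega), Finsupp.erase_same]
    -- With m = m₁ X_k^s X_{k+1}, the product rule for ∂ₓ(b m₁ X_k^{s+1}) replaces a m by -X_k^{s+1}
    -- ∂ₓ(b m₁), where b = a/(s + 1).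
    set b : R := ((s : ℝ) + 1)⁻¹ • a with hb
    refine ⟨-(monomial (Finsupp.single k (s + 1)) 1 * totalDeriv D (monomial m₁ b)), ?_, ?_⟩
    · rw [← sub_eq_zero, ← map_sub, sub_neg_eq_add, functional_eq_zero_iff]
      refine ⟨monomial m₁ b * X k ^ (s + 1), ?_⟩
      rw [totalDeriv_mul, totalDeriv_pow, totalDeriv_X, X_pow_eq_monomial, X_pow_eq_monomial]
      congr 1
      have hab : ((s + 1 : ℕ) : DiffPoly R) * monomial m₁ b = monomial m₁ a := by
        rw [hb, ← nsmul_eq_mul, ← map_nsmul, ← Nat.cast_smul_eq_nsmul ℝ, smul_smul]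
        push_cast
        rw [mul_inv_cancel₀ (by positivity), one_smul]
      rw [show monomial m₁ b * (((s + 1 : ℕ) : DiffPoly R) * monomial (Finsupp.single k s) 1 *
        X (k + 1)) = ((s + 1 : ℕ) : DiffPoly R) * monomial m₁ b * monomial (Finsupp.single k s) 1 *
        X (k + 1) by ring, hab, X, monomial_mul, monomial_mul, mul_one, mul_one, ← hmm]
    · intro n hn
      rw [coeff_neg, neg_ne_zero, coeff_monomial_mul', one_mul] at hn
      have hle : Finsupp.single k (s + 1) ≤ n := by by_contra h; exact hn (if_neg h)
      rw [if_pos hle] at hn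
      obtain ⟨n', rfl⟩ := exists_add_of_le hle
      rw [add_tsub_cancel_left] at hn
      have h3 : ∀ i, 1 ≤ 3 ^ i := fun i => Nat.one_le_pow _ _ (by norm_num)
      rw [hmm]
      simp only [jetKey, map_add, Finsupp.weight_single, Finsupp.degree_single, smul_eq_mul,
        jetWeight, pow_succ]
      -- The key loses 3^{k+1} - 3^k = 2·3^k. It gains 1 if the coefficient is differentiated, or
      -- 2·3^j with j < k if a variable of m₁ is. Base 2 would fail at k = 0.
      rcases exists_of_coeff_totalDeriv_monomial_ne_zero hn with rfl | ⟨j, hj, hnj⟩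
      · have := h3 k
        simp only [map_add, Finsupp.weight_single, Finsupp.degree_single, smul_eq_mul, pow_zero]
        refine ⟨by ring, by omega, ?_⟩
        ring_nf
        omega
      · have hjk : j < k := by
          by_contra h
          exact hj (hm₁z j (by omega))
        have e1 := congrArg (Finsupp.weight jetWeight) hnj
        have e2 := congrArg Finsupp.degree hnj
        have e3 := congrArg jetKey hnj
        have e4 : 3 ^ j < 3 ^ k := Nat.pow_lt_pow_right (by norm_num) hjk
        simp only [jetKey, map_add, Finsupp.weight_single, Finsupp.degree_single, smul_eq_mul,
          jetWeight, pow_succ] at e1 e2 e3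
        refine ⟨?_, by omega, ?_⟩
        · ring_nf at e1 ⊢
          omega
        · ring_nf at e3 ⊢
          omega

theorem functional_mem_of_monomials (P : AddSubgroup (LocalFunctional D)) {h : DiffPoly R}
    (hh : ∀ m, coeff m h ≠ 0 → ∀ a, functional D (monomial m a) ∈ P) : functional D h ∈ P := by
  rw [h.as_sum, map_sum]
  exact sum_mem fun m hm => hh m (mem_support_iff.mp hm) _

/-- Induction on the key: membership in an additive subgroup only has to be checked for reduced
monomials. -/
theorem functional_mem_of_reduced (hD : Function.Surjective D)
    (P : AddSubgroup (LocalFunctional D)) {d r : ℕ}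
    (hP : ∀ m, Finsupp.weight jetWeight m = d → r ≤ Finsupp.degree m → IsReduced m →
      (∀ n, Finsupp.weight jetWeight n = d → Finsupp.degree m ≤ Finsupp.degree n →
        jetKey n < jetKey m → ∀ b, functional D (monomial n b) ∈ P) →
      ∀ a, functional D (monomial m a) ∈ P)
    {h : DiffPoly R} (hh : h ∈ jetFiltration R d r) : functional D h ∈ P := by
  have key : ∀ N m, jetKey m < N → Finsupp.weight jetWeight m = d → r ≤ Finsupp.degree m →
      ∀ a, functional D (monomial m a) ∈ P := by
    intro N
    induction N with
    | zero => intro m hm; omega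
    | succ N ih =>
      intro m hm hd hr a
      by_cases hred : IsReduced m
      · exact hP m hd hr hred (fun n h1 h2 h3 b => ih n (by omega) h1 (hr.trans h2) b) a
      · obtain ⟨k, hk, hk'⟩ := exists_integration_by_parts hD hred a
        rw [hk]
        refine functional_mem_of_monomials P fun n hn b => ?_
        obtain ⟨h1, h2, h3⟩ := hk' n hn
        exact ih n (by omega) (h1.trans hd) (hr.trans h2) b
  exact functional_mem_of_monomials P fun m hm =>
    key _ m (Nat.lt_succ_self _) (hh m hm).1 (hh m hm).2

theorem exists_reduced_density (hD : Function.Surjective D) {d r : ℕ} {h : DiffPoly R}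
    (hh : h ∈ jetFiltration R d r) :
    ∃ k ∈ jetFiltration R d r, (∀ m, coeff m k ≠ 0 → IsReduced m) ∧
      functional D k = functional D h := by
  classical
  let P : AddSubgroup (LocalFunctional D) :=
    { carrier := {G | ∃ k ∈ jetFiltration R d r, (∀ m, coeff m k ≠ 0 → IsReduced m) ∧
        functional D k = G}
      zero_mem' := ⟨0, zero_mem _, fun m hm => (hm (coeff_zero m)).elim, map_zero _⟩
      add_mem' := by
        rintro _ _ ⟨k, hk, hk', rfl⟩ ⟨l, hl, hl', rfl⟩
        refine ⟨k + l, add_mem hk hl, fun m hm => ?_, map_add _ _ _⟩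
        by_cases h0 : coeff m k = 0
        · exact hl' m fun h1 => hm (by rw [coeff_add, h0, h1, add_zero])
        · exact hk' m h0
      neg_mem' := by
        rintro _ ⟨k, hk, hk', rfl⟩
        exact ⟨-k, neg_mem hk, fun m hm => hk' m (by simpa using hm), map_neg _ _⟩ }
  refine functional_mem_of_reduced hD P (fun m hd hr hm _ a => ?_) hh
  refine ⟨monomial m a, monomial_mem_jetFiltration hd hr a, fun n hn => ?_, rfl⟩
  rw [coeff_monomial] at hn
  obtain rfl : m = n := by by_contra h; exact hn (if_neg h)
  exact hm

/-! ### Total derivatives -/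

theorem natCast_mul_eq_zero {n : ℕ} (hn : n ≠ 0) {a : R} (h : a * (n : R) = 0) : a = 0 := by
  have h1 : (n : ℝ) • a = 0 := by
    rw [Nat.cast_smul_eq_nsmul, nsmul_eq_mul, mul_comm, h]
  exact (smul_eq_zero_iff_right (Nat.cast_ne_zero.mpr hn)).mp h1

theorem pderiv_eq_zero_iff {k : ℕ} {h : DiffPoly R} :
    pderiv k h = 0 ↔ ∀ m, m k ≠ 0 → coeff m h = 0 := by
  constructor
  · intro h0 m hm
    have h1 : coeff (m - Finsupp.single k 1) (pderiv k h) = 0 := by rw [h0, coeff_zero]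
    have h2 : m - Finsupp.single k 1 + Finsupp.single k 1 = m := tsub_add_cancel_of_le
      (Finsupp.single_le_iff.mpr (Nat.one_le_iff_ne_zero.mpr hm))
    rw [coeff_pderiv, h2] at h1
    refine natCast_mul_eq_zero (n := (m - Finsupp.single k 1 : ℕ →₀ ℕ) k + 1) (by omega) ?_
    exact_mod_cast h1
  · intro h0
    ext m
    rw [coeff_pderiv, h0 _ (by simp), zero_mul, coeff_zero]

theorem exists_bound (h : DiffPoly R) : ∃ N, ∀ k, N ≤ k → pderiv k h = 0 := by
  refine ⟨jetBound h, fun k hk => ?_⟩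
  exact jetPartial_eq_zero (0 : Derivation ℝ R R) h (k + 1) (by omega)

theorem pderiv_succ_totalDeriv (k : ℕ) (h : DiffPoly R) :
    pderiv (k + 1) (totalDeriv D h) = totalDeriv D (pderiv (k + 1) h) + pderiv k h :=
  jetPartial_succ_totalDeriv D (k + 1) h

/-- A total derivative is at most linear in its highest jet variable. -/
theorem coeff_totalDeriv_eq_zero {W : DiffPoly R} {k : ℕ}
    (hk : ∀ j, k < j → pderiv j (totalDeriv D W) = 0) {n : ℕ →₀ ℕ} (hn : 2 ≤ n k) :
    coeff n (totalDeriv D W) = 0 := by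
  -- Descending induction: if X_{j+1} occurs neither in W nor in ∂ₓW, the commutation rule forces
  -- ∂W/∂X_j = 0.
  have hW : ∀ j, k ≤ j → pderiv j W = 0 := by
    obtain ⟨N, hN⟩ := exists_bound W
    have key : ∀ M j, k ≤ j → N ≤ j + M → pderiv j W = 0 := by
      intro M
      induction M with
      | zero => intro j _ hj; exact hN j hj
      | succ M ih =>
        intro j hj hM
        have h1 := hk (j + 1) (by omega)
        rwa [pderiv_succ_totalDeriv, ih (j + 1) (by omega) (by omega), map_zero, zero_add] at h1
    exact fun j hj => key N j hj (by omega)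
  have h2 : pderiv k (pderiv k (totalDeriv D W)) = 0 := by
    cases k with
    | zero =>
      have h3 : pderiv 0 (totalDeriv D W) = totalDeriv D (pderiv 0 W) + partialU D W :=
        jetPartial_succ_totalDeriv D 0 W
      rw [h3, hW 0 le_rfl, map_zero, zero_add, pderiv_eq_zero_iff]
      intro m hm
      rw [coeff_partialU, pderiv_eq_zero_iff.mp (hW 0 le_rfl) m hm, map_zero]
    | succ k =>
      rw [pderiv_succ_totalDeriv, hW _ le_rfl, map_zero, zero_add, pderiv_eq_zero_iff]
      intro m hm
      rw [coeff_pderiv, pderiv_eq_zero_iff.mp (hW _ le_rfl) _ (by simp [hm]), zero_mul]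
  have h4 : coeff (n - Finsupp.single k 1) (pderiv k (totalDeriv D W)) = 0 :=
    pderiv_eq_zero_iff.mp h2 _ (by simp; omega)
  have h5 : n - Finsupp.single k 1 + Finsupp.single k 1 = n := tsub_add_cancel_of_le
      (Finsupp.single_le_iff.mpr (by omega))
  rw [coeff_pderiv, h5] at h4
  refine natCast_mul_eq_zero (n := (n - Finsupp.single k 1 : ℕ →₀ ℕ) k + 1) (by omega) ?_
  exact_mod_cast h4

theorem exists_top_variable {h : DiffPoly R} {m : ℕ →₀ ℕ} (hm : coeff m h ≠ 0) (hm0 : m ≠ 0) :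
    ∃ k, (∀ j, k < j → ∀ n, n j ≠ 0 → coeff n h = 0) ∧ ∃ n, coeff n h ≠ 0 ∧ n k ≠ 0 := by
  classical
  obtain ⟨i, hi⟩ := Finsupp.ne_iff.mp hm0
  obtain ⟨N, hN⟩ := exists_bound h
  let S := (Finset.range N).filter fun k => ∃ n, coeff n h ≠ 0 ∧ n k ≠ 0
  have hS : ∀ k, (∃ n, coeff n h ≠ 0 ∧ n k ≠ 0) → k ∈ S := by
    rintro k ⟨n, h1, h2⟩
    refine Finset.mem_filter.mpr ⟨Finset.mem_range.mpr ?_, n, h1, h2⟩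
    by_contra hc
    exact h1 (pderiv_eq_zero_iff.mp (hN k (by omega)) n h2)
  have hne : S.Nonempty := ⟨i, hS i ⟨m, hm, by simpa using hi⟩⟩
  refine ⟨S.max' hne, fun j hj n hn => ?_, (Finset.mem_filter.mp (S.max'_mem hne)).2⟩
  by_contra hc
  exact absurd (S.le_max' j (hS j ⟨n, hc, hn⟩)) (by omega)

/-- A reduced density of positive degree with trivial functional is zero. -/
theorem eq_zero_of_functional_eq_zero {d r : ℕ} (hd : d ≠ 0) {h : DiffPoly R}
    (hh : h ∈ jetFiltration R d r) (hred : ∀ m, coeff m h ≠ 0 → IsReduced m)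
    (h0 : functional D h = 0) : h = 0 := by
  obtain ⟨W, rfl⟩ := functional_eq_zero_iff.mp h0
  by_contra hne
  obtain ⟨m, hm⟩ := MvPolynomial.ne_zero_iff.mp hne
  have hm0 : m ≠ 0 := by
    rintro rfl
    exact hd ((hh 0 hm).1.symm.trans (map_zero _))
  obtain ⟨k, hk, n, hn, hnk⟩ := exists_top_variable hm hm0
  -- The top variable of the whole density is also the top variable of the monomial n, so
  -- reducedness gives it exponent at least 2, impossible in a total derivative.
  refine hn (coeff_totalDeriv_eq_zero (k := k)
    (fun j hj => pderiv_eq_zero_iff.mpr (hk j hj)) ?_)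
  have h1 := hred n hn k fun j hj => by
    by_contra hc
    exact hn (hk j hj n hc)
  omega

end

noncomputable section

variable {R : Type*} [CommRing R] [Algebra ℝ R] {D : Derivation ℝ R R}

/-! ### The bracket with the Hopf Hamiltonian -/

/-- The terms of `∂ₓ^{j+1}(u u_x)` that do not contain `u`. -/
def hopfPoly (R : Type*) [CommRing R] (j : ℕ) : DiffPoly R :=
  ∑ i ∈ Finset.range (j + 1), ((j + 1).choose (i + 1) : DiffPoly R) * (X i * X (j - i))

theorem totalDeriv_natCast (n : ℕ) : totalDeriv D (n : DiffPoly R) = 0 := by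
  rw [← map_natCast (C : R →+* DiffPoly R), totalDeriv_C, Derivation.map_natCast, map_zero,
    mul_zero]

/-- This is Pascal's rule. The additional product arises when ∂ₓ hits the factor u of u u^{(j+2)}.
-/
theorem hopfPoly_succ (j : ℕ) :
    hopfPoly R (j + 1) = totalDeriv D (hopfPoly R j) + X 0 * X (j + 1) := by
  have h1 : hopfPoly R (j + 1) =
      ∑ i ∈ Finset.range (j + 2), ((j + 1).choose i : DiffPoly R) * (X i * X (j + 1 - i)) +
      ∑ i ∈ Finset.range (j + 2),
        ((j + 1).choose (i + 1) : DiffPoly R) * (X i * X (j + 1 - i)) := by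
    rw [hopfPoly, ← Finset.sum_add_distrib]
    refine Finset.sum_congr rfl fun i _ => ?_
    rw [Nat.choose_succ_succ]
    push_cast
    ring
  rw [h1, Finset.sum_range_succ', Finset.sum_range_succ _ (j + 1), hopfPoly, map_sum]
  simp only [totalDeriv_mul, totalDeriv_natCast, totalDeriv_X, mul_zero, add_zero, mul_add,
    Finset.sum_add_distrib]
  rw [Nat.choose_succ_self, Nat.choose_zero_right]
  have h2 : ∑ i ∈ Finset.range (j + 1), ((j + 1).choose (i + 1) : DiffPoly R) *
      (X (i + 1) * X (j + 1 - (i + 1))) = ∑ i ∈ Finset.range (j + 1),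
        ((j + 1).choose (i + 1) : DiffPoly R) * (X (j - i) * X (i + 1)) := by
    refine Finset.sum_congr rfl fun i _ => ?_
    rw [show j + 1 - (i + 1) = j - i by omega]
    ring
  have h3 : ∑ i ∈ Finset.range (j + 1), ((j + 1).choose (i + 1) : DiffPoly R) *
      (X i * X (j + 1 - i)) = ∑ i ∈ Finset.range (j + 1),
        ((j + 1).choose (i + 1) : DiffPoly R) * (X i * X (j - i + 1)) := by
    refine Finset.sum_congr rfl fun i hi => ?_
    rw [show j + 1 - i = j - i + 1 by have := Finset.mem_range.mp hi; omega]
  rw [h2, h3]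
  simp only [Nat.sub_zero]
  push_cast
  ring

theorem totalDeriv_pow_hopf {υ : R} (hυ : D υ = 1) (k : ℕ) :
    (totalDeriv D ^ (k + 1)) (X 0 * C υ) = C υ * X (k + 1) + hopfPoly R k := by
  induction k with
  | zero =>
    rw [zero_add, pow_one, totalDeriv_mul, totalDeriv_C, totalDeriv_X, hυ, hopfPoly]
    simp
    ring
  | succ k ih =>
    rw [totalDeriv_pow_succ, ih, map_add, totalDeriv_mul, totalDeriv_X, totalDeriv_C, hυ,
      hopfPoly_succ (D := D), map_one]
    ring

/-- The operator on densities that represents the bracket with the Hopf Hamiltonian. -/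
def hopfOp (R : Type*) [CommRing R] [Algebra ℝ R] : DiffPoly R →ₗ[R] DiffPoly R :=
  (mkDerivation R (hopfPoly R) : DiffPoly R →ₗ[R] DiffPoly R) - LinearMap.mulLeft R (X 0)

theorem hopfOp_apply (h : DiffPoly R) :
    hopfOp R h = mkDerivation R (hopfPoly R) h - X 0 * h := rfl

theorem eulerLagrange_C (f : R) : eulerLagrange D (C f) = C (D f) := by
  have h1 : jetBound (C f : DiffPoly R) = 1 := by simp [jetBound]
  rw [eulerLagrange_eq_sum D _ 1 h1.le, Finset.sum_range_one]
  exact partialU_C D f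

theorem varDeriv_functionalOf (f : R) : varDeriv D (functionalOf D f) = C (D f) :=
  eulerLagrange_C f

theorem poissonBracket_functionalOf (h : DiffPoly R) (f : R) :
    poissonBracket D (functional D h) (functionalOf D f) =
      functional D (evol D (X 0 * C (D (D f))) h) := by
  rw [poissonBracket_functional, varDeriv_functionalOf, totalDeriv_C]

/-- The part of the field proportional to υ = f₀'' is υ ∂ₓh, which integrates by parts to -u_x h
because υ' = 1. What remains never differentiates coefficients, so the operator is `R`-linear. -/
theorem poissonBracket_hopf {f₀ : R} (h3 : D (D (D f₀)) = 1) (h : DiffPoly R) :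
    poissonBracket D (functional D h) (functionalOf D f₀) = functional D (hopfOp R h) := by
  rw [poissonBracket_functionalOf]
  have h1 : evol D (X 0 * C (D (D f₀))) h =
      C (D (D f₀)) * totalDeriv D h + mkDerivation R (hopfPoly R) h := by
    have h2 : mkDerivation R (fun k => (totalDeriv D ^ (k + 1)) (X 0 * C (D (D f₀)))) =
        (C (D (D f₀)) : DiffPoly R) • jetShift + mkDerivation R (hopfPoly R) := by
      refine derivation_ext fun i => ?_
      rw [mkDerivation_X, totalDeriv_pow_hopf h3, Derivation.add_apply, Derivation.smul_apply,
        jetShift, mkDerivation_X, mkDerivation_X, smul_eq_mul]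
    rw [evol_apply, h2, totalDeriv_apply, Derivation.add_apply, Derivation.smul_apply, smul_eq_mul]
    ring
  rw [h1, map_add, functional_mul_totalDeriv, totalDeriv_C, h3, map_one, mul_one, hopfOp_apply,
    map_sub]
  abel

/-- The eigenvalue contributed by a jet variable. -/
def hopfWeight (j : ℕ) : ℕ := if j = 0 then 1 else j + 2

-- The product u_x u^{(j+1)} sits at both ends of the binomial sum, with coefficients j + 1 and 1;
-- for j = 0 the two ends coincide.
omit [Algebra ℝ R] in
theorem hopfPoly_eq (j : ℕ) : hopfPoly R j = (hopfWeight j : DiffPoly R) * (X 0 * X j) +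
    ∑ i ∈ Finset.Ico 1 j, ((j + 1).choose (i + 1) : DiffPoly R) * (X i * X (j - i)) := by
  cases j with
  | zero => simp [hopfPoly, hopfWeight]
  | succ j =>
    rw [hopfPoly, Finset.sum_range_succ, Finset.range_eq_Ico,
      Finset.sum_eq_sum_Ico_succ_bot (Nat.succ_pos j), hopfWeight, if_neg (Nat.succ_ne_zero j)]
    simp
    ring

theorem natCast_smul_eq (n : ℕ) (h : DiffPoly R) : (n : DiffPoly R) * h = (n : ℝ) • h := by
  rw [Nat.cast_smul_eq_nsmul, nsmul_eq_mul]

/-- The bracket with the Hopf Hamiltonian is triangular on monomials. -/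
theorem hopfOp_monomial (m : ℕ →₀ ℕ) (a : R) :
    ∃ p : DiffPoly R, hopfOp R (monomial m a) =
        ((Finsupp.weight hopfWeight m : ℝ) - 1) • monomial (m + Finsupp.single 0 1) a + p ∧
      ∀ n, coeff n p ≠ 0 → ∃ j i, 1 ≤ i ∧ i < j ∧ m j ≠ 0 ∧
        n + Finsupp.single j 1 = m + Finsupp.single i 1 + Finsupp.single (j - i) 1 := by
  classical
  refine ⟨∑ j ∈ m.support, ∑ i ∈ Finset.Ico 1 j, monomial (m - Finsupp.single j 1 +
    Finsupp.single i 1 + Finsupp.single (j - i) 1)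
      (a * (m j : R) * ((j + 1).choose (i + 1) : R)), ?_, fun n hn => ?_⟩
  · have e1 : ∀ j ∈ m.support, a • (monomial (m - Finsupp.single j 1) (m j : R) •
        hopfPoly R j : DiffPoly R) =
        ((m j * hopfWeight j : ℕ) : ℝ) • monomial (m + Finsupp.single 0 1) a +
        ∑ i ∈ Finset.Ico 1 j, monomial (m - Finsupp.single j 1 +
          Finsupp.single i 1 + Finsupp.single (j - i) 1)
            (a * (m j : R) * ((j + 1).choose (i + 1) : R)) := by
      intro j hj
      have hj' : m - Finsupp.single j 1 + Finsupp.single j 1 = m := tsub_add_cancel_of_le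
        (Finsupp.single_le_iff.mpr (Nat.one_le_iff_ne_zero.mpr (Finsupp.mem_support_iff.mp hj)))
      rw [hopfPoly_eq, smul_add, smul_add, smul_eq_mul, smul_eq_mul, Finset.mul_sum,
        Finset.smul_sum]
      congr 1
      · have e2 : monomial (m + Finsupp.single 0 1) a =
            C a * (X 0 * (X j * monomial (m - Finsupp.single j 1) (1 : R))) := by
          rw [X, X, monomial_mul, monomial_mul, C_mul_monomial]
          congr 1
          · rw [add_comm (Finsupp.single j 1), hj', add_comm]
          · simp
        have e3 : monomial (m - Finsupp.single j 1) (m j : R) =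
            (m j : DiffPoly R) * monomial (m - Finsupp.single j 1) (1 : R) := by
          rw [← map_natCast (C : R →+* DiffPoly R), C_mul_monomial, mul_one]
        rw [e2, ← natCast_smul_eq, smul_eq_C_mul, e3]
        push_cast
        ring
      · refine Finset.sum_congr rfl fun i _ => ?_
        rw [← map_natCast (C : R →+* DiffPoly R), X, X, monomial_mul, C_mul_monomial,
          monomial_mul, smul_monomial]
        congr 1
        · rw [← add_assoc]
        · simp; ring
    rw [hopfOp_apply, mkDerivation_monomial, Finsupp.smul_sum, Finsupp.sum, Finset.sum_congr rfl e1,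
      Finset.sum_add_distrib, ← Finset.sum_smul, sub_smul, one_smul, X, monomial_mul, one_mul,
      Finsupp.weight_apply, Finsupp.sum, add_comm (Finsupp.single 0 1) m]
    push_cast
    simp only [smul_eq_mul, Nat.cast_mul]
    abel
  · rw [coeff_sum] at hn
    obtain ⟨j, hj, hn⟩ := Finset.exists_ne_zero_of_sum_ne_zero hn
    rw [coeff_sum] at hn
    obtain ⟨i, hi, hn⟩ := Finset.exists_ne_zero_of_sum_ne_zero hn
    rw [coeff_monomial] at hn
    have hnm : m - Finsupp.single j 1 + Finsupp.single i 1 + Finsupp.single (j - i) 1 = n := by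
      by_contra h
      exact hn (if_neg h)
    subst hnm
    have hj' := Finsupp.mem_support_iff.mp hj
    obtain ⟨h1, h2⟩ := Finset.mem_Ico.mp hi
    refine ⟨j, i, h1, h2, hj', ?_⟩
    rw [add_right_comm _ _ (Finsupp.single j 1), add_right_comm _ _ (Finsupp.single j 1),
      tsub_add_cancel_of_le (Finsupp.single_le_iff.mpr (Nat.one_le_iff_ne_zero.mpr hj'))]

/-- Splitting X_j into X_i X_{j-i} lowers the key, since 3^i + 3^{j-i} ≤ 2·3^{j-1} < 3^j. -/
theorem key_lt_of_add_eq {m n : ℕ →₀ ℕ} {i j : ℕ} (hi : 1 ≤ i) (hij : i < j)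
    (h : n + Finsupp.single j 1 = m + Finsupp.single i 1 + Finsupp.single (j - i) 1) :
    Finsupp.weight jetWeight n = Finsupp.weight jetWeight m + 1 ∧
      Finsupp.degree n = Finsupp.degree m + 1 ∧ jetKey n < jetKey m := by
  have e1 := congrArg (Finsupp.weight jetWeight) h
  have e2 := congrArg Finsupp.degree h
  have e3 := congrArg jetKey h
  obtain ⟨l, rfl⟩ : ∃ l, j = l + 1 := ⟨j - 1, by omega⟩
  have e4 : 3 ^ i ≤ 3 ^ l := Nat.pow_le_pow_right (by norm_num) (by omega)
  have e5 : 3 ^ (l + 1 - i) ≤ 3 ^ l := Nat.pow_le_pow_right (by norm_num) (by omega)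
  have e6 : 1 ≤ 3 ^ l := Nat.one_le_pow _ _ (by norm_num)
  simp only [jetKey, map_add, Finsupp.weight_single, Finsupp.degree_single, smul_eq_mul,
    jetWeight, one_mul, pow_succ 3 l] at e1 e2 e3 ⊢
  refine ⟨by omega, by omega, by omega⟩

/-- Each jet factor contributes at least 1, so the diagonal coefficient Λ - 1 is nonzero and can be
divided by. -/
theorem one_lt_hopfWeight {m : ℕ →₀ ℕ} {k : ℕ} (hk : 2 ≤ m k) :
    2 ≤ Finsupp.weight hopfWeight m := by
  have h1 : Finsupp.degree m ≤ Finsupp.weight hopfWeight m := by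
    rw [Finsupp.weight_apply, Finsupp.degree_apply, Finsupp.sum]
    refine Finset.sum_le_sum fun i _ => ?_
    rw [smul_eq_mul]
    refine Nat.le_mul_of_pos_right _ ?_
    rw [hopfWeight]
    split_ifs <;> omega
  exact (hk.trans (Finsupp.le_degree k m)).trans h1

theorem IsReduced.exists_top {m : ℕ →₀ ℕ} (hm : IsReduced m) (h0 : m ≠ 0) :
    ∃ k, 2 ≤ m k ∧ ∀ j, k < j → m j = 0 := by
  classical
  have hne : m.support.Nonempty := Finsupp.support_nonempty_iff.mpr h0
  have htop : ∀ j, m.support.max' hne < j → m j = 0 := fun j hj => by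
    by_contra hc
    exact absurd (m.support.le_max' j (Finsupp.mem_support_iff.mpr hc)) (by omega)
  refine ⟨m.support.max' hne, ?_, htop⟩
  have h1 := Finsupp.mem_support_iff.mp (m.support.max'_mem hne)
  have h2 := hm _ htop
  omega

/-- The bracket with the Hopf Hamiltonian is injective in positive degree. -/
theorem eq_zero_of_poissonBracket_hopf (hD : Function.Surjective D) {f₀ : R}
    (h3 : D (D (D f₀)) = 1) {d : ℕ} (hd : d ≠ 0) {G : LocalFunctional D} (hG : IsHomF D G d)
    (h0 : poissonBracket D (functionalOf D f₀) G = 0) : G = 0 := by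
  classical
  obtain ⟨g, hg, rfl⟩ := hG
  obtain ⟨h, hh, hred, hhg⟩ := exists_reduced_density hD (isHom_iff_mem_jetFiltration.mp hg)
  rw [← hhg] at h0 ⊢
  rw [poissonBracket_antisymm, neg_eq_zero, poissonBracket_hopf h3] at h0
  obtain ⟨W, hW⟩ := functional_eq_zero_iff.mp h0
  suffices h = 0 by rw [this, map_zero]
  by_contra hne
  obtain ⟨m₀, hm₀⟩ := MvPolynomial.ne_zero_iff.mp hne
  have hm0 : m₀ ≠ 0 := by
    rintro rfl
    exact hd ((hh 0 hm₀).1.symm.trans (map_zero _))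
  obtain ⟨k, hk, m₁, hm₁, hm₁k⟩ := exists_top_variable hm₀ hm0
  -- Among the monomials containing the top variable X_k, one of maximal key is taken: its image u_x
  -- m cannot be cancelled by lower terms of the others.
  obtain ⟨m, hmS, hmax⟩ := Finset.exists_max_image (h.support.filter fun n => n k ≠ 0) jetKey
    ⟨m₁, Finset.mem_filter.mpr ⟨mem_support_iff.mpr hm₁, hm₁k⟩⟩
  obtain ⟨hm, hmk⟩ := Finset.mem_filter.mp hmS
  have hm := mem_support_iff.mp hm
  have hm2 : 2 ≤ m k := by
    have := hred m hm k fun j hj => by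
      by_contra hc
      exact hm (hk j hj m hc)
    omega
  choose p hp hp' using fun n => hopfOp_monomial (R := R) n (coeff n h)
  have hop : hopfOp R h = ∑ n ∈ h.support, (((Finsupp.weight hopfWeight n : ℝ) - 1) •
      monomial (n + Finsupp.single 0 1) (coeff n h) + p n) := by
    conv_lhs => rw [h.as_sum, map_sum]
    exact Finset.sum_congr rfl fun n _ => hp n
  have hvars : ∀ j, k < j → pderiv j (totalDeriv D W) = 0 := by
    intro j hj
    rw [hW, pderiv_eq_zero_iff]
    intro n hn
    rw [hop, coeff_sum]
    refine Finset.sum_eq_zero fun n' hn' => ?_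
    have hn's := mem_support_iff.mp hn'
    have hn'0 : ∀ l, k < l → n' l = 0 := fun l hl => by
      by_contra hc
      exact hn's (hk l hl n' hc)
    rw [coeff_add, coeff_smul, coeff_monomial, if_neg, smul_zero, zero_add]
    · by_contra hc
      obtain ⟨j', i, h1, h2, h4, h5⟩ := hp' n' n hc
      have h6 := DFunLike.congr_fun h5 j
      have h7 : j' ≤ k := by
        by_contra hc
        exact h4 (hn'0 j' (by omega))
      simp only [Finsupp.add_apply, hn'0 j hj] at h6
      rw [Finsupp.single_eq_of_ne (by omega), Finsupp.single_eq_of_ne (by omega),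
        Finsupp.single_eq_of_ne (by omega)] at h6
      omega
    · rintro rfl
      rw [Finsupp.add_apply, hn'0 j hj, Finsupp.single_eq_of_ne (by omega)] at hn
      exact hn rfl
  -- The monomial u_x m is at least quadratic in the top variable, so its coefficient in a total
  -- derivative vanishes.
  have hc := coeff_totalDeriv_eq_zero hvars (n := m + Finsupp.single 0 1)
    (by rw [Finsupp.add_apply]; omega)
  rw [hW, hop, coeff_sum, Finset.sum_eq_single m] at hc
  · rw [coeff_add, coeff_smul, coeff_monomial, if_pos rfl] at hc
    have hp0 : coeff (m + Finsupp.single 0 1) (p m) = 0 := by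
      by_contra hc
      obtain ⟨j, i, h1, h2, h4, h5⟩ := hp' m _ hc
      have := (key_lt_of_add_eq h1 h2 h5).2.2
      simp [jetKey, Finsupp.weight_single] at this
    rw [hp0, add_zero, smul_eq_zero_iff_right] at hc
    · exact hm hc
    · have := one_lt_hopfWeight hm2
      have h8 : (2 : ℝ) ≤ Finsupp.weight hopfWeight m := by exact_mod_cast this
      linarith
  · intro n hn hnm
    rw [coeff_add, coeff_smul, coeff_monomial, if_neg (fun h => hnm (add_right_cancel h)),
      smul_zero, zero_add]
    by_contra hc
    -- A lower term of n equal to u_x m would make n contain X_k and have larger key than m, against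
    -- maximality.
    obtain ⟨j, i, h1, h2, h4, h5⟩ := hp' n _ hc
    have h6 := (key_lt_of_add_eq h1 h2 h5).2.2
    have h7 : j ≤ k := by
      by_contra hc
      exact mem_support_iff.mp hn (hk j (by omega) n h4)
    have h8 : n k ≠ 0 := by
      by_cases hjk : j = k
      · exact hjk ▸ h4
      · have h9 := DFunLike.congr_fun h5 k
        simp only [Finsupp.add_apply] at h9
        rw [Finsupp.single_eq_of_ne (a := j) (by omega), Finsupp.single_eq_of_ne (a := i) (by omega),
          Finsupp.single_eq_of_ne (a := j - i) (by omega)] at h9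
        omega
    have h10 := hmax n (Finset.mem_filter.mpr ⟨hn, h8⟩)
    have h11 : jetKey m ≤ jetKey (m + Finsupp.single 0 1) := by simp [jetKey]
    omega
  · intro h
    exact (h (mem_support_iff.mpr hm)).elim

/-- Reduced monomials that are not `u_x` times a nonconstant reduced monomial. -/
def IsResidual (m : ℕ →₀ ℕ) : Prop := IsReduced m ∧ (m 0 ≠ 0 → m = Finsupp.single 0 2)

/-- Every functional is the bracket of the Hopf Hamiltonian with some functional up to residual
monomials. -/
theorem functional_mem_of_residual (hD : Function.Surjective D) {f₀ : R}
    (h3 : D (D (D f₀)) = 1) (P : AddSubgroup (LocalFunctional D)) {d r : ℕ}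
    (hP : ∀ k ∈ jetFiltration R d r,
      poissonBracket D (functionalOf D f₀) (functional D k) ∈ P)
    (hres : ∀ m, Finsupp.weight jetWeight m = d + 1 → r + 1 ≤ Finsupp.degree m → IsResidual m →
      ∀ a, functional D (monomial m a) ∈ P)
    {h : DiffPoly R} (hh : h ∈ jetFiltration R (d + 1) (r + 1)) : functional D h ∈ P := by
  refine functional_mem_of_reduced hD P (fun m hd hr hm ih a => ?_) hh
  by_cases hm' : IsResidual m
  · exact hres m hd hr hm' a
  have h0 : m 0 ≠ 0 ∧ m ≠ Finsupp.single 0 2 := by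
    simpa [IsResidual, hm] using hm'
  obtain ⟨n, rfl⟩ : ∃ n, m = n + Finsupp.single 0 1 :=
    ⟨m - Finsupp.single 0 1, (tsub_add_cancel_of_le
      (Finsupp.single_le_iff.mpr (Nat.one_le_iff_ne_zero.mpr h0.1))).symm⟩
  -- Removing one u_x keeps an exponent at least 2: either the top variable is not u_x, or m is a
  -- power of u_x other than u_x².
  have hn : ∃ k, 2 ≤ n k := by
    obtain ⟨k, hk, hk'⟩ := hm.exists_top (fun h => h0.1 (by rw [h]; rfl))
    cases k with
    | succ k => exact ⟨k + 1, by simpa using hk⟩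
    | zero =>
      refine ⟨0, ?_⟩
      by_contra hc
      refine h0.2 ?_
      ext j
      cases j with
      | zero => simp at hk ⊢; omega
      | succ j => rw [hk' _ (Nat.succ_pos j)]; simp
  obtain ⟨k, hk⟩ := hn
  have hΛ : (Finsupp.weight hopfWeight n : ℝ) - 1 ≠ 0 := by
    have h8 : (2 : ℝ) ≤ Finsupp.weight hopfWeight n := by exact_mod_cast one_lt_hopfWeight hk
    linarith
  set b : R := ((Finsupp.weight hopfWeight n : ℝ) - 1)⁻¹ • a with hb
  obtain ⟨p, hp, hp'⟩ := hopfOp_monomial (R := R) n b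
  -- The leading term is traded for a bracket with H₀; the error p has smaller key, so the induction
  -- hypothesis applies.
  have e1 : functional D (monomial (n + Finsupp.single 0 1) a) =
      -poissonBracket D (functionalOf D f₀) (functional D (monomial n b)) - functional D p := by
    rw [← poissonBracket_antisymm, poissonBracket_hopf h3, hp, map_add, add_sub_cancel_right, smul_monomial,
      hb, smul_smul, mul_inv_cancel₀ hΛ, one_smul]
  rw [map_add, Finsupp.weight_single] at hd
  rw [map_add, Finsupp.degree_single] at hr
  rw [e1]
  refine sub_mem (neg_mem (hP _ (monomial_mem_jetFiltration ?_ ?_ _))) ?_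
  · simpa using hd
  · simpa using hr
  · refine functional_mem_of_monomials P fun l hl c => ?_
    obtain ⟨j, i, h1, h2, h4, h5⟩ := hp' l hl
    obtain ⟨e1, e2, e3⟩ := key_lt_of_add_eq h1 h2 h5
    refine ih l ?_ ?_ ?_ c
    · rw [e1, ← hd]; simp
    · rw [e2, map_add, Finsupp.degree_single]
    · refine e3.trans_le ?_
      simp [jetKey]

end

noncomputable section

variable {R : Type*} [CommRing R] [Algebra ℝ R] {D : Derivation ℝ R R}

/-! ### Residual densities of low degree -/

theorem exists_residual_density (hD : Function.Surjective D) {f₀ : R} (h3 : D (D (D f₀)) = 1)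
    {d r : ℕ} {h : DiffPoly R} (hh : h ∈ jetFiltration R (d + 1) (r + 1)) :
    ∃ k ∈ jetFiltration R d r, ∃ e ∈ jetFiltration R (d + 1) (r + 1),
      (∀ m, coeff m e ≠ 0 → IsResidual m) ∧ functional D h =
        poissonBracket D (functionalOf D f₀) (functional D k) + functional D e := by
  classical
  let P : AddSubgroup (LocalFunctional D) :=
    { carrier := {G | ∃ k ∈ jetFiltration R d r, ∃ e ∈ jetFiltration R (d + 1) (r + 1),
        (∀ m, coeff m e ≠ 0 → IsResidual m) ∧ G =
          poissonBracket D (functionalOf D f₀) (functional D k) + functional D e}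
      zero_mem' := ⟨0, zero_mem _, 0, zero_mem _, fun m hm => (hm (coeff_zero m)).elim, by
        rw [map_zero, poissonBracket_zero_right, add_zero]⟩
      add_mem' := by
        rintro _ _ ⟨k, hk, e, he, he', rfl⟩ ⟨l, hl, f, hf, hf', rfl⟩
        refine ⟨k + l, add_mem hk hl, e + f, add_mem he hf, fun m hm => ?_, ?_⟩
        · by_cases h0 : coeff m e = 0
          · exact hf' m fun h1 => hm (by rw [coeff_add, h0, h1, add_zero])
          · exact he' m h0
        · rw [map_add, map_add, poissonBracket_add_right]
          abel
      neg_mem' := by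
        rintro _ ⟨k, hk, e, he, he', rfl⟩
        refine ⟨-k, neg_mem hk, -e, neg_mem he, fun m hm => he' m (by simpa using hm), ?_⟩
        rw [map_neg, map_neg, poissonBracket_neg_right]
        abel }
  refine functional_mem_of_residual hD h3 P (fun k hk => ?_) (fun m hd hr hm a => ?_) hh
  · exact ⟨k, hk, 0, zero_mem _, fun m hm => (hm (coeff_zero m)).elim, by
      rw [map_zero, add_zero]⟩
  · refine ⟨0, zero_mem _, monomial m a, monomial_mem_jetFiltration hd hr a, fun n hn => ?_, by
      rw [map_zero, poissonBracket_zero_right, zero_add]⟩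
    rw [coeff_monomial] at hn
    obtain rfl : m = n := by by_contra h; exact hn (if_neg h)
    exact hm

theorem mem_jetFiltration_one {d : ℕ} {h : DiffPoly R} (hh : IsHom h (d + 1)) :
    h ∈ jetFiltration R (d + 1) 1 := fun m hm => by
  refine ⟨hh hm, Nat.one_le_iff_ne_zero.mpr fun h0 => ?_⟩
  rw [Finsupp.degree_eq_zero_iff] at h0
  have := hh hm
  rw [h0, map_zero] at this
  omega

theorem le_weight_of_apply (m : ℕ →₀ ℕ) (k : ℕ) :
    m k * (k + 1) ≤ Finsupp.weight jetWeight m := by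
  classical
  by_cases hk : k ∈ m.support
  · rw [Finsupp.weight_apply, Finsupp.sum]
    exact Finset.single_le_sum (f := fun i => m i • jetWeight i) (fun _ _ => Nat.zero_le _) hk
  · rw [Finsupp.notMem_support_iff.mp hk, zero_mul]
    exact Nat.zero_le _

/-- The exponents of a reduced monomial of differential degree at most `9`. -/
theorem IsReduced.exponents {m : ℕ →₀ ℕ} (hm : IsReduced m)
    (hd : Finsupp.weight jetWeight m ≤ 9) :
    m = Finsupp.single 0 (m 0) + Finsupp.single 1 (m 1) + Finsupp.single 2 (m 2) +
      Finsupp.single 3 (m 3) ∧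
    Finsupp.weight jetWeight m = m 0 + 2 * m 1 + 3 * m 2 + 4 * m 3 ∧
    Finsupp.degree m = m 0 + m 1 + m 2 + m 3 ∧ m 3 ≠ 1 ∧ (m 3 = 0 → m 2 ≠ 1) ∧
      (m 3 = 0 → m 2 = 0 → m 1 ≠ 1) := by
  have h4 : ∀ j, 3 < j → m j = 0 := by
    by_cases h0 : m = 0
    · rw [h0]; exact fun _ _ => rfl
    obtain ⟨k, hk, hk'⟩ := hm.exists_top h0
    have h1 := (le_weight_of_apply m k).trans hd
    have h2 : k ≤ 3 := by nlinarith
    exact fun j hj => hk' j (by omega)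
  have hmm : m = Finsupp.single 0 (m 0) + Finsupp.single 1 (m 1) + Finsupp.single 2 (m 2) +
      Finsupp.single 3 (m 3) := by
    ext j
    rcases Nat.lt_or_ge 3 j with hj | hj
    · simp only [Finsupp.add_apply]
      rw [h4 j hj, Finsupp.single_eq_of_ne (by omega), Finsupp.single_eq_of_ne (by omega),
        Finsupp.single_eq_of_ne (by omega), Finsupp.single_eq_of_ne (by omega)]
      rfl
    · interval_cases j <;> simp
  refine ⟨hmm, ?_, ?_, hm 3 h4, fun e3 => hm 2 fun j hj => ?_, fun e3 e2 => hm 1 fun j hj => ?_⟩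
  · conv_lhs => rw [hmm]
    simp only [map_add, Finsupp.weight_single, jetWeight, smul_eq_mul]
    ring
  · conv_lhs => rw [hmm]
    simp only [map_add, Finsupp.degree_single]
  · rcases Nat.lt_or_ge 3 j with hj' | hj'
    · exact h4 j hj'
    · rwa [show j = 3 by omega]
  · rcases Nat.lt_or_ge 3 j with hj' | hj'
    · exact h4 j hj'
    · obtain rfl | rfl : j = 2 ∨ j = 3 := by omega
      · exact e2
      · exact e3

theorem IsResidual.exponents {m : ℕ →₀ ℕ} (hm : IsResidual m) :
    m 0 = 0 ∨ (m 0 = 2 ∧ m 1 = 0 ∧ m 2 = 0 ∧ m 3 = 0) := by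
  by_cases h0 : m 0 = 0
  · exact Or.inl h0
  · right
    rw [hm.2 h0]
    simp

/-- Degrees 1, 3, 5, 7 have no residual monomial. In degree 9 the only one is u_xxx³, excluded by
requiring four factors. -/
theorem eq_zero_of_residual {d r : ℕ} (hdr : d = 1 ∨ d = 3 ∨ d = 5 ∨ d = 7 ∨ d = 9 ∧ r = 4)
    {e : DiffPoly R} (he : e ∈ jetFiltration R d r) (hres : ∀ m, coeff m e ≠ 0 → IsResidual m) :
    e = 0 := by
  by_contra hne
  obtain ⟨m, hm⟩ := MvPolynomial.ne_zero_iff.mp hne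
  obtain ⟨h1, h2⟩ := he m hm
  obtain ⟨-, h3, h4, h5, h6, h7⟩ := (hres m hm).1.exponents (by omega)
  have h8 := (hres m hm).exponents
  omega

omit [Algebra ℝ R] in
theorem eq_sum_of_support_subset {e : DiffPoly R} (s : Finset (ℕ →₀ ℕ))
    (h : ∀ m, coeff m e ≠ 0 → m ∈ s) : e = ∑ m ∈ s, monomial m (coeff m e) := by
  conv_lhs => rw [e.as_sum]
  refine Finset.sum_subset (fun m hm => h m (mem_support_iff.mp hm)) fun m _ hm => ?_
  rw [notMem_support_iff.mp hm, monomial_zero]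

theorem residual_two {r : ℕ} {e : DiffPoly R} (he : e ∈ jetFiltration R 2 r)
    (hres : ∀ m, coeff m e ≠ 0 → IsResidual m) : ∃ a, e = C a * X 0 ^ 2 := by
  refine ⟨coeff (Finsupp.single 0 2) e,
    (eq_sum_of_support_subset {Finsupp.single 0 2} fun m hm => ?_).trans ?_⟩
  · obtain ⟨h1, h2⟩ := he m hm
    obtain ⟨h, h3, h4, h5, h6, h7⟩ := (hres m hm).1.exponents (by omega)
    have h8 := (hres m hm).exponents
    rw [Finset.mem_singleton, h, show m 0 = 2 by omega, show m 1 = 0 by omega,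
      show m 2 = 0 by omega, show m 3 = 0 by omega]
    simp
  · rw [Finset.sum_singleton, X_pow_eq_monomial, C_mul_monomial, mul_one]

theorem residual_four {r : ℕ} {e : DiffPoly R} (he : e ∈ jetFiltration R 4 r)
    (hres : ∀ m, coeff m e ≠ 0 → IsResidual m) : ∃ a, e = C a * X 1 ^ 2 := by
  refine ⟨coeff (Finsupp.single 1 2) e,
    (eq_sum_of_support_subset {Finsupp.single 1 2} fun m hm => ?_).trans ?_⟩
  · obtain ⟨h1, h2⟩ := he m hm
    obtain ⟨h, h3, h4, h5, h6, h7⟩ := (hres m hm).1.exponents (by omega)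
    have h8 := (hres m hm).exponents
    rw [Finset.mem_singleton, h, show m 0 = 0 by omega, show m 1 = 2 by omega,
      show m 2 = 0 by omega, show m 3 = 0 by omega]
    simp
  · rw [Finset.sum_singleton, X_pow_eq_monomial, C_mul_monomial, mul_one]

theorem residual_six {r : ℕ} {e : DiffPoly R} (he : e ∈ jetFiltration R 6 r)
    (hres : ∀ m, coeff m e ≠ 0 → IsResidual m) :
    ∃ a b, e = C a * X 2 ^ 2 + C b * X 1 ^ 3 := by
  classical
  refine ⟨coeff (Finsupp.single 2 2) e, coeff (Finsupp.single 1 3) e,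
    (eq_sum_of_support_subset {Finsupp.single 2 2, Finsupp.single 1 3}
    fun m hm => ?_).trans ?_⟩
  · obtain ⟨h1, h2⟩ := he m hm
    obtain ⟨h, h3, h4, h5, h6, h7⟩ := (hres m hm).1.exponents (by omega)
    have h8 := (hres m hm).exponents
    rw [Finset.mem_insert, Finset.mem_singleton, h, show m 0 = 0 by omega, show m 3 = 0 by omega]
    rcases (by omega : m 1 = 0 ∧ m 2 = 2 ∨ m 1 = 3 ∧ m 2 = 0) with ⟨h9, h10⟩ | ⟨h9, h10⟩ <;>
      rw [h9, h10] <;> simp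
  · rw [Finset.sum_pair, X_pow_eq_monomial, X_pow_eq_monomial, C_mul_monomial, C_mul_monomial,
      mul_one, mul_one]
    intro h
    have := DFunLike.congr_fun h 1
    simp at this

/-- Solvability of the homological equation. -/
theorem exists_poissonBracket_eq (hD : Function.Surjective D) {f₀ : R} (h3 : D (D (D f₀)) = 1)
    {d r : ℕ} (hdr : d = 0 ∨ d = 2 ∨ d = 4 ∨ d = 6 ∨ d = 8 ∧ r = 3) {h : DiffPoly R}
    (hh : h ∈ jetFiltration R (d + 1) (r + 1)) :
    ∃ k ∈ jetFiltration R d r,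
      poissonBracket D (functionalOf D f₀) (functional D k) = functional D h := by
  obtain ⟨k, hk, e, he, hres, h1⟩ := exists_residual_density hD h3 hh
  rw [eq_zero_of_residual (by omega) he hres, map_zero, add_zero] at h1
  exact ⟨k, hk, h1.symm⟩

theorem exists_potential (hD : Function.Surjective D) {f₀ : R}
    (h3 : D (D (D f₀)) = 1) {d : ℕ} (hd : d = 0 ∨ d = 2 ∨ d = 4 ∨ d = 6)
    {G : LocalFunctional D} (hG : IsHomF D G (d + 1)) :
    ∃ K, IsHomF D K d ∧ poissonBracket D (functionalOf D f₀) K = G := by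
  obtain ⟨g, hg, rfl⟩ := hG
  obtain ⟨k, hk, h1⟩ := exists_poissonBracket_eq hD h3 (r := 0) (by omega)
    (mem_jetFiltration_one hg)
  exact ⟨_, isHomF_functional (isHom_of_mem_jetFiltration hk), h1⟩

theorem eq_zero_of_isHomF_one (hD : Function.Surjective D) {f₀ : R}
    (h3 : D (D (D f₀)) = 1) {G : LocalFunctional D} (hG : IsHomF D G 1) : G = 0 := by
  obtain ⟨K, ⟨k, hk, rfl⟩, rfl⟩ := exists_potential hD h3 (d := 0) (by omega) hG
  have h1 : k = C (coeff 0 k) := by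
    refine (eq_sum_of_support_subset {0} fun m hm => ?_).trans (Finset.sum_singleton _ _)
    have h2 := hk hm
    rw [Finset.mem_singleton]
    ext j
    have h3 := le_weight_of_apply m j
    rw [h2] at h3
    simp only [Finsupp.zero_apply]
    nlinarith
  rw [h1, poissonBracket_antisymm, poissonBracket_functionalOf, evol_C, neg_eq_zero]
  obtain ⟨b, hb⟩ := hD (D (D f₀) * D (coeff 0 k))
  refine functional_eq_zero_iff.mpr ⟨C b, ?_⟩
  rw [totalDeriv_C, hb, C_mul]
  ring

/-! ### Series of Hamiltonians -/

theorem isHomF_seriesBracket {H F : HamSeries D} {a : ℕ} (hH : ∀ n, IsHomF D (H n) (n + a))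
    (hF : IsGraded D F) (n : ℕ) : IsHomF D (seriesBracket D H F n) (n + a + 1) := by
  refine IsHomF.sum _ _ fun ij hij => ?_
  have h1 := (hH ij.1).poissonBracket (hF ij.2)
  have h2 := Finset.HasAntidiagonal.mem_antidiagonal.mp hij
  rwa [show ij.1 + a + ij.2 + 1 = n + a + 1 by omega] at h1

/-- Hamiltonians that commute with a perturbation of the Hopf Hamiltonian commute with each
other. -/
theorem seriesBracket_isBigOEps (hD : Function.Surjective D) {f₀ : R} (h3 : D (D (D f₀)) = 1)
    {H F G : HamSeries D} (hF : IsGraded D F) (hG : IsGraded D G) (h0 : H 0 = functionalOf D f₀)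
    {N : ℕ} (hHF : IsBigOEps D (seriesBracket D H F) N)
    (hHG : IsBigOEps D (seriesBracket D H G) N) : IsBigOEps D (seriesBracket D F G) N := by
  intro n
  induction n using Nat.strong_induction_on with
  | _ n ih =>
    intro hn
    have hz : ∀ A B : HamSeries D, (∀ k < N, A k = 0) → seriesBracket D A B n = 0 := by
      intro A B hA
      refine Finset.sum_eq_zero fun ij hij => ?_
      have := Finset.HasAntidiagonal.mem_antidiagonal.mp hij
      rw [hA ij.1 (by omega), poissonBracket_zero_left]
    -- At order n the right side of the Jacobi identity vanishes, and by induction the left side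
    -- reduces to {H₀, {F, G}_n}. Injectivity applies because {F, G}_n has degree n + 1 > 0.
    have h1 := congrFun (seriesBracket_jacobi H F G) n
    rw [Pi.sub_apply, hz _ _ hHF, hz _ _ hHG, sub_zero, seriesBracket_apply,
      Finset.sum_eq_single (0, n), h0] at h1
    · exact eq_zero_of_poissonBracket_hopf hD h3 (Nat.succ_ne_zero n)
        (isHomF_seriesBracket (a := 0) hF hG n) h1
    · intro ij hij hne
      have h2 := Finset.HasAntidiagonal.mem_antidiagonal.mp hij
      have h4 : ij.1 ≠ 0 := fun h => hne (Prod.ext h (by simp only; omega))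
      rw [ih ij.2 (by omega) (by omega), poissonBracket_zero_right]
    · intro h
      exact (h (by simp)).elim

theorem seriesBracket_update_of_lt (H F : HamSeries D) {n k : ℕ} (hk : k < n)
    (G : LocalFunctional D) :
    seriesBracket D H (Function.update F n G) k = seriesBracket D H F k := by
  refine Finset.sum_congr rfl fun ij hij => ?_
  have := Finset.HasAntidiagonal.mem_antidiagonal.mp hij
  rw [Function.update_of_ne (by omega)]

theorem seriesBracket_update (H F : HamSeries D) {n : ℕ} (hF : F n = 0) (G : LocalFunctional D) :
    seriesBracket D H (Function.update F n G) n =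
      seriesBracket D H F n + poissonBracket D (H 0) G := by
  have h1 : poissonBracket D (H 0) G = ∑ ij ∈ Finset.HasAntidiagonal.antidiagonal n,
      if ij = (0, n) then poissonBracket D (H 0) G else 0 := by
    rw [Finset.sum_ite_eq' , if_pos (by simp)]
  rw [h1, seriesBracket_apply, seriesBracket_apply, ← Finset.sum_add_distrib]
  refine Finset.sum_congr rfl fun ij hij => ?_
  have h2 := Finset.HasAntidiagonal.mem_antidiagonal.mp hij
  by_cases h : ij = (0, n)
  · rw [if_pos h, h, Function.update_self, hF, poissonBracket_zero_right, zero_add]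
  · have h4 : ij.2 ≠ n := fun h' => h (Prod.ext (by simp only; omega) h')
    rw [if_neg h, Function.update_of_ne h4, add_zero]

theorem isGraded_update {F : HamSeries D} (hF : IsGraded D F) {n : ℕ} {G : LocalFunctional D}
    (hG : IsHomF D G n) : IsGraded D (Function.update F n G) := by
  intro k
  rcases eq_or_ne k n with rfl | h
  · rw [Function.update_self]; exact hG
  · rw [Function.update_of_ne h]; exact hF k

/-- One order of the homological equation can be solved by changing one term. -/
theorem exists_update_seriesBracket {f₀ : R} {H F : HamSeries D}
    (h0 : H 0 = functionalOf D f₀) (hF : IsGraded D F) {n : ℕ} (hFn : F n = 0)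
    (hsol : ∃ K, IsHomF D K n ∧
      poissonBracket D (functionalOf D f₀) K = seriesBracket D H F n) :
    ∃ G, IsGraded D (Function.update F n G) ∧
      seriesBracket D H (Function.update F n G) n = 0 := by
  obtain ⟨K, hK, h1⟩ := hsol
  refine ⟨-K, isGraded_update hF hK.neg, ?_⟩
  rw [seriesBracket_update H F hFn, h0, poissonBracket_neg_right, h1, add_neg_cancel]

theorem seriesBracket_odd {H F : HamSeries D} (hH : ∀ n, Odd n → H n = 0)
    (hF : ∀ n, Odd n → F n = 0) {n : ℕ} (hn : Odd n) : seriesBracket D H F n = 0 := by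
  refine Finset.sum_eq_zero fun ij hij => ?_
  have h1 := Finset.HasAntidiagonal.mem_antidiagonal.mp hij
  rw [← h1, Nat.odd_add] at hn
  by_cases h : Odd ij.1
  · rw [hH _ h, poissonBracket_zero_left]
  · rw [hF ij.2 (Nat.not_even_iff_odd.mp fun h' => h (hn.mpr h')), poissonBracket_zero_right]

omit [Algebra ℝ R] in
theorem isHom_C (f : R) : IsHom (C f : DiffPoly R) 0 := isWeightedHomogeneous_C _ _

/-- Every `∫ f dx` has a deformation that commutes with an even perturbation of the Hopf
Hamiltonian up to order `7`. -/
theorem exists_commuting_series (hD : Function.Surjective D) {f₀ : R} (h3 : D (D (D f₀)) = 1)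
    {H : HamSeries D} (hH : IsGraded D H) (h0 : H 0 = functionalOf D f₀)
    (hodd : ∀ n, Odd n → H n = 0) (f : R) :
    ∃ F : HamSeries D, IsGraded D F ∧ F 0 = functionalOf D f ∧ (∀ n, Odd n → F n = 0) ∧
      F 8 = 0 ∧ IsBigOEps D (seriesBracket D H F) 8 := by
  have step : ∀ N ≤ 4, ∃ F : HamSeries D, IsGraded D F ∧ F 0 = functionalOf D f ∧
      (∀ n, Odd n → F n = 0) ∧ (∀ n, 2 * N ≤ n → n ≠ 0 → F n = 0) ∧
      IsBigOEps D (seriesBracket D H F) (2 * N) := by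
    intro N
    induction N with
    | zero =>
      intro _
      refine ⟨Function.update 0 0 (functionalOf D f), isGraded_update (fun n => isHomF_zero n)
        (isHomF_functional (isHom_C f)), Function.update_self _ _ _, fun n hn => ?_,
        fun n _ hn => ?_, fun k hk => by omega⟩
      · rw [Function.update_of_ne (by rintro rfl; exact absurd hn (by decide))]; rfl
      · rw [Function.update_of_ne hn]; rfl
    | succ N ih =>
      intro hN
      obtain ⟨F, hF, hF0, hFodd, hFz, hFc⟩ := ih (by omega)
      rcases Nat.eq_zero_or_pos N with rfl | hpos
      -- No correction is needed at order 0: the bracket there has degree 1, and every functional of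
      -- degree 1 is zero.
      · refine ⟨F, hF, hF0, hFodd, fun n h1 h2 => hFz n (by omega) h2, fun k hk => ?_⟩
        obtain rfl | rfl : k = 0 ∨ k = 1 := by omega
        · exact eq_zero_of_isHomF_one hD h3 (isHomF_seriesBracket (a := 0) hH hF 0)
        · exact seriesBracket_odd hodd hFodd (by decide)
      -- Here N is 1, 2 or 3, so the equation has degree 3, 5 or 7 and is solvable. The following
      -- odd order vanishes by parity.
      · obtain ⟨G, hG1, hG2⟩ := exists_update_seriesBracket h0 hF (hFz (2 * N) le_rfl (by omega))
          (exists_potential hD h3 (by omega)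
            (isHomF_seriesBracket (a := 0) hH hF (2 * N)))
        have hodd' : ∀ n, Odd n → Function.update F (2 * N) G n = 0 := fun n hn => by
          have hne : n ≠ 2 * N := by
            rintro rfl
            exact Nat.not_odd_iff_even.mpr (even_two_mul N) hn
          rw [Function.update_of_ne hne]
          exact hFodd n hn
        refine ⟨Function.update F (2 * N) G, hG1, ?_, hodd', fun n h1 h2 => ?_, fun k hk => ?_⟩
        · rw [Function.update_of_ne (by omega), hF0]
        · rw [Function.update_of_ne (by omega)]
          exact hFz n (by omega) h2
        · rcases Nat.lt_or_ge k (2 * N) with h | h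
          · rw [seriesBracket_update_of_lt _ _ h]
            exact hFc k h
          · obtain rfl | rfl : k = 2 * N ∨ k = 2 * N + 1 := by omega
            · exact hG2
            · exact seriesBracket_odd hodd hodd' (odd_two_mul_add_one N)
  obtain ⟨F, h1, h2, h4, h5, h6⟩ := step 4 le_rfl
  exact ⟨F, h1, h2, h4, h5 8 le_rfl (by omega), h6⟩

/-- Integrability follows from the existence of deformations commuting with the Hamiltonian. -/
theorem isIntegrableOf_of_commuting (hD : Function.Surjective D) {f₀ : R}
    (h3 : D (D (D f₀)) = 1) {H : HamSeries D} (hH : IsGraded D H)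
    (h0 : H 0 = functionalOf D f₀) {N : ℕ}
    (hF : ∀ f, ∃ F : HamSeries D, IsGraded D F ∧ F 0 = functionalOf D f ∧
      IsBigOEps D (seriesBracket D H F) (N + 1)) : IsIntegrableOf D f₀ N H := by
  classical
  choose F hF1 hF2 hF3 using hF
  -- The member of the family at f₀ must be H itself, which commutes with H by antisymmetry.
  have key : ∀ f, IsBigOEps D (seriesBracket D H (Function.update F f₀ H f)) (N + 1) := by
    intro f
    rcases eq_or_ne f f₀ with rfl | h
    · rw [Function.update_self, seriesBracket_self]
      exact fun _ _ => rfl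
    · rw [Function.update_of_ne h]
      exact hF3 f
  have hgr : ∀ f, IsGraded D (Function.update F f₀ H f) := by
    intro f
    rcases eq_or_ne f f₀ with rfl | h
    · rw [Function.update_self]; exact hH
    · rw [Function.update_of_ne h]; exact hF1 f
  refine ⟨Function.update F f₀ H, hgr, fun f => ?_, Function.update_self _ _ _, fun f g =>
    seriesBracket_isBigOEps hD h3 (hgr f) (hgr g) h0 (key f) (key g)⟩
  rcases eq_or_ne f f₀ with rfl | h
  · rw [Function.update_self, h0]
  · rw [Function.update_of_ne h, hF2]

/-! ### Canonical transformations -/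

theorem iterate_seriesBracket_congr (H : HamSeries D) {K K' : HamSeries D} (m s : ℕ)
    (h : ∀ j ≤ s, K j = K' j) :
    ((fun G : HamSeries D => seriesBracket D G K)^[m] H) s =
      ((fun G : HamSeries D => seriesBracket D G K')^[m] H) s := by
  induction m generalizing s with
  | zero => simp only [Function.iterate_zero, id_eq]
  | succ m ih =>
    rw [Function.iterate_succ_apply', Function.iterate_succ_apply', seriesBracket_apply,
      seriesBracket_apply]
    refine Finset.sum_congr rfl fun ij hij => ?_
    have h1 := Finset.HasAntidiagonal.mem_antidiagonal.mp hij
    rw [ih ij.1 fun j hj => h j (by omega), h ij.2 (by omega)]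

theorem isHomF_iterate_seriesBracket {H K : HamSeries D} (hH : IsGraded D H) (hK : IsGraded D K)
    (m s : ℕ) : IsHomF D (((fun G : HamSeries D => seriesBracket D G K)^[m] H) s) (s + m) := by
  induction m generalizing s with
  | zero =>
    rw [Function.iterate_zero, id_eq, add_zero]
    exact hH s
  | succ m ih =>
    rw [Function.iterate_succ_apply', ← add_assoc]
    exact isHomF_seriesBracket (a := m) ih hK s

theorem isGraded_canonicalTransform {H K : HamSeries D} (hH : IsGraded D H)
    (hK : IsGraded D K) : IsGraded D (canonicalTransform D K H) := by
  intro n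
  refine IsHomF.sum _ _ fun m hm => IsHomF.smul ?_ _
  have h1 := isHomF_iterate_seriesBracket hH hK m (n - m)
  rwa [Nat.sub_add_cancel (by have := Finset.mem_range.mp hm; omega)] at h1

theorem canonicalTransform_update_of_le (H K : HamSeries D) {N n : ℕ} (hn : n ≤ N)
    (k : LocalFunctional D) :
    canonicalTransform D (Function.update K N k) H n = canonicalTransform D K H n := by
  simp only [canonicalTransform]
  refine Finset.sum_congr rfl fun m hm => ?_
  have h1 := Finset.mem_range.mp hm
  cases m with
  | zero => simp only [Function.iterate_zero, id_eq]
  | succ m =>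
    rw [iterate_seriesBracket_congr (K' := K) H _ _ fun j hj =>
      Function.update_of_ne (by omega) _ _]

/-- Every bracket carries a factor ε, so m-fold brackets with m ≥ 2 see only K_j with j < N at this
order. The new term enters linearly, through H₀. -/
theorem canonicalTransform_update (H K : HamSeries D) {N : ℕ} (hK : K N = 0)
    (k : LocalFunctional D) :
    canonicalTransform D (Function.update K N k) H (N + 1) =
      canonicalTransform D K H (N + 1) + poissonBracket D (H 0) k := by
  simp only [canonicalTransform]
  rw [Finset.sum_range_succ', Finset.sum_range_succ', Finset.sum_range_succ' _ (N + 1),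
    Finset.sum_range_succ' _ N]
  have h1 : ∀ m ∈ Finset.range N, (((m + 1 + 1) ! : ℝ)⁻¹) •
      ((fun G : HamSeries D => seriesBracket D G (Function.update K N k))^[m + 1 + 1] H)
        (N + 1 - (m + 1 + 1)) = (((m + 1 + 1) ! : ℝ)⁻¹) •
      ((fun G : HamSeries D => seriesBracket D G K)^[m + 1 + 1] H) (N + 1 - (m + 1 + 1)) := by
    intro m hm
    have h2 := Finset.mem_range.mp hm
    rw [iterate_seriesBracket_congr (K' := K) H _ _ fun j hj =>
      Function.update_of_ne (by omega) _ _]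
  rw [Finset.sum_congr rfl h1]
  simp only [zero_add, Function.iterate_one, Nat.add_sub_cancel, Function.iterate_zero, id_eq,
    Nat.factorial_one, Nat.cast_one, inv_one, one_smul]
  rw [seriesBracket_update H K hK]
  abel

/-- Every perturbation of the Hopf Hamiltonian can be transformed to one with residual
densities. -/
theorem exists_canonicalTransform_residual (hD : Function.Surjective D) {f₀ : R}
    (h3 : D (D (D f₀)) = 1) {H : HamSeries D} (hH : IsGraded D H)
    (h0 : H 0 = functionalOf D f₀) (N : ℕ) :
    ∃ K : HamSeries D, IsGraded D K ∧ (∀ j, N ≤ j → K j = 0) ∧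
      ∀ n < N, ∃ e ∈ jetFiltration R (n + 1) 1, (∀ m, coeff m e ≠ 0 → IsResidual m) ∧
        canonicalTransform D K H (n + 1) = functional D e := by
  induction N with
  | zero => exact ⟨0, fun n => isHomF_zero n, fun _ _ => rfl, fun n hn => by omega⟩
  | succ N ih =>
    obtain ⟨K, hK, hK0, hKr⟩ := ih
    obtain ⟨g, hg, hg'⟩ := isGraded_canonicalTransform hH hK (N + 1)
    obtain ⟨k, hk, e, he, hres, h1⟩ := exists_residual_density hD h3 (r := 0)
      (mem_jetFiltration_one hg)
    have hk' : IsHomF D (-functional D k) N :=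
      (isHomF_functional (isHom_of_mem_jetFiltration hk)).neg
    refine ⟨Function.update K N (-functional D k), isGraded_update hK hk', fun j hj => ?_,
      fun n hn => ?_⟩
    · rw [Function.update_of_ne (by omega)]
      exact hK0 j (by omega)
    · rcases Nat.lt_or_ge n N with h | h
      · obtain ⟨e', he', hres', h2⟩ := hKr n h
        exact ⟨e', he', hres', by rw [canonicalTransform_update_of_le H K h, h2]⟩
      · obtain rfl : n = N := by omega
        refine ⟨e, he, hres, ?_⟩
        rw [canonicalTransform_update H K (hK0 n le_rfl), ← hg', h1, h0,
          poissonBracket_neg_right]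
        abel

end

noncomputable section

set_option linter.unusedSimpArgs false

variable {R : Type*} [CommRing R] [Algebra ℝ R] {D : Derivation ℝ R R}

/-! ### Functionals modulo densities with many jet factors -/

variable (D) in
/-- Functionals with a density all of whose monomials have at least `r` jet factors. -/
def tail (r : ℕ) : Submodule ℝ (LocalFunctional D) :=
  (((idealOfVars ℕ R) ^ r).restrictScalars ℝ).map (functional D)

theorem functional_mem_tail {r : ℕ} {h : DiffPoly R} (hh : h ∈ (idealOfVars ℕ R) ^ r) :
    functional D h ∈ tail D r := Submodule.mem_map_of_mem hh

theorem functional_eq_of_totalDeriv {h k : DiffPoly R} (W : DiffPoly R)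
    (hW : h - k = totalDeriv D W) : functional D h = functional D k := by
  rw [← sub_eq_zero, ← map_sub, hW, functional_totalDeriv]

theorem mem_tail_of_eq {r : ℕ} {h k : DiffPoly R} (W i : DiffPoly R)
    (hW : h - k = totalDeriv D W + i) (hi : i ∈ (idealOfVars ℕ R) ^ r) :
    functional D h - functional D k ∈ tail D r := by
  rw [← map_sub, hW, map_add, functional_totalDeriv, zero_add]
  exact functional_mem_tail hi

omit [Algebra ℝ R] in
theorem X_mem_idealOfVars (k : ℕ) : (X k : DiffPoly R) ∈ idealOfVars ℕ R :=
  Ideal.subset_span ⟨k, rfl⟩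

omit [Algebra ℝ R] in
theorem mul_prod_mem_4 (g : DiffPoly R) (a b c d : ℕ) :
    g * (X a * X b * X c * X d) ∈ (idealOfVars ℕ R) ^ 4 := by
  refine Ideal.mul_mem_left _ _ ?_
  simp only [pow_succ, pow_zero, one_mul]
  exact Ideal.mul_mem_mul (Ideal.mul_mem_mul (Ideal.mul_mem_mul (X_mem_idealOfVars a)
    (X_mem_idealOfVars b)) (X_mem_idealOfVars c)) (X_mem_idealOfVars d)

omit [Algebra ℝ R] in
theorem mul_prod_mem_5 (g : DiffPoly R) (a b c d e : ℕ) :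
    g * (X a * X b * X c * X d * X e) ∈ (idealOfVars ℕ R) ^ 5 := by
  rw [← mul_assoc, pow_succ]
  exact Ideal.mul_mem_mul (mul_prod_mem_4 g a b c d) (X_mem_idealOfVars e)

theorem totalDeriv_ofNat (n : ℕ) [n.AtLeastTwo] :
    totalDeriv D (ofNat(n) : DiffPoly R) = 0 := totalDeriv_natCast n

theorem ofNat_smul_eq (n : ℕ) [n.AtLeastTwo] (h : DiffPoly R) :
    (ofNat(n) : ℝ) • h = ofNat(n) * h := (natCast_smul_eq n h).symm

/-! ### Explicit variational derivatives and brackets of the normal-form densities -/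

theorem eulerLagrange_eq_sum_of_jetPartial {h : DiffPoly R} (N : ℕ)
    (hN : ∀ j, N ≤ j → jetPartial D j h = 0) :
    eulerLagrange D h = ∑ j ∈ Finset.range N, ((-totalDeriv D) ^ j) (jetPartial D j h) := by
  rw [eulerLagrange_eq_sum D h (max (jetBound h) N) (le_max_left _ _)]
  refine (Finset.sum_subset (Finset.range_mono (le_max_right _ _)) fun j _ hj => ?_).symm
  rw [hN j (by simpa using hj), map_zero]

theorem jetPartial_succ_C_mul_sq (a : R) (k j : ℕ) :
    jetPartial D (j + 1) (C a * X k ^ 2 : DiffPoly R) =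
      if j = k then 2 * (C a * X k) else 0 := by
  rw [pow_two, jetPartial_mul, jetPartial_mul, jetPartial_succ_C, jetPartial_succ_X]
  split_ifs <;> ring

theorem jetPartial_zero_C_mul_sq (a : R) (k : ℕ) :
    jetPartial D 0 (C a * X k ^ 2 : DiffPoly R) = C (D a) * X k ^ 2 := by
  change partialU D (C a * X k ^ 2) = _
  rw [pow_two, partialU_mul, partialU_mul, partialU_X, partialU_C]
  ring

theorem eulerLagrange_ux2 (a : R) :
    eulerLagrange D (C a * X 0 ^ 2) = -(C (D a) * X 0 ^ 2) - 2 * (C a * X 1) := by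
  rw [eulerLagrange_eq_sum_of_jetPartial 2]
  · have h1 : jetPartial D 1 (C a * X 0 ^ 2 : DiffPoly R) = 2 * (C a * X 0) :=
      (jetPartial_succ_C_mul_sq a 0 0).trans (if_pos rfl)
    simp only [Finset.sum_range_succ, Finset.sum_range_zero, jetPartial_zero_C_mul_sq, zero_add,
      h1, pow_zero, Module.End.one_apply, pow_one, LinearMap.neg_apply, totalDeriv_mul,
      totalDeriv_ofNat, totalDeriv_C, totalDeriv_X]
    ring
  · intro j hj
    obtain ⟨i, rfl⟩ := Nat.exists_eq_add_of_le' hj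
    rw [show i + 2 = (i + 1) + 1 by rfl, jetPartial_succ_C_mul_sq, if_neg (by omega)]

theorem eulerLagrange_uxx2 (a : R) :
    eulerLagrange D (C a * X 1 ^ 2) =
      C (D a) * X 1 ^ 2 + totalDeriv D (totalDeriv D (2 * (C a * X 1))) := by
  rw [eulerLagrange_eq_sum_of_jetPartial 3]
  · have h1 : jetPartial D 1 (C a * X 1 ^ 2 : DiffPoly R) = 0 :=
      (jetPartial_succ_C_mul_sq a 1 0).trans (if_neg (by omega))
    have h2 : jetPartial D 2 (C a * X 1 ^ 2 : DiffPoly R) = 2 * (C a * X 1) :=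
      (jetPartial_succ_C_mul_sq a 1 1).trans (if_pos rfl)
    simp only [Finset.sum_range_succ, Finset.sum_range_zero, jetPartial_zero_C_mul_sq, zero_add,
      h1, h2, pow_zero, Module.End.one_apply, map_zero, add_zero]
    rw [pow_two (-totalDeriv D), Module.End.mul_apply, LinearMap.neg_apply, LinearMap.neg_apply,
      map_neg, neg_neg]
  · intro j hj
    obtain ⟨i, rfl⟩ := Nat.exists_eq_add_of_le' hj
    rw [show i + 3 = (i + 2) + 1 by rfl, jetPartial_succ_C_mul_sq, if_neg (by omega)]

/-- In this table of brackets the result is written in reduced monomials, and the witness is the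
explicit density whose total derivative is the discrepancy. Numerical prefactors on the left clear
denominators. -/
theorem bracket_ux2_fun (s f : R) :
    poissonBracket D (functional D (C s * X 0 ^ 2)) (functionalOf D f) = functional D (C
      (D (D (D f)) * s) * (X 0 ^ 3)) := by
  rw [poissonBracket_functionalOf]
  generalize D (D f) = υ
  refine functional_eq_of_totalDeriv (C υ * C s * X 0 ^ 2) ?_
  simp only [map_add, map_sub, map_neg, map_mul, map_ofNat, map_pow, pow_succ, pow_zero, one_mul,
    evol_mul, evol_C, evol_X, totalDeriv_mul, totalDeriv_C, totalDeriv_X, Module.End.mul_apply,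
    Module.End.one_apply, totalDeriv_ofNat, ofNat_smul_eq, map_zero]
  ring

theorem bracket_uxx2_fun (s f : R) :
    (2 : ℝ) • poissonBracket D (functional D (C s * X 1 ^ 2)) (functionalOf D f) = functional D (C
      (10 * D (D (D f)) * s) * (X 0 * X 1 ^ 2) + C (-D (D (D (D f))) * D s - D (D (D (D (D f)))) *
      s) * (X 0 ^ 5)) := by
  rw [poissonBracket_functionalOf]
  generalize D (D f) = υ
  rw [← map_smul]
  refine functional_eq_of_totalDeriv (2 * C υ * C s * X 1 ^ 2 + C (D (D υ)) * C s * X 0 ^ 4) ?_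
  simp only [map_add, map_sub, map_neg, map_mul, map_ofNat, map_pow, pow_succ, pow_zero, one_mul,
    evol_mul, evol_C, evol_X, totalDeriv_mul, totalDeriv_C, totalDeriv_X, Module.End.mul_apply,
    Module.End.one_apply, totalDeriv_ofNat, ofNat_smul_eq, map_zero]
  ring

theorem bracket_ux4_fun (s f : R) :
    poissonBracket D (functional D (C s * X 0 ^ 4)) (functionalOf D f) = functional D (C (3 *
      D (D (D f)) * s) * (X 0 ^ 5)) := by
  rw [poissonBracket_functionalOf]
  generalize D (D f) = υ
  refine functional_eq_of_totalDeriv (C υ * C s * X 0 ^ 4) ?_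
  simp only [map_add, map_sub, map_neg, map_mul, map_ofNat, map_pow, pow_succ, pow_zero, one_mul,
    evol_mul, evol_C, evol_X, totalDeriv_mul, totalDeriv_C, totalDeriv_X, Module.End.mul_apply,
    Module.End.one_apply, totalDeriv_ofNat, ofNat_smul_eq, map_zero]
  ring

theorem bracket_ux2_ux2 (s a : R) :
    (2 : ℝ) • poissonBracket D (functional D (C s * X 0 ^ 2)) (functional D (C a * X 0 ^ 2)) =
      functional D (C (-12 * a * D s + 12 * D a * s) * (X 0 * X 1 ^ 2) + C (a * D (D (D s)) -
      D (D (D a)) * s) * (X 0 ^ 5)) := by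
  rw [poissonBracket_functional, varDeriv_functional, eulerLagrange_ux2]
  rw [← map_smul]
  refine functional_eq_of_totalDeriv (-8 * C a * C s * X 0 * X 2 + 4 * C a * C s * X 1 ^ 2 + 4 *
    C a * C (D s) * X 0 ^ 2 * X 1 - C a * C (D (D s)) * X 0 ^ 4 - 16 * C (D a) * C s * X 0 ^ 2 *
    X 1 + C (D a) * C (D s) * X 0 ^ 4 - 3 * C (D (D a)) * C s * X 0 ^ 4) ?_
  simp only [map_add, map_sub, map_neg, map_mul, map_ofNat, map_pow, pow_succ, pow_zero, one_mul,
    evol_mul, evol_C, evol_X, totalDeriv_mul, totalDeriv_C, totalDeriv_X, Module.End.mul_apply,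
    Module.End.one_apply, totalDeriv_ofNat, ofNat_smul_eq, map_zero]
  ring

/-- In degree 7 terms with five factors may be dropped: dividing by H₀ costs one factor, and at
order 8 only terms with at most three factors matter. The second witness collects the dropped terms.
-/
theorem bracket_uxx2_ux2 (s a : R) :
    (3 : ℝ) • poissonBracket D (functional D (C s * X 1 ^ 2)) (functional D (C a * X 0 ^ 2)) -
      functional D (C (18 * a * D (D s) - 14 * D a * D s - 50 * D (D a) * s) * (X 0 * X 1 ^ 3) + C
      (-18 * a * D s + 30 * D a * s) * (X 0 * X 2 ^ 2)) ∈ tail D 5 := by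
  rw [poissonBracket_functional, varDeriv_functional, eulerLagrange_ux2]
  rw [← map_smul]
  refine mem_tail_of_eq (-12 * C a * C s * X 1 * X 3 + 6 * C a * C s * X 2 ^ 2 + 12 * C a *
    C (D s) * X 0 * X 1 * X 2 - 6 * C a * C (D s) * X 1 ^ 3 - 6 * C a * C (D (D s)) * X 0 ^ 2 *
    X 1 ^ 2 - 36 * C (D a) * C s * X 0 * X 1 * X 2 - 16 * C (D a) * C s * X 1 ^ 3 + 12 * C (D a) *
    C (D s) * X 0 ^ 2 * X 1 ^ 2 - 21 * C (D (D a)) * C s * X 0 ^ 2 * X 1 ^ 2) ((-6 *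
    C (D (D (D (D a)))) * C s * X 1) * (X 0 * X 0 * X 0 * X 0 * X 0) + (6 * C a * C (D (D (D s)))
    - 6 * C (D a) * C (D (D s)) + 6 * C (D (D a)) * C (D s) - 45 * C (D (D (D a))) * C s) * (X 0 *
    X 0 * X 0 * X 1 * X 1)) ?_ ?_
  · simp only [map_add, map_sub, map_neg, map_mul, map_ofNat, map_pow, pow_succ, pow_zero, one_mul,
      evol_mul, evol_C, evol_X, totalDeriv_mul, totalDeriv_C, totalDeriv_X, Module.End.mul_apply,
      Module.End.one_apply, totalDeriv_ofNat, ofNat_smul_eq, map_zero]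
    ring
  · exact add_mem (mul_prod_mem_5 _ _ _ _ _ _) (mul_prod_mem_5 _ _ _ _ _ _)

theorem bracket_ux4_ux2 (s a : R) :
    poissonBracket D (functional D (C s * X 0 ^ 4)) (functional D (C a * X 0 ^ 2)) - functional D
      (C (-24 * a * s) * (X 0 * X 1 ^ 3)) ∈ tail D 5 := by
  rw [poissonBracket_functional, varDeriv_functional, eulerLagrange_ux2]
  refine mem_tail_of_eq (12 * C a * C s * X 0 ^ 2 * X 1 ^ 2 - 8 * C a * C s * X 0 ^ 3 * X 2) ((-4
    * C (D a) * C (D s) * X 1 - 28 * C (D (D a)) * C s * X 1 - C (D (D a)) * C (D s) * X 0 ^ 2 - 4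
    * C (D (D (D a))) * C s * X 0 ^ 2) * (X 0 * X 0 * X 0 * X 0 * X 0) + (6 * C a * C (D s) - 16 *
    C (D a) * C s) * (X 0 * X 0 * X 0 * X 0 * X 2) + (-12 * C a * C (D s) - 28 * C (D a) * C s) *
    (X 0 * X 0 * X 0 * X 1 * X 1)) ?_ ?_
  · simp only [map_add, map_sub, map_neg, map_mul, map_ofNat, map_pow, pow_succ, pow_zero, one_mul,
      evol_mul, evol_C, evol_X, totalDeriv_mul, totalDeriv_C, totalDeriv_X, Module.End.mul_apply,
      Module.End.one_apply, totalDeriv_ofNat, ofNat_smul_eq, map_zero]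
    ring
  · exact add_mem (add_mem (mul_prod_mem_5 _ _ _ _ _ _) (mul_prod_mem_5 _ _ _ _ _ _))
      (mul_prod_mem_5 _ _ _ _ _ _)

theorem bracket_uxxx2_fun (s f : R) :
    poissonBracket D (functional D (C s * X 2 ^ 2)) (functionalOf D f) - functional D (C (-2 *
      D (D (D f)) * D s - 14 * D (D (D (D f))) * s) * (X 0 * X 1 ^ 3) + C (7 * D (D (D f)) * s) *
      (X 0 * X 2 ^ 2)) ∈ tail D 5 := by
  rw [poissonBracket_functionalOf]
  generalize D (D f) = υ
  refine mem_tail_of_eq (C υ * C s * X 2 ^ 2 + 2 * C (D υ) * C s * X 1 ^ 3 + 6 * C (D (D υ)) * C s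
    * X 0 ^ 2 * X 1 ^ 2) ((2 * C (D (D (D υ))) * C s) * (X 0 * X 0 * X 0 * X 0 * X 2) + (-6 *
    C (D (D υ)) * C (D s) - 6 * C (D (D (D υ))) * C s) * (X 0 * X 0 * X 0 * X 1 * X 1)) ?_ ?_
  · simp only [map_add, map_sub, map_neg, map_mul, map_ofNat, map_pow, pow_succ, pow_zero, one_mul,
      evol_mul, evol_C, evol_X, totalDeriv_mul, totalDeriv_C, totalDeriv_X, Module.End.mul_apply,
      Module.End.one_apply, totalDeriv_ofNat, ofNat_smul_eq, map_zero]
    ring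
  · exact add_mem (mul_prod_mem_5 _ _ _ _ _ _) (mul_prod_mem_5 _ _ _ _ _ _)

theorem bracket_uxx3_fun (s f : R) :
    poissonBracket D (functional D (C s * X 1 ^ 3)) (functionalOf D f) - functional D (C (8 *
      D (D (D f)) * s) * (X 0 * X 1 ^ 3)) ∈ tail D 5 := by
  rw [poissonBracket_functionalOf]
  generalize D (D f) = υ
  refine mem_tail_of_eq (C υ * C s * X 1 ^ 3) ((3 * C (D (D υ)) * C s) * (X 0 * X 0 * X 0 * X 1 *
    X 1)) ?_ ?_
  · simp only [map_add, map_sub, map_neg, map_mul, map_ofNat, map_pow, pow_succ, pow_zero, one_mul,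
      evol_mul, evol_C, evol_X, totalDeriv_mul, totalDeriv_C, totalDeriv_X, Module.End.mul_apply,
      Module.End.one_apply, totalDeriv_ofNat, ofNat_smul_eq, map_zero]
    ring
  · exact mul_prod_mem_5 _ _ _ _ _ _

theorem bracket_uxxx2_ux2 (s a : R) :
    poissonBracket D (functional D (C s * X 2 ^ 2)) (functional D (C a * X 0 ^ 2)) - functional D
      (C (-6 * a * D s + 14 * D a * s) * (X 0 * X 3 ^ 2) + C (-14 * D a * s) * (X 2 ^ 3)) ∈ tail D
      4 := by
  rw [poissonBracket_functional, varDeriv_functional, eulerLagrange_ux2]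
  refine mem_tail_of_eq (-4 * C a * C s * X 2 * X 4 + 2 * C a * C s * X 3 ^ 2 + 4 * C a * C (D s)
    * X 0 * X 2 * X 3 - 2 * C a * C (D s) * X 1 * X 2 ^ 2 - 16 * C (D a) * C s * X 0 * X 2 * X 3 -
    14 * C (D a) * C s * X 1 * X 2 ^ 2) ((-32 * C (D (D (D (D a)))) * C s * X 1 * X 2 - 2 *
    C (D (D (D (D (D a))))) * C s * X 0 ^ 2 * X 2) * (X 0 * X 0 * X 0 * X 0) + (-C (D (D a)) *
    C (D s) * X 2 - 48 * C (D (D (D a))) * C s * X 2) * (X 0 * X 0 * X 0 * X 2) + (-102 *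
    C (D (D (D a))) * C s * X 2) * (X 0 * X 0 * X 1 * X 1) + (-4 * C a * C (D (D s)) + 12 *
    C (D a) * C (D s) - 26 * C (D (D a)) * C s) * (X 0 * X 0 * X 2 * X 3) + (2 * C a * C (D (D s))
    + 12 * C (D a) * C (D s) - 138 * C (D (D a)) * C s) * (X 0 * X 1 * X 2 * X 2) + (-36 *
    C (D (D a)) * C s) * (X 1 * X 1 * X 1 * X 2)) ?_ ?_
  · simp only [map_add, map_sub, map_neg, map_mul, map_ofNat, map_pow, pow_succ, pow_zero, one_mul,
      evol_mul, evol_C, evol_X, totalDeriv_mul, totalDeriv_C, totalDeriv_X, Module.End.mul_apply,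
      Module.End.one_apply, totalDeriv_ofNat, ofNat_smul_eq, map_zero]
    ring
  · exact add_mem (add_mem (add_mem (add_mem (add_mem (mul_prod_mem_4 _ _ _ _ _) (mul_prod_mem_4 _
      _ _ _ _)) (mul_prod_mem_4 _ _ _ _ _)) (mul_prod_mem_4 _ _ _ _ _)) (mul_prod_mem_4 _ _ _ _
      _)) (mul_prod_mem_4 _ _ _ _ _)

theorem bracket_uxx3_ux2 (s a : R) :
    poissonBracket D (functional D (C s * X 1 ^ 3)) (functional D (C a * X 0 ^ 2)) - functional D
      (C (-6 * a * s) * (X 2 ^ 3)) ∈ tail D 4 := by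
  rw [poissonBracket_functional, varDeriv_functional, eulerLagrange_ux2]
  refine mem_tail_of_eq (6 * C a * C s * X 1 * X 2 ^ 2 - 6 * C a * C s * X 1 ^ 2 * X 3) ((-3 *
    C (D (D (D (D a)))) * C s * X 0 * X 1 ^ 2) * (X 0 * X 0 * X 0 * X 0) + (-C (D (D a)) * C (D s)
    * X 1 ^ 2 - 33 * C (D (D (D a))) * C s * X 1 ^ 2) * (X 0 * X 0 * X 0 * X 1) + (-39 *
    C (D (D a)) * C s * X 2) * (X 0 * X 0 * X 1 * X 1) + (-4 * C (D a) * C (D s) * X 1 - 54 *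
    C (D (D a)) * C s * X 1) * (X 0 * X 1 * X 1 * X 1) + (6 * C a * C (D s) - 18 * C (D a) * C s)
    * (X 0 * X 1 * X 1 * X 3) + (-6 * C a * C (D s) - 6 * C (D a) * C s) * (X 0 * X 1 * X 2 * X 2)
    + (-2 * C a * C (D s) - 42 * C (D a) * C s) * (X 1 * X 1 * X 1 * X 2)) ?_ ?_
  · simp only [map_add, map_sub, map_neg, map_mul, map_ofNat, map_pow, pow_succ, pow_zero, one_mul,
      evol_mul, evol_C, evol_X, totalDeriv_mul, totalDeriv_C, totalDeriv_X, Module.End.mul_apply,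
      Module.End.one_apply, totalDeriv_ofNat, ofNat_smul_eq, map_zero]
    ring
  · exact add_mem (add_mem (add_mem (add_mem (add_mem (add_mem (mul_prod_mem_4 _ _ _ _ _)
      (mul_prod_mem_4 _ _ _ _ _)) (mul_prod_mem_4 _ _ _ _ _)) (mul_prod_mem_4 _ _ _ _ _))
      (mul_prod_mem_4 _ _ _ _ _)) (mul_prod_mem_4 _ _ _ _ _)) (mul_prod_mem_4 _ _ _ _ _)

set_option maxHeartbeats 1000000 in
theorem bracket_uxx2_uxx2 (s a : R) :
    poissonBracket D (functional D (C s * X 1 ^ 2)) (functional D (C a * X 1 ^ 2)) - functional D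
      (C (-10 * a * D s + 10 * D a * s) * (X 0 * X 3 ^ 2) + C (10 * a * D s - 10 * D a * s) *
      (X 2 ^ 3)) ∈ tail D 4 := by
  rw [poissonBracket_functional, varDeriv_functional, eulerLagrange_uxx2]
  refine mem_tail_of_eq (4 * C a * C s * X 1 * X 5 - 4 * C a * C s * X 2 * X 4 + 2 * C a * C s *
    X 3 ^ 2 - 4 * C a * C (D s) * X 0 * X 1 * X 4 + 8 * C a * C (D s) * X 0 * X 2 * X 3 - 10 * C a
    * C (D s) * X 1 * X 2 ^ 2 + 6 * C a * C (D s) * X 1 ^ 2 * X 3 + 16 * C (D a) * C s * X 0 * X 1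
    * X 4 - 12 * C (D a) * C s * X 0 * X 2 * X 3 + 10 * C (D a) * C s * X 1 * X 2 ^ 2 + 32 *
    C (D a) * C s * X 1 ^ 2 * X 3) ((20 * C (D (D (D (D a)))) * C s * X 1 * X 2 + 4 *
    C (D (D (D (D (D a))))) * C s * X 0 * X 1 ^ 2) * (X 0 * X 0 * X 0 * X 0) + (40 *
    C (D (D (D a))) * C s * X 3 + 2 * C (D (D (D a))) * C (D s) * X 1 ^ 2 + 42 *
    C (D (D (D (D a)))) * C s * X 1 ^ 2) * (X 0 * X 0 * X 0 * X 1) + (6 * C (D (D a)) * C (D s) *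
    X 2 + 172 * C (D (D (D a))) * C s * X 2) * (X 0 * X 0 * X 1 * X 1) + (4 * C a * C (D (D s)) -
    12 * C (D a) * C (D s) + 24 * C (D (D a)) * C s) * (X 0 * X 0 * X 1 * X 4) + (-8 * C a *
    C (D (D s)) + 4 * C (D a) * C (D s) + 12 * C (D (D a)) * C s) * (X 0 * X 0 * X 2 * X 3) + (7 *
    C (D (D a)) * C (D s) * X 1 + 66 * C (D (D (D a))) * C s * X 1) * (X 0 * X 1 * X 1 * X 1) +
    (-6 * C a * C (D (D s)) - 32 * C (D a) * C (D s) + 120 * C (D (D a)) * C s) * (X 0 * X 1 * X 1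
    * X 3) + (10 * C a * C (D (D s)) + 82 * C (D (D a)) * C s) * (X 0 * X 1 * X 2 * X 2) + (10 *
    C (D a) * C (D s) + 114 * C (D (D a)) * C s) * (X 1 * X 1 * X 1 * X 2)) ?_ ?_
  · simp only [map_add, map_sub, map_neg, map_mul, map_ofNat, map_pow, pow_succ, pow_zero, one_mul,
      evol_mul, evol_C, evol_X, totalDeriv_mul, totalDeriv_C, totalDeriv_X, Module.End.mul_apply,
      Module.End.one_apply, totalDeriv_ofNat, ofNat_smul_eq, map_zero]
    ring
  · exact add_mem (add_mem (add_mem (add_mem (add_mem (add_mem (add_mem (add_mem (mul_prod_mem_4 _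
      _ _ _ _) (mul_prod_mem_4 _ _ _ _ _)) (mul_prod_mem_4 _ _ _ _ _)) (mul_prod_mem_4 _ _ _ _ _))
      (mul_prod_mem_4 _ _ _ _ _)) (mul_prod_mem_4 _ _ _ _ _)) (mul_prod_mem_4 _ _ _ _ _))
      (mul_prod_mem_4 _ _ _ _ _)) (mul_prod_mem_4 _ _ _ _ _)

/-- The ratio 9 : -10 fixes the cubic part of the image in degree 9, hence the obstructing
combination 10 g₁ + 9 g₂. -/
theorem bracket_uxxxx2_fun (s f : R) :
    poissonBracket D (functional D (C s * X 3 ^ 2)) (functionalOf D f) - functional D (C (9 *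
      D (D (D f)) * s) * (X 0 * X 3 ^ 2) + C (-10 * D (D (D f)) * s) * (X 2 ^ 3)) ∈ tail D 4 := by
  rw [poissonBracket_functionalOf]
  generalize D (D f) = υ
  refine mem_tail_of_eq (C υ * C s * X 3 ^ 2 + 10 * C (D υ) * C s * X 1 * X 2 ^ 2) ((2 *
    C (D (D (D (D υ)))) * C s * X 0 * X 3) * (X 0 * X 0 * X 0 * X 0) + (20 * C (D (D (D υ))) * C s
    * X 3) * (X 0 * X 0 * X 0 * X 1) + (20 * C (D (D υ)) * C s) * (X 0 * X 0 * X 2 * X 3) + (30 *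
    C (D (D υ)) * C s) * (X 0 * X 1 * X 1 * X 3) + (-10 * C (D υ) * C (D s) - 10 * C (D (D υ)) *
    C s) * (X 0 * X 1 * X 2 * X 2)) ?_ ?_
  · simp only [map_add, map_sub, map_neg, map_mul, map_ofNat, map_pow, pow_succ, pow_zero, one_mul,
      evol_mul, evol_C, evol_X, totalDeriv_mul, totalDeriv_C, totalDeriv_X, Module.End.mul_apply,
      Module.End.one_apply, totalDeriv_ofNat, ofNat_smul_eq, map_zero]
    ring
  · exact add_mem (add_mem (add_mem (add_mem (mul_prod_mem_4 _ _ _ _ _) (mul_prod_mem_4 _ _ _ _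
      _)) (mul_prod_mem_4 _ _ _ _ _)) (mul_prod_mem_4 _ _ _ _ _)) (mul_prod_mem_4 _ _ _ _ _)

end

noncomputable section

variable {R : Type*} [CommRing R] [Algebra ℝ R] {D : Derivation ℝ R R}

/-! ### Brackets and the filtration by the number of jet factors -/

theorem partialU_mem_pow {r : ℕ} {h : DiffPoly R} (hh : h ∈ (idealOfVars ℕ R) ^ r) :
    partialU D h ∈ (idealOfVars ℕ R) ^ r := by
  rw [mem_pow_idealOfVars_iff'] at hh ⊢
  intro m hm
  rw [coeff_partialU, hh m hm, map_zero]

omit [Algebra ℝ R] in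
/-- A derivation that takes every jet variable to the power `a + 1` of the ideal of the jet
variables raises the number of jet factors by `a`. -/
theorem derivation_mem_pow {d : Derivation R (DiffPoly R) (DiffPoly R)} {a : ℕ}
    (hd : ∀ k, d (X k) ∈ (idealOfVars ℕ R) ^ (a + 1)) {r : ℕ} {h : DiffPoly R}
    (hh : h ∈ (idealOfVars ℕ R) ^ r) : d h ∈ (idealOfVars ℕ R) ^ (r + a) := by
  have h1 : ∀ p : DiffPoly R, d p ∈ (idealOfVars ℕ R) ^ (a + 1) := fun p => by
    induction p using MvPolynomial.induction_on with
    | C b => rw [derivation_C]; exact zero_mem _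
    | add p q hp hq => rw [map_add]; exact add_mem hp hq
    | mul_X p k hp =>
      rw [Derivation.leibniz, smul_eq_mul, smul_eq_mul]
      exact add_mem (Ideal.mul_mem_left _ _ (hd k)) (Ideal.mul_mem_left _ _ hp)
  induction r generalizing h with
  | zero => exact Ideal.pow_le_pow_right (by omega) (h1 h)
  | succ r ih =>
    rw [pow_succ] at hh
    refine Submodule.mul_induction_on hh (fun x hx y hy => ?_) fun x y hx hy => ?_
    · rw [Derivation.leibniz, smul_eq_mul, smul_eq_mul]
      refine add_mem ?_ ?_
      · rw [show r + 1 + a = r + (a + 1) by ring, pow_add]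
        exact Ideal.mul_mem_mul hx (h1 y)
      · rw [show r + 1 + a = (r + a) + 1 by ring, pow_succ']
        exact Ideal.mul_mem_mul hy (ih hx)
    · rw [map_add]; exact add_mem hx hy

theorem totalDeriv_mem_pow {r : ℕ} {h : DiffPoly R} (hh : h ∈ (idealOfVars ℕ R) ^ r) :
    totalDeriv D h ∈ (idealOfVars ℕ R) ^ r := by
  rw [totalDeriv_apply]
  refine add_mem (Ideal.mul_mem_left _ _ (partialU_mem_pow hh)) ?_
  refine derivation_mem_pow (a := 0) (fun k => ?_) hh
  rw [jetShift, mkDerivation_X, zero_add, pow_one]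
  exact X_mem_idealOfVars _

theorem totalDeriv_mem_idealOfVars (h : DiffPoly R) : totalDeriv D h ∈ idealOfVars ℕ R := by
  rw [totalDeriv_apply]
  refine add_mem (Ideal.mul_mem_right _ _ (X_mem_idealOfVars 0)) ?_
  have h1 : (jetShift : Derivation R (DiffPoly R) (DiffPoly R)) h ∈ (idealOfVars ℕ R) ^ 1 := by
    induction h using MvPolynomial.induction_on with
    | C b => rw [derivation_C]; exact zero_mem _
    | add p q hp hq => rw [map_add]; exact add_mem hp hq
    | mul_X p k hp =>
      rw [Derivation.leibniz, smul_eq_mul, smul_eq_mul, jetShift, mkDerivation_X, pow_one]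
      rw [jetShift, pow_one] at hp
      exact add_mem (Ideal.mul_mem_left _ _ (X_mem_idealOfVars _)) (Ideal.mul_mem_left _ _ hp)
  rwa [pow_one] at h1

/-- The characteristic is a total derivative, so each jet factor is replaced by an element of the
ideal of jet variables and no factor is lost. -/
theorem poissonBracket_mem_tail {r : ℕ} {G : LocalFunctional D} (hG : G ∈ tail D r)
    (F : LocalFunctional D) : poissonBracket D G F ∈ tail D r := by
  obtain ⟨h, hh, rfl⟩ := hG
  rw [poissonBracket_functional, evol_apply]
  refine functional_mem_tail (add_mem (Ideal.mul_mem_left _ _ (partialU_mem_pow hh)) ?_)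
  refine derivation_mem_pow (a := 0) (fun k => ?_) hh
  rw [mkDerivation_X, zero_add, pow_one]
  rw [pow_succ', Module.End.mul_apply]
  exact totalDeriv_mem_idealOfVars _

theorem totalDeriv_pow_sub_mem (v : R) (n : ℕ) :
    (totalDeriv D ^ n) (X 0 * C v) - C v * X n ∈ (idealOfVars ℕ R) ^ 2 := by
  induction n with
  | zero => rw [pow_zero, Module.End.one_apply, mul_comm, sub_self]; exact zero_mem _
  | succ n ih =>
    have h1 := totalDeriv_mem_pow (D := D) ih
    rw [map_sub, totalDeriv_mul, totalDeriv_C, totalDeriv_X] at h1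
    have h2 : (C (D v) * (X n * X 0) : DiffPoly R) ∈ (idealOfVars ℕ R) ^ 2 := by
      rw [pow_two]
      exact Ideal.mul_mem_left _ _
        (Ideal.mul_mem_mul (X_mem_idealOfVars _) (X_mem_idealOfVars _))
    rw [totalDeriv_pow_succ]
    convert add_mem h1 h2 using 1
    ring

/-- The part of the field linear in jets is f'' ∂ₓh, which integrates by parts to -f''' u_x h; the
remainder replaces a variable by a product of two. Either way one factor is gained. -/
theorem poissonBracket_functionalOf_mem_tail {r : ℕ} {G : LocalFunctional D} (hG : G ∈ tail D r)
    (f : R) : poissonBracket D G (functionalOf D f) ∈ tail D (r + 1) := by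
  obtain ⟨h, hh, rfl⟩ := hG
  rw [poissonBracket_functionalOf, evol_apply]
  set t : ℕ → DiffPoly R := fun k =>
    (totalDeriv D ^ (k + 1)) (X 0 * C (D (D f))) - C (D (D f)) * X (k + 1)
  have h2 : mkDerivation R (fun k => (totalDeriv D ^ (k + 1)) (X 0 * C (D (D f)))) =
      (C (D (D f)) : DiffPoly R) • jetShift + mkDerivation R t := by
    refine derivation_ext fun i => ?_
    rw [mkDerivation_X, Derivation.add_apply, Derivation.smul_apply, jetShift, mkDerivation_X,
      mkDerivation_X, smul_eq_mul]
    simp only [t]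
    ring
  have h3 : X 0 * C (D (D f)) * partialU D h +
      mkDerivation R (fun k => (totalDeriv D ^ (k + 1)) (X 0 * C (D (D f)))) h =
      C (D (D f)) * totalDeriv D h + mkDerivation R t h := by
    rw [h2, totalDeriv_apply, Derivation.add_apply, Derivation.smul_apply, smul_eq_mul]
    ring
  rw [h3, map_add, functional_mul_totalDeriv, totalDeriv_C, ← map_neg]
  refine add_mem (functional_mem_tail ?_) (functional_mem_tail ?_)
  · have h4 : X 0 * C (D (D (D f))) * h ∈ (idealOfVars ℕ R) ^ (r + 1) := by
      rw [mul_right_comm, pow_succ']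
      exact Ideal.mul_mem_right _ _ (Ideal.mul_mem_mul (X_mem_idealOfVars 0) hh)
    exact neg_mem h4
  · refine derivation_mem_pow (a := 1) (fun k => ?_) hh
    rw [mkDerivation_X]
    exact totalDeriv_pow_sub_mem _ _

/-- A homogeneous functional in `tail D r` has a homogeneous density with at least `r` jet
factors. -/
theorem exists_density_of_mem_tail {d r : ℕ} {G : LocalFunctional D} (hG : IsHomF D G (d + 1))
    (ht : G ∈ tail D r) : ∃ k ∈ jetFiltration R (d + 1) r, functional D k = G := by
  classical
  obtain ⟨g, hg, rfl⟩ := hG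
  obtain ⟨i, hi, h1⟩ := ht
  obtain ⟨W, hW⟩ := functional_eq_zero_iff.mp
    (show functional D (g - i) = 0 by rw [map_sub, h1, sub_self])
  -- Homogeneous components commute with ∂ₓ up to a degree shift, so the component of the tail
  -- density still represents the functional.
  refine ⟨weightedHomogeneousComponent jetWeight (d + 1) i, fun m hm => ?_, ?_⟩
  · rw [coeff_weightedHomogeneousComponent] at hm
    obtain ⟨h2, h3⟩ := ite_ne_right_iff.mp hm
    refine ⟨h2, ?_⟩
    by_contra h4
    exact h3 ((mem_pow_idealOfVars_iff' r i).mp hi m (by omega))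
  · have h2 := component_totalDeriv (D := D) W d
    rw [hW, map_sub, weightedHomogeneousComponent_of_mem hg, if_pos rfl] at h2
    rw [← sub_eq_zero, ← map_sub, ← neg_sub, h2, map_neg, functional_totalDeriv, neg_zero]

theorem mem_tail_of_mem_jetFiltration {d r : ℕ} {k : DiffPoly R} (hk : k ∈ jetFiltration R d r) :
    functional D k ∈ tail D r := by
  refine functional_mem_tail ((mem_pow_idealOfVars_iff' r k).mpr fun m hm => ?_)
  by_contra h
  have := (hk m h).2
  omega

end

noncomputable section

variable {R : Type*} [CommRing R] [Algebra ℝ R] {D : Derivation ℝ R R}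

/-! ### The homological equation modulo densities with many jet factors -/

theorem poissonBracket_sub_left (H H' F : LocalFunctional D) :
    poissonBracket D (H - H') F = poissonBracket D H F - poissonBracket D H' F := by
  rw [poissonBracket_antisymm, poissonBracket_sub_right, poissonBracket_antisymm F,
    poissonBracket_antisymm F H']
  abel

theorem eq_of_poissonBracket_hopf (hD : Function.Surjective D) {f₀ : R}
    (h3 : D (D (D f₀)) = 1) {d : ℕ} (hd : d ≠ 0) {G G' : LocalFunctional D}
    (hG : IsHomF D G d) (hG' : IsHomF D G' d)
    (h : poissonBracket D G (functionalOf D f₀) = poissonBracket D G' (functionalOf D f₀)) :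
    G = G' := by
  rw [← sub_eq_zero]
  refine eq_zero_of_poissonBracket_hopf hD h3 hd (hG.sub hG') ?_
  rw [poissonBracket_antisymm, poissonBracket_sub_left, h, sub_self, neg_zero]

theorem exists_potential_mem_tail (hD : Function.Surjective D) {f₀ : R}
    (h3 : D (D (D f₀)) = 1) {d r : ℕ} (hdr : d = 6 ∨ d = 8 ∧ r = 3)
    {G : LocalFunctional D} (hG : IsHomF D G (d + 1)) (ht : G ∈ tail D (r + 1)) :
    ∃ K ∈ tail D r, IsHomF D K d ∧ poissonBracket D K (functionalOf D f₀) = G := by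
  obtain ⟨g, hg, rfl⟩ := exists_density_of_mem_tail hG ht
  obtain ⟨k, hk, h1⟩ := exists_poissonBracket_eq hD h3 (by omega) (neg_mem hg)
  refine ⟨_, mem_tail_of_mem_jetFiltration hk, isHomF_functional (isHom_of_mem_jetFiltration hk),
    ?_⟩
  rw [poissonBracket_antisymm, h1, map_neg, neg_neg]

/-- The bracket has a potential with r factors, and injectivity identifies it with G. -/
theorem mem_tail_of_poissonBracket_hopf (hD : Function.Surjective D) {f₀ : R}
    (h3 : D (D (D f₀)) = 1) {d r : ℕ} (hdr : d = 6 ∨ d = 8 ∧ r = 3)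
    {G : LocalFunctional D} (hG : IsHomF D G d)
    (ht : poissonBracket D G (functionalOf D f₀) ∈ tail D (r + 1)) : G ∈ tail D r := by
  have h1 : IsHomF D (poissonBracket D G (functionalOf D f₀)) (d + 1) :=
    hG.poissonBracket (isHomF_functional (isHom_C f₀))
  obtain ⟨K, hK, hK', h2⟩ := exists_potential_mem_tail hD h3 hdr h1 ht
  rwa [eq_of_poissonBracket_hopf hD h3 (by omega) hG hK' h2.symm]

/-! ### Coefficients -/

theorem derivation_ofNat (n : ℕ) [n.AtLeastTwo] : D (ofNat(n) : R) = 0 := D.map_natCast n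

theorem exists_ofNat_mul_eq (n : ℕ) [n.AtLeastTwo] (a : R) : ∃ x, (ofNat(n) : R) * x = a := by
  refine ⟨(n : ℝ)⁻¹ • a, ?_⟩
  change ((n : ℕ) : R) * _ = a
  rw [← nsmul_eq_mul, ← Nat.cast_smul_eq_nsmul ℝ, smul_smul,
    mul_inv_cancel₀ (Nat.cast_ne_zero.mpr (NeZero.ne n)), one_smul]

theorem ofNat_mul_cancel (n : ℕ) [n.AtLeastTwo] {a b : R}
    (h : (ofNat(n) : R) * a = ofNat(n) * b) : a = b := by
  rw [← sub_eq_zero]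
  refine natCast_mul_eq_zero (NeZero.ne n) ?_
  change (a - b) * (ofNat(n) : R) = 0
  linear_combination h

omit [Algebra ℝ R] in
theorem isHom_C_mul_X_pow (a : R) (k n : ℕ) : IsHom (C a * X k ^ n) (n * (k + 1)) := by
  rw [X_pow_eq_monomial, C_mul_monomial, mul_one]
  exact isWeightedHomogeneous_monomial _ _ _ (by rw [Finsupp.weight_single]; rfl)

/-! ### The terms of low order of a commuting Hamiltonian -/

theorem second_order_eq (hD : Function.Surjective D) {f₀ : R}
    (h3 : D (D (D f₀)) = 1) {F : LocalFunctional D} (hF : IsHomF D F 2) {a f w : R}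
    (hw : D (D (D f)) = w)
    (h : poissonBracket D F (functionalOf D f₀) =
      poissonBracket D (functional D (C a * X 0 ^ 2)) (functionalOf D f)) :
    F = functional D (C (w * a) * X 0 ^ 2) := by
  refine eq_of_poissonBracket_hopf hD h3 two_ne_zero hF
    (isHomF_functional (isHom_C_mul_X_pow _ 0 2)) ?_
  rw [h, bracket_ux2_fun, bracket_ux2_fun, hw, h3, one_mul]

/-- By injectivity it suffices to match brackets with H₀. The equations for x and y compare the
coefficients of u_x u_xx² and u_x⁵. -/
theorem fourth_order_eq (hD : Function.Surjective D) {f₀ : R}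
    (h3 : D (D (D f₀)) = 1) {F : LocalFunctional D} (hF : IsHomF D F 4) {a p f w x y : R}
    (hw : D (D (D f)) = w)
    (hx : 5 * x = 6 * a * a * D w + 5 * w * p)
    (hy : 6 * y = w * a * D (D (D a)) - D (D (D (w * a))) * a - D w * D p - D (D w) * p)
    (h : poissonBracket D F (functionalOf D f₀) =
      poissonBracket D (functional D (C a * X 0 ^ 2)) (functional D (C (w * a) * X 0 ^ 2)) +
      poissonBracket D (functional D (C p * X 1 ^ 2)) (functionalOf D f)) :
    F = functional D (C x * X 1 ^ 2 + C y * X 0 ^ 4) := by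
  refine eq_of_poissonBracket_hopf hD h3 four_ne_zero hF (isHomF_functional
    ((isHom_C_mul_X_pow _ 1 2).add (isHom_C_mul_X_pow _ 0 4))) ?_
  rw [h]
  refine smul_right_injective _ (two_ne_zero (α := ℝ)) ?_
  simp only [map_add, poissonBracket_add_left, smul_add, bracket_ux2_ux2, bracket_uxx2_fun,
    bracket_ux4_fun, h3, hw, D.map_one_eq_zero, map_zero]
  simp only [← map_smul, ← map_add, ofNat_smul_eq]
  refine congrArg (functional D) ?_
  have hx' := congrArg (C : R → DiffPoly R) hx
  have hy' := congrArg (C : R → DiffPoly R) hy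
  simp only [map_add, map_sub, map_mul, map_neg, map_ofNat, Derivation.leibniz, smul_eq_mul,
    map_one, map_zero] at hx' hy' ⊢
  linear_combination (-2 * X 0 * X 1 ^ 2) * hx' - (X 0 ^ 5) * hy'

/-- The equations for s and t compare the coefficients of u_x u_xxx² and u_x u_xx³; the u_x⁵-type
terms are absorbed in the tail. -/
theorem sixth_order_mem (hD : Function.Surjective D) {f₀ : R}
    (h3 : D (D (D f₀)) = 1) {F : LocalFunctional D} (hF : IsHomF D F 6)
    {a p m n f w x y s t : R} (hw : D (D (D f)) = w)
    (hs : 7 * s = 6 * a * D x - 10 * D a * x - 6 * (w * a) * D p + 10 * D (w * a) * p +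
      7 * w * m)
    (ht : 24 * t = 6 * D s - 18 * a * D (D x) + 14 * D a * D x + 50 * D (D a) * x + 72 * a * y +
      18 * (w * a) * D (D p) - 14 * D (w * a) * D p - 50 * D (D (w * a)) * p - 6 * w * D m -
      42 * D w * m + 24 * w * n)
    (h : poissonBracket D F (functionalOf D f₀) =
      poissonBracket D (functional D (C a * X 0 ^ 2))
        (functional D (C x * X 1 ^ 2 + C y * X 0 ^ 4)) +
      poissonBracket D (functional D (C p * X 1 ^ 2)) (functional D (C (w * a) * X 0 ^ 2)) +
      poissonBracket D (functional D (C m * X 2 ^ 2 + C n * X 1 ^ 3)) (functionalOf D f)) :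
    F - functional D (C s * X 2 ^ 2 + C t * X 1 ^ 3) ∈ tail D 4 := by
  refine mem_tail_of_poissonBracket_hopf hD h3 (Or.inl rfl) (hF.sub (isHomF_functional
    ((isHom_C_mul_X_pow _ 2 2).add (isHom_C_mul_X_pow _ 1 3)))) ?_
  have e1 := bracket_uxx2_ux2 (D := D) x a
  have e2 := Submodule.smul_mem _ (3 : ℝ) (bracket_ux4_ux2 (D := D) y a)
  have e3 := bracket_uxx2_ux2 (D := D) p (w * a)
  have e4 := Submodule.smul_mem _ (3 : ℝ) (bracket_uxxx2_fun (D := D) m f)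
  have e5 := Submodule.smul_mem _ (3 : ℝ) (bracket_uxx3_fun (D := D) n f)
  have e6 := Submodule.smul_mem _ (3 : ℝ) (bracket_uxxx2_fun (D := D) s f₀)
  have e7 := Submodule.smul_mem _ (3 : ℝ) (bracket_uxx3_fun (D := D) t f₀)
  have e8 := sub_mem (sub_mem (add_mem (add_mem (sub_mem (sub_mem e3 e1) e2) e4) e5) e6) e7
  rw [poissonBracket_sub_left, h]
  rw [poissonBracket_antisymm (functional D (C a * X 0 ^ 2))]
  simp only [map_add, poissonBracket_add_left]
  have h0 : functional D (C (18 * (w * a) * D (D p) - 14 * D (w * a) * D p -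
        50 * D (D (w * a)) * p) * (X 0 * X 1 ^ 3) +
        C (-18 * (w * a) * D p + 30 * D (w * a) * p) * (X 0 * X 2 ^ 2)) -
      functional D (C (18 * a * D (D x) - 14 * D a * D x - 50 * D (D a) * x) *
        (X 0 * X 1 ^ 3) + C (-18 * a * D x + 30 * D a * x) * (X 0 * X 2 ^ 2)) -
      (3 : ℝ) • functional D (C (-24 * a * y) * (X 0 * X 1 ^ 3)) +
      (3 : ℝ) • functional D (C (-2 * w * D m - 14 * D w * m) * (X 0 * X 1 ^ 3) +
        C (7 * w * m) * (X 0 * X 2 ^ 2)) +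
      (3 : ℝ) • functional D (C (8 * w * n) * (X 0 * X 1 ^ 3)) -
      (3 : ℝ) • functional D (C (-2 * 1 * D s - 14 * 0 * s) * (X 0 * X 1 ^ 3) +
        C (7 * 1 * s) * (X 0 * X 2 ^ 2)) -
      (3 : ℝ) • functional D (C (8 * 1 * t) * (X 0 * X 1 ^ 3)) = 0 := by
    simp only [← map_smul, ← map_add, ← map_sub]
    rw [← map_zero (functional D)]
    congr 1
    have hs' := congrArg (C : R → DiffPoly R) hs
    have ht' := congrArg (C : R → DiffPoly R) ht
    simp only [map_add, map_sub, map_mul, map_neg, map_ofNat, ofNat_smul_eq, map_one,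
      map_zero] at hs' ht' ⊢
    linear_combination (-3 * X 0 * X 2 ^ 2) * hs' - (X 0 * X 1 ^ 3) * ht'
  simp only [hw, h3, D.map_one_eq_zero] at e8
  rw [← Submodule.smul_mem_iff _ (three_ne_zero (α := ℝ))]
  convert e8 using 1
  rw [← sub_eq_zero, ← h0]
  simp only [smul_sub, smul_add, smul_neg]
  abel

end

noncomputable section

variable {R : Type*} [CommRing R] [Algebra ℝ R] {D : Derivation ℝ R R}

/-! ### The obstruction at order eight -/

/-- The y-term and the unknown part of F have four factors already and brackets keep them, so
neither is visible here. -/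
theorem eighth_order_mem {F : LocalFunctional D} {a b p m n x y s t : R}
    (hF : F - functional D (C s * X 2 ^ 2 + C t * X 1 ^ 3) ∈ tail D 4) :
    poissonBracket D (functional D (C a * X 0 ^ 2)) F +
      poissonBracket D (functional D (C p * X 1 ^ 2))
        (functional D (C x * X 1 ^ 2 + C y * X 0 ^ 4)) +
      poissonBracket D (functional D (C m * X 2 ^ 2 + C n * X 1 ^ 3))
        (functional D (C b * X 0 ^ 2)) -
      functional D (C (6 * a * D s - 14 * D a * s - 10 * x * D p + 10 * D x * p -
          6 * b * D m + 14 * D b * m) * (X 0 * X 3 ^ 2) +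
        C (14 * D a * s + 6 * a * t + 10 * x * D p - 10 * D x * p - 14 * D b * m -
          6 * b * n) * X 2 ^ 3) ∈ tail D 4 := by
  have e1 := bracket_uxxx2_ux2 (D := D) s a
  have e2 := bracket_uxx3_ux2 (D := D) t a
  have e3 := bracket_uxx2_uxx2 (D := D) p x
  have e4 := poissonBracket_mem_tail (D := D) (r := 4) (functional_mem_tail (h := C y * X 0 ^ 4)
    (Ideal.mul_mem_left _ _ (Ideal.pow_mem_pow (X_mem_idealOfVars 0) 4)))
    (functional D (C p * X 1 ^ 2))
  have e5 := bracket_uxxx2_ux2 (D := D) m b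
  have e6 := bracket_uxx3_ux2 (D := D) n b
  have e7 := poissonBracket_mem_tail hF (functional D (C a * X 0 ^ 2))
  have e8 := add_mem (add_mem (sub_mem (sub_mem (sub_mem (sub_mem e3 e1) e2) e4) e7) e5) e6
  rw [poissonBracket_sub_left] at e8
  rw [poissonBracket_antisymm (functional D (C a * X 0 ^ 2))]
  simp only [map_add, poissonBracket_add_left, poissonBracket_add_right] at e8 ⊢
  rw [poissonBracket_antisymm (functional D (C p * X 1 ^ 2)) (functional D (C y * X 0 ^ 4))]
  convert e8 using 1
  simp only [map_sub, map_mul, map_add, map_neg, sub_mul, add_mul, neg_mul]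
  abel

/-- Eliminating x, y, s, t also cancels n and every term in w itself or in its higher derivatives.
Only a multiple of w' survives, so one condition, free of β, serves all f. -/
theorem obstruction_identity {a p m n w x y s t : R}
    (hx : 5 * x = 6 * a * a * D w + 5 * w * p)
    (hy : 6 * y = w * a * D (D (D a)) - D (D (D (w * a))) * a - D w * D p - D (D w) * p)
    (hs : 7 * s = 6 * a * D x - 10 * D a * x - 6 * (w * a) * D p + 10 * D (w * a) * p +
      7 * w * m)
    (ht : 24 * t = 6 * D s - 18 * a * D (D x) + 14 * D a * D x + 50 * D (D a) * x + 72 * a * y +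
      18 * (w * a) * D (D p) - 14 * D (w * a) * D p - 50 * D (D (w * a)) * p - 6 * w * D m -
      42 * D w * m + 24 * w * n) :
    2 * (10 * (6 * a * D s - 14 * D a * s - 10 * x * D p + 10 * D x * p -
          6 * (w * a) * D m + 14 * D (w * a) * m) +
        9 * (14 * D a * s + 6 * a * t + 10 * x * D p - 10 * D x * p - 14 * D (w * a) * m -
          6 * (w * a) * n)) =
      D w * (20 * p * p - 67 * a * D a * p + 48 * a * a * D a * D a + 33 * a * a * D p -
        36 * a * a * a * D (D a) - 14 * a * m) := by
  have hx1 := congrArg D hx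
  have hx2 := congrArg D hx1
  have hs1 := congrArg D hs
  simp only [map_add, map_sub, Derivation.leibniz, smul_eq_mul, derivation_ofNat, map_zero]
    at hx1 hx2 hs1 hy hs ht ⊢
  -- Doubling makes the multipliers of the elimination integral.
  refine ofNat_mul_cancel 2 ?_
  linear_combination (18 * a * a) * hx2 + (8 * p - 18 * a * D a) * hx1 +
    (6 * a * D (D a) + 16 * D a * D a - 8 * D p) * hx + 42 * a * hs1 - 8 * D a * hs + 9 * a * ht +
    108 * a * a * hy


/-- The obstruction vanishes only if its leading density does. -/
theorem eq_zero_of_mem_tail (hD : Function.Surjective D) {a b : R}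
    (h : functional D (C a * (X 0 * X 3 ^ 2) + C b * X 2 ^ 3) ∈ tail D 4) : a = 0 ∧ b = 0 := by
  classical
  set m₁ : ℕ →₀ ℕ := Finsupp.single 0 1 + Finsupp.single 3 2 with hm₁
  set m₂ : ℕ →₀ ℕ := Finsupp.single 2 3 with hm₂
  have hne : m₁ ≠ m₂ := fun h => by
    have := DFunLike.congr_fun h 0
    simp [hm₁, hm₂] at this
  have hg : (C a * (X 0 * X 3 ^ 2) + C b * X 2 ^ 3 : DiffPoly R) =
      monomial m₁ a + monomial m₂ b := by
    rw [X_pow_eq_monomial, X_pow_eq_monomial, X, monomial_mul, C_mul_monomial, C_mul_monomial,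
      mul_one, mul_one, mul_one]
  rw [hg] at h
  have w₁ : Finsupp.weight jetWeight m₁ = 9 := by
    simp [hm₁, Finsupp.weight_single, jetWeight]
  have w₂ : Finsupp.weight jetWeight m₂ = 9 := by
    simp [hm₂, Finsupp.weight_single, jetWeight]
  have d₁ : Finsupp.degree m₁ = 3 := by simp [hm₁]
  have d₂ : Finsupp.degree m₂ = 3 := by simp [hm₂]
  have hmem : monomial m₁ a + monomial m₂ b ∈ jetFiltration R 9 0 :=
    add_mem (monomial_mem_jetFiltration w₁ (Nat.zero_le _) a)
      (monomial_mem_jetFiltration w₂ (Nat.zero_le _) b)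
  obtain ⟨k, hk, h1⟩ := exists_density_of_mem_tail (d := 8)
    (isHomF_functional (isHom_of_mem_jetFiltration hmem)) h
  obtain ⟨k', hk', hred, h2⟩ := exists_reduced_density hD hk
  have hk0 : k' ∈ jetFiltration R 9 0 := fun m hm => ⟨(hk' m hm).1, Nat.zero_le _⟩
  have r₁ : IsReduced m₁ := fun j hj => by
    rcases lt_or_ge j 3 with h' | h'
    · have := hj 3 h'
      simp [hm₁] at this
    · rw [hm₁, Finsupp.add_apply, Finsupp.single_apply, Finsupp.single_apply]
      split_ifs <;> omega
  have r₂ : IsReduced m₂ := fun j _ => by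
    rw [hm₂, Finsupp.single_apply]
    split_ifs <;> omega
  -- The cubic density minus its reduced representative with four or more factors is reduced with
  -- zero functional, hence zero. The cubic coefficients come from the first part alone.
  have h3 := eq_zero_of_functional_eq_zero (D := D) (d := 9) (by omega) (sub_mem hmem hk0)
    (fun m hm => ?_) (by rw [map_sub, ← h1, ← h2, sub_self])
  · have c₁ := congrArg (coeff m₁) h3
    have c₂ := congrArg (coeff m₂) h3
    have z : ∀ m, Finsupp.degree m = 3 → coeff m k' = 0 := fun m hm => by
      by_contra h4
      have := (hk' m h4).2
      omega
    rw [coeff_sub, coeff_add, coeff_monomial, coeff_monomial, z _ d₁, if_pos rfl,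
      if_neg hne.symm, coeff_zero] at c₁
    rw [coeff_sub, coeff_add, coeff_monomial, coeff_monomial, z _ d₂, if_pos rfl,
      if_neg hne, coeff_zero] at c₂
    constructor
    · linear_combination c₁
    · linear_combination c₂
  · by_cases h4 : coeff m k' = 0
    · rw [coeff_sub, coeff_add, coeff_monomial, coeff_monomial, h4] at hm
      by_cases h5 : m₁ = m
      · exact h5 ▸ r₁
      · by_cases h6 : m₂ = m
        · exact h6 ▸ r₂
        · simp [h5, h6] at hm
    · exact hred m h4

/-- In degree 8 the only reduced monomial with fewer than three factors is u_xxxx². -/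
theorem exists_leading_eight (hD : Function.Surjective D) {G : LocalFunctional D}
    (hG : IsHomF D G 8) : ∃ q, G - functional D (C q * X 3 ^ 2) ∈ tail D 3 := by
  classical
  obtain ⟨g, hg, rfl⟩ := hG
  obtain ⟨k, hk, hred, h1⟩ := exists_reduced_density hD (isHom_iff_mem_jetFiltration.mp hg)
  refine ⟨coeff (Finsupp.single 3 2) k, ?_⟩
  rw [← h1, ← map_sub, X_pow_eq_monomial, C_mul_monomial, mul_one]
  refine functional_mem_tail ((mem_pow_idealOfVars_iff' 3 _).mpr fun m hm => ?_)
  rw [coeff_sub, coeff_monomial]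
  split_ifs with h2
  · rw [h2, sub_self]
  · rw [sub_zero]
    by_contra h3
    obtain ⟨e1, e2, e3, e4, e5, e6⟩ := (hred m h3).exponents (by rw [(hk m h3).1]; omega)
    have e7 := (hk m h3).1
    refine h2 ?_
    rw [e1, show m 0 = 0 by omega, show m 1 = 0 by omega, show m 2 = 0 by omega,
      show m 3 = 2 by omega]
    simp

theorem bracket_leading_eight {G : LocalFunctional D} {q : R}
    (hG : G - functional D (C q * X 3 ^ 2) ∈ tail D 3) {f w : R} (hw : D (D (D f)) = w) :
    poissonBracket D G (functionalOf D f) -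
      functional D (C (9 * w * q) * (X 0 * X 3 ^ 2) + C (-10 * w * q) * X 2 ^ 3) ∈ tail D 4 := by
  have h1 := poissonBracket_functionalOf_mem_tail hG f
  rw [poissonBracket_sub_left] at h1
  have h2 := add_mem h1 (bracket_uxxxx2_fun (D := D) q f)
  rw [hw] at h2
  convert h2 using 1
  abel

/-! ### The criterion -/

/-- The expression in the coefficients of `∫ a u_x²`, `∫ p u_xx²` and `∫ m u_xxx²` that obstructs
integrability at order eight. -/
def obstruction (D : Derivation ℝ R R) (a p m : R) : R :=
  20 * p * p - 67 * a * D a * p + 48 * a * a * D a * D a + 33 * a * a * D p -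
    36 * a * a * a * D (D a) - 14 * a * m

/-- Hamiltonians whose terms up to order six are in normal form. -/
structure IsNormalized (D : Derivation ℝ R R) (f₀ a p m n : R) (H : HamSeries D) : Prop where
  zero : H 0 = functionalOf D f₀
  one : H 1 = 0
  two : H 2 = functional D (C a * X 0 ^ 2)
  three : H 3 = 0
  four : H 4 = functional D (C p * X 1 ^ 2)
  five : H 5 = 0
  six : H 6 = functional D (C m * X 2 ^ 2 + C n * X 1 ^ 3)

/-- Commutation at orders 2, 4 and 6 fixes F₂, F₄ and, up to four factors, F₆. The order-8 terms not
involving H₈ or F₈ are then known to cubic accuracy. -/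
theorem exists_obstruction (hD : Function.Surjective D) {f₀ : R} (h3 : D (D (D f₀)) = 1)
    {a p m n f w : R} {H F : HamSeries D} (hH : IsNormalized D f₀ a p m n H)
    (hF : IsGraded D F) (hF0 : F 0 = functionalOf D f) (hw : D (D (D f)) = w)
    (hHF : IsBigOEps D (seriesBracket D H F) 7) :
    ∃ g₁ g₂, 2 * (10 * g₁ + 9 * g₂) = D w * obstruction D a p m ∧
      poissonBracket D (H 2) (F 6) + poissonBracket D (H 4) (F 4) +
        poissonBracket D (H 6) (F 2) -
          functional D (C g₁ * (X 0 * X 3 ^ 2) + C g₂ * X 2 ^ 3) ∈ tail D 4 := by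
  have hF1 : F 1 = 0 := eq_zero_of_isHomF_one hD h3 (hF 1)
  have s2 := hHF 2 (by omega)
  have s4 := hHF 4 (by omega)
  have s6 := hHF 6 (by omega)
  simp only [seriesBracket_apply, Finset.Nat.sum_antidiagonal_eq_sum_range_succ_mk,
    Finset.sum_range_succ, Finset.sum_range_zero, hH.zero, hH.one, hH.two, hH.three, hH.four,
    hH.five, hH.six, hF0, hF1, poissonBracket_zero_left, Nat.sub_zero, Nat.reduceSub, zero_add,
    add_zero, poissonBracket_antisymm (functionalOf D f₀), Nat.sub_self] at s2 s4 s6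
  have e2 := second_order_eq hD h3 (hF 2) hw
    (sub_eq_zero.mp (neg_eq_zero.mp (Eq.trans (by abel) s2)))
  obtain ⟨x, hx⟩ := exists_ofNat_mul_eq 5 (6 * a * a * D w + 5 * w * p)
  obtain ⟨y, hy⟩ := exists_ofNat_mul_eq 6
    (w * a * D (D (D a)) - D (D (D (w * a))) * a - D w * D p - D (D w) * p)
  rw [e2] at s4 s6
  have e4 := fourth_order_eq hD h3 (hF 4) hw hx hy
    (sub_eq_zero.mp (neg_eq_zero.mp (Eq.trans (by abel) s4)))
  obtain ⟨s, hs⟩ := exists_ofNat_mul_eq 7 (6 * a * D x - 10 * D a * x - 6 * (w * a) * D p +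
    10 * D (w * a) * p + 7 * w * m)
  obtain ⟨t, ht⟩ := exists_ofNat_mul_eq 24 (6 * D s - 18 * a * D (D x) + 14 * D a * D x +
    50 * D (D a) * x + 72 * a * y + 18 * (w * a) * D (D p) - 14 * D (w * a) * D p -
    50 * D (D (w * a)) * p - 6 * w * D m - 42 * D w * m + 24 * w * n)
  rw [e4] at s6
  have e6 := sixth_order_mem hD h3 (hF 6) hw hs ht
    (sub_eq_zero.mp (neg_eq_zero.mp (Eq.trans (by abel) s6)))
  refine ⟨_, _, obstruction_identity hx hy hs ht, ?_⟩
  rw [hH.two, hH.four, hH.six, e2, e4]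
  exact eighth_order_mem e6

theorem obstruction_eq_zero (hD : Function.Surjective D) {f₀ : R} (h3 : D (D (D f₀)) = 1)
    {a p m n : R} {H : HamSeries D} (hH : IsNormalized D f₀ a p m n H)
    (hint : IsIntegrableOf D f₀ 9 H) : obstruction D a p m = 0 := by
  obtain ⟨F, hF, hF0, hFH, hcomm⟩ := hint
  -- Four antiderivatives of 1 produce f with f'''' = 1, so the factor w' in the obstruction
  -- disappears.
  obtain ⟨w, hw⟩ := hD 1
  obtain ⟨v, hv⟩ := hD w
  obtain ⟨u, hu⟩ := hD v
  obtain ⟨f, hf⟩ := hD u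
  have hf3 : D (D (D f)) = w := by rw [hf, hu, hv]
  have hgr : IsGraded D H := hFH ▸ hF f₀
  have hc : IsBigOEps D (seriesBracket D H (F f)) 10 := hFH ▸ hcomm f₀ f
  obtain ⟨g₁, g₂, hg, hmem⟩ := exists_obstruction hD h3 hH (hF f) (hF0 f) hf3
    fun k hk => hc k (by omega)
  obtain ⟨q, hq⟩ := exists_leading_eight hD (hgr 8)
  obtain ⟨r, hr⟩ := exists_leading_eight hD (hF f 8)
  have hF1 : F f 1 = 0 := eq_zero_of_isHomF_one hD h3 (hF f 1)
  have s8 := hc 8 (by omega)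
  simp only [seriesBracket_apply, Finset.Nat.sum_antidiagonal_eq_sum_range_succ_mk,
    Finset.sum_range_succ, Finset.sum_range_zero, hH.zero, hH.one, hH.three,
    hH.five, hF0, hF1, poissonBracket_zero_left, poissonBracket_zero_right, Nat.sub_zero,
    Nat.reduceSub, zero_add, add_zero, poissonBracket_antisymm (functionalOf D f₀),
    Nat.sub_self] at s8
  -- The leading coefficients q of H₈ and r of F₈ both shift (g₁, g₂) along (9, -10), and the
  -- combination 10 g₁ + 9 g₂ eliminates them.
  have h1 := sub_mem (sub_mem (bracket_leading_eight hr h3) hmem) (bracket_leading_eight hq hf3)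
  have h2 : functional D (C (g₁ + 9 * w * q - 9 * r) * (X 0 * X 3 ^ 2) +
      C (g₂ - 10 * w * q + 10 * r) * X 2 ^ 3) ∈ tail D 4 := by
    convert h1 using 1
    rw [← sub_eq_zero]
    refine Eq.trans ?_ s8
    simp only [map_add, map_sub, map_neg, map_mul, add_mul, sub_mul, neg_mul, mul_one]
    abel
  obtain ⟨z1, z2⟩ := eq_zero_of_mem_tail hD h2
  rw [hw, one_mul] at hg
  linear_combination -hg + 20 * z1 + 18 * z2

theorem isIntegrableOf_nine (hD : Function.Surjective D) {f₀ : R} (h3 : D (D (D f₀)) = 1)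
    {a p m n : R} {H : HamSeries D} (hgr : IsGraded D H) (hH : IsNormalized D f₀ a p m n H)
    (hodd : ∀ k, Odd k → H k = 0) (h8 : H 8 = 0) (hob : obstruction D a p m = 0) :
    IsIntegrableOf D f₀ 9 H := by
  refine isIntegrableOf_of_commuting hD h3 hgr hH.zero fun f => ?_
  obtain ⟨F, hF, hF0, hFodd, hF8, hHF⟩ := exists_commuting_series hD h3 hgr hH.zero hodd f
  obtain ⟨g₁, g₂, hg, hmem⟩ := exists_obstruction hD h3 hH hF hF0 rfl
    fun k hk => hHF k (by omega)
  rw [hob, mul_zero] at hg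
  -- As 10 g₁ + 9 g₂ = 0, the pair (g₁, g₂) equals q (9, -10), the cubic part of {∫ q u_xxxx², H₀}.
  obtain ⟨q, hq⟩ := exists_ofNat_mul_eq 9 g₁
  have hq' : g₂ = -10 * q := ofNat_mul_cancel 9 (ofNat_mul_cancel 2 (by
    linear_combination hg + 20 * hq))
  have hB : seriesBracket D H F 8 = poissonBracket D (H 2) (F 6) + poissonBracket D (H 4) (F 4) +
      poissonBracket D (H 6) (F 2) := by
    simp only [seriesBracket_apply, Finset.Nat.sum_antidiagonal_eq_sum_range_succ_mk,
      Finset.sum_range_succ, Finset.sum_range_zero, hH.one, hH.three, hH.five, hF8, h8,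
      hodd 7 (by decide), poissonBracket_zero_left, poissonBracket_zero_right, Nat.sub_zero,
      Nat.reduceSub, zero_add, add_zero]
  have hQ := isHomF_functional (D := D) (isHom_C_mul_X_pow q 3 2)
  have h1 := sub_mem hmem
    (bracket_leading_eight (D := D) (q := q) (by rw [sub_self]; exact zero_mem _) h3)
  rw [← hB] at h1
  have h2 : seriesBracket D H F 8 -
      poissonBracket D (functional D (C q * X 3 ^ 2)) (functionalOf D f₀) ∈ tail D 4 := by
    convert h1 using 1
    rw [← hq, hq']
    simp only [mul_one]
    abel
  -- What is left in degree 9 has at least four factors, where no residual monomial exists.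
  obtain ⟨K, -, hK, h4⟩ := exists_potential_mem_tail hD h3 (Or.inr ⟨rfl, rfl⟩)
    ((isHomF_seriesBracket (a := 0) hgr hF 8).sub
      (hQ.poissonBracket (isHomF_functional (isHom_C f₀) : IsHomF D (functionalOf D f₀) 0))) h2
  obtain ⟨G, hG, h5⟩ := exists_update_seriesBracket hH.zero hF hF8
    ⟨-(functional D (C q * X 3 ^ 2) + K), (hQ.add hK).neg, by
      rw [poissonBracket_neg_right, ← poissonBracket_antisymm, poissonBracket_add_left, h4]
      exact add_sub_cancel _ _⟩
  refine ⟨_, hG, by rw [Function.update_of_ne (by omega), hF0], fun k hk => ?_⟩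
  rcases lt_or_ge k 8 with h6 | h6
  · rw [seriesBracket_update_of_lt H F h6]
    exact hHF k h6
  · obtain rfl | rfl : k = 8 ∨ k = 9 := by omega
    · exact h5
    · refine seriesBracket_odd hodd (fun j hj => ?_) (by decide)
      rw [Function.update_of_ne (by rintro rfl; exact absurd hj (by decide)), hFodd j hj]

end

noncomputable section

theorem neg_smul_C_mul {R : Type*} [CommRing R] [Algebra ℝ R] (r : ℝ) (c : R) (h : DiffPoly R) :
    -(r • (C c * h)) = C (-(r • c)) * h := by
  rw [map_neg C, neg_mul, ← smul_mul_assoc, C_apply, C_apply, smul_monomial]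

/-! ### Smooth functions -/

variable {J : TopologicalSpace.Opens ℝ}

theorem smoothDeriv_eq_of_hasDerivAt {f g : SmoothFn J} {F : ℝ → ℝ}
    (hf : ∀ u : J, (f : J → ℝ) u = F u)
    (hF : ∀ u : J, HasDerivAt F ((g : J → ℝ) u) u) : smoothDeriv J f = g := by
  ext u
  have h1 : Function.extend Subtype.val (f : J → ℝ) 0 =ᶠ[nhds (u : ℝ)] F := by
    filter_upwards [J.isOpen.mem_nhds u.2] with x hx
    lift x to J using hx
    rw [Subtype.val_injective.extend_apply, hf]
  exact h1.deriv_eq.trans (hF u).deriv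

/-- The restriction to `J` of a function that is smooth on `J`. -/
def smoothRestrict (F : ℝ → ℝ) (hF : ContDiffOn ℝ ∞ F J) : SmoothFn J :=
  ⟨fun u => F u, hF.congr fun x hx => by
    lift x to J using hx
    rw [Subtype.val_injective.extend_apply]⟩

theorem smoothDeriv_surjective (hJ : (J : Set ℝ).OrdConnected) :
    Function.Surjective (smoothDeriv J) := by
  intro g
  rcases isEmpty_or_nonempty J with h | ⟨⟨u₀⟩⟩
  · exact ⟨0, by ext u; exact (h.false u).elim⟩
  set G : ℝ → ℝ := Function.extend Subtype.val (g : J → ℝ) 0 with hG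
  have hcd : ContDiffOn ℝ ∞ G J := g.2
  have hc : ContinuousOn G J := hcd.continuousOn
  -- The segment from u₀ to u stays in J because J is an interval, so the values of the extension by
  -- zero outside J play no role.
  have hderiv : ∀ u ∈ J, HasDerivAt (fun v => ∫ x in (u₀ : ℝ)..v, G x) (G u) u := by
    intro u hu
    refine intervalIntegral.integral_hasDerivAt_right
      ((hc.mono (hJ.uIcc_subset u₀.2 hu)).intervalIntegrable) ?_
      (hc.continuousAt (J.isOpen.mem_nhds hu))
    exact hc.stronglyMeasurableAtFilter J.isOpen u hu
  have hsmooth : ContDiffOn ℝ ∞ (fun v => ∫ x in (u₀ : ℝ)..v, G x) J := by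
    rw [contDiffOn_infty_iff_deriv_of_isOpen J.isOpen]
    exact ⟨fun u hu => (hderiv u hu).differentiableAt.differentiableWithinAt,
      hcd.congr fun u hu => (hderiv u hu).deriv⟩
  refine ⟨smoothRestrict _ hsmooth, smoothDeriv_eq_of_hasDerivAt
    (F := fun v => ∫ x in (u₀ : ℝ)..v, G x) (fun _ => rfl) fun u => ?_⟩
  have h1 := hderiv u u.2
  rwa [hG, Subtype.val_injective.extend_apply] at h1

theorem smoothDeriv_cubicHopf :
    smoothDeriv J (smoothDeriv J (smoothDeriv J (cubicHopf J))) = 1 := by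
  have h1 : smoothDeriv J (cubicHopf J) =
      smoothRestrict (fun x => x ^ 2 / 2) (by fun_prop) :=
    smoothDeriv_eq_of_hasDerivAt (F := fun x => x ^ 3 / 6) (fun _ => rfl) fun u =>
      ((hasDerivAt_pow 3 (u : ℝ)).div_const 6).congr_deriv (by
        change _ = (u : ℝ) ^ 2 / 2
        push_cast
        ring)
  have h2 : smoothDeriv J (smoothRestrict (fun x => x ^ 2 / 2) (by fun_prop)) =
      smoothRestrict (fun x => x) (by fun_prop) :=
    smoothDeriv_eq_of_hasDerivAt (F := fun x => x ^ 2 / 2) (fun _ => rfl) fun u =>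
      ((hasDerivAt_pow 2 (u : ℝ)).div_const 2).congr_deriv (by
        change _ = (u : ℝ)
        push_cast
        ring)
  rw [h1, h2]
  exact smoothDeriv_eq_of_hasDerivAt (F := fun x => x) (fun _ => rfl) fun u => hasDerivAt_id' _

/-! ### The normal form -/

theorem isNormalized_of_eq {c p α β : SmoothFn J} {H : HamSeries (smoothDeriv J)}
    (h : ∀ n ≤ 6, H n = normalForm c p α β n) :
    IsNormalized (smoothDeriv J) (cubicHopf J) (-((1 / 2 : ℝ) • c)) p (-α) (-β) H where
  zero := h 0 (by omega)
  one := h 1 (by omega)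
  two := (h 2 (by omega)).trans (congrArg _ (neg_smul_C_mul _ c _))
  three := h 3 (by omega)
  four := h 4 (by omega)
  five := h 5 (by omega)
  six := (h 6 (by omega)).trans (by
    rw [map_neg C, map_neg C, neg_mul, neg_mul, ← neg_add]; rfl)

theorem normalForm_odd (c p α β : SmoothFn J) (n : ℕ) (hn : Odd n) :
    normalForm c p α β n = 0 := by
  match n, hn with
  | 1, _ => rfl
  | 2, h => exact absurd h (by decide)
  | 3, _ => rfl
  | 4, h => exact absurd h (by decide)
  | 5, _ => rfl
  | 6, h => exact absurd h (by decide)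
  | _ + 7, _ => rfl

theorem isGraded_normalForm (c p α β : SmoothFn J) :
    IsGraded (smoothDeriv J) (normalForm c p α β) := by
  have h := isNormalized_of_eq (H := normalForm c p α β) fun _ _ => rfl
  intro n
  match n with
  | 0 => exact ⟨_, isHom_C _, h.zero.symm⟩
  | 1 => exact ⟨0, isWeightedHomogeneous_zero _ _ _, (map_zero _).trans h.one.symm⟩
  | 2 => exact ⟨_, isHom_C_mul_X_pow _ 0 2, h.two.symm⟩
  | 3 => exact ⟨0, isWeightedHomogeneous_zero _ _ _, (map_zero _).trans h.three.symm⟩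
  | 4 => exact ⟨_, isHom_C_mul_X_pow _ 1 2, h.four.symm⟩
  | 5 => exact ⟨0, isWeightedHomogeneous_zero _ _ _, (map_zero _).trans h.five.symm⟩
  | 6 => exact ⟨_, (isHom_C_mul_X_pow _ 2 2).add (isHom_C_mul_X_pow _ 1 3), h.six.symm⟩
  | _ + 7 => exact ⟨0, isWeightedHomogeneous_zero _ _ _, map_zero _⟩

/-- Substituting a = -c/2 and m = -α gives one quarter of the difference of the two sides. The form
without division by c also makes sense at zeros of c. -/
theorem obstruction_eq_zero_iff (c p α : SmoothFn J) :
    obstruction (smoothDeriv J) (-((1 / 2 : ℝ) • c)) p (-α) = 0 ↔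
      ∀ u : J, 80 * (p : J → ℝ) u ^ 2 -
        67 * (p : J → ℝ) u * (c : J → ℝ) u * (smoothDeriv J c : J → ℝ) u +
        33 * (c : J → ℝ) u ^ 2 * (smoothDeriv J p : J → ℝ) u +
        12 * (c : J → ℝ) u ^ 2 * (smoothDeriv J c : J → ℝ) u ^ 2 -
        9 * (c : J → ℝ) u ^ 3 * (smoothDeriv J (smoothDeriv J c) : J → ℝ) u =
        28 * (c : J → ℝ) u * (α : J → ℝ) u := by
  have key : ∀ u : J, ((obstruction (smoothDeriv J) (-((1 / 2 : ℝ) • c)) p (-α) :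
      SmoothFn J) : J → ℝ) u = (80 * (p : J → ℝ) u ^ 2 -
        67 * (p : J → ℝ) u * (c : J → ℝ) u * (smoothDeriv J c : J → ℝ) u +
        33 * (c : J → ℝ) u ^ 2 * (smoothDeriv J p : J → ℝ) u +
        12 * (c : J → ℝ) u ^ 2 * (smoothDeriv J c : J → ℝ) u ^ 2 -
        9 * (c : J → ℝ) u ^ 3 * (smoothDeriv J (smoothDeriv J c) : J → ℝ) u -
        28 * (c : J → ℝ) u * (α : J → ℝ) u) / 4 := by
    intro u
    let ev : SmoothFn J →ₐ[ℝ] ℝ := (Pi.evalAlgHom ℝ (fun _ : J => ℝ) u).comp (SmoothFn J).val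
    change ev (obstruction (smoothDeriv J) (-((1 / 2 : ℝ) • c)) p (-α)) =
      (80 * ev p ^ 2 - 67 * ev p * ev c * ev (smoothDeriv J c) +
      33 * ev c ^ 2 * ev (smoothDeriv J p) + 12 * ev c ^ 2 * ev (smoothDeriv J c) ^ 2 -
      9 * ev c ^ 3 * ev (smoothDeriv J (smoothDeriv J c)) - 28 * ev c * ev α) / 4
    simp only [obstruction, Derivation.map_smul, map_add, map_sub, map_mul,
      map_neg, map_smul, map_ofNat, smul_eq_mul]
    ring
  constructor
  · intro h u
    have h1 := key u
    rw [h] at h1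
    have h2 : (((0 : SmoothFn J) : J → ℝ)) u = 0 := rfl
    linarith
  · intro h
    ext u
    rw [key, h, sub_self, zero_div]
    rfl

end

end JetCalculus


/-! ### The theorem -/

open JetCalculus in
theorem theorem3p1 (J : TopologicalSpace.Opens ℝ) (hJ : (J : Set ℝ).OrdConnected) :
    -- every perturbation is reduced by a canonical transformation to the normal form up to order 6
    (∀ H : HamSeries (smoothDeriv J),
      IsGraded (smoothDeriv J) H →
      H 0 = functionalOf (smoothDeriv J) (cubicHopf J) →
      ∃ K : HamSeries (smoothDeriv J), IsGraded (smoothDeriv J) K ∧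
        ∃ c p α β : SmoothFn J,
          IsBigOEps (smoothDeriv J)
            (canonicalTransform (smoothDeriv J) K H - normalForm c p α β) 7) ∧
    -- every normal form is 7-integrable
    (∀ c p α β : SmoothFn J, IsNIntegrable 7 (normalForm c p α β)) ∧
    -- criterion for 9-integrability
    (∀ c p α β : SmoothFn J,
      (∀ u : J, (c : J → ℝ) u ≠ 0 ∨ (p : J → ℝ) u ≠ 0) →
      (ExtendsToNIntegrable 9 (normalForm c p α β) ↔
        (∀ u : J, (c : J → ℝ) u ≠ 0) ∧
        ∀ u : J, (α : J → ℝ) u =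
          1 / 28 *
            (80 * ((p : J → ℝ) u ^ 2 / (c : J → ℝ) u)
              - 67 * (p : J → ℝ) u * (smoothDeriv J c : J → ℝ) u
              + 33 * (c : J → ℝ) u * (smoothDeriv J p : J → ℝ) u
              + 12 * (c : J → ℝ) u * (smoothDeriv J c : J → ℝ) u ^ 2
              - 9 * (c : J → ℝ) u ^ 2 * (smoothDeriv J (smoothDeriv J c) : J → ℝ) u))) := by
  have hD := smoothDeriv_surjective hJ
  have h3 := smoothDeriv_cubicHopf (J := J)
  refine ⟨fun H hH h0 => ?_, fun c p α β => ?_, fun c p α β hcp => ⟨?_, ?_⟩⟩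
  · obtain ⟨K, hK, -, h⟩ := exists_canonicalTransform_residual hD h3 hH h0 6
    obtain ⟨e1, he1, hr1, h1⟩ := h 0 (by omega)
    obtain ⟨e2, he2, hr2, h2⟩ := h 1 (by omega)
    obtain ⟨e3, he3, hr3, h3⟩ := h 2 (by omega)
    obtain ⟨e4, he4, hr4, h4⟩ := h 3 (by omega)
    obtain ⟨e5, he5, hr5, h5⟩ := h 4 (by omega)
    obtain ⟨e6, he6, hr6, h6⟩ := h 5 (by omega)
    obtain ⟨a, rfl⟩ := residual_two he2 hr2
    obtain ⟨p, rfl⟩ := residual_four he4 hr4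
    obtain ⟨m, n, rfl⟩ := residual_six he6 hr6
    rw [eq_zero_of_residual (by omega) he1 hr1, map_zero] at h1
    rw [eq_zero_of_residual (by omega) he3 hr3, map_zero] at h3
    rw [eq_zero_of_residual (by omega) he5 hr5, map_zero] at h5
    -- The coefficient of u_x² is a = -c/2, hence c = -2a; the sixth-order coefficients change sign
    -- in the same way.
    have hn := isNormalized_of_eq
      (H := normalForm ((-2 : ℝ) • a) p (-m) (-n)) fun _ _ => rfl
    refine ⟨K, hK, (-2 : ℝ) • a, p, -m, -n, fun k hk => sub_eq_zero.mpr ?_⟩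
    interval_cases k
    · rw [hn.zero, ← h0]
      simp [canonicalTransform]
    · exact h1.trans hn.one.symm
    · rw [hn.two, smul_smul]
      norm_num
      exact h2
    · exact h3.trans hn.three.symm
    · exact h4.trans hn.four.symm
    · exact h5.trans hn.five.symm
    · rw [hn.six, neg_neg, neg_neg]
      exact h6
  · refine isIntegrableOf_of_commuting hD h3 (isGraded_normalForm c p α β) rfl fun f => ?_
    obtain ⟨F, hF, hF0, -, -, hHF⟩ := exists_commuting_series hD h3
      (isGraded_normalForm c p α β) rfl (normalForm_odd c p α β) f
    exact ⟨F, hF, hF0, hHF⟩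
  · rintro ⟨H, -, hH, hint⟩
    have hob := (obstruction_eq_zero_iff c p α).mp
      (obstruction_eq_zero hD h3 (isNormalized_of_eq hH) hint)
    -- At a zero of c the condition collapses to 80 p² = 0, so c and p would have a common zero.
    have hc : ∀ u : J, (c : J → ℝ) u ≠ 0 := fun u hu => by
      have h1 := hob u
      rw [hu] at h1
      refine (hcp u).elim (fun h => h hu) fun h => h ?_
      have h2 : (p : J → ℝ) u ^ 2 = 0 := by linarith
      exact pow_eq_zero_iff two_ne_zero |>.mp h2
    refine ⟨hc, fun u => ?_⟩
    have h1 := hc u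
    have h2 := hob u
    field_simp
    linear_combination -h2
  · rintro ⟨hc, hα⟩
    -- The normal form with no further terms already serves as the extension.
    refine ⟨_, isGraded_normalForm c p α β, fun _ _ => rfl,
      isIntegrableOf_nine hD h3 (isGraded_normalForm c p α β)
        (isNormalized_of_eq (c := c) (p := p) (α := α) (β := β) fun _ _ => rfl)
        (normalForm_odd c p α β) rfl ((obstruction_eq_zero_iff c p α).mpr fun u => ?_)⟩
    have h1 := hc u
    rw [hα u]
    field_simp
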